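/- Let $k$ be a field of characteristic different from $2$ and $3$. For $\Gamma=\operatorname{diag}(\gamma_1,\gamma_2,\gamma_3)\in GL_3(k)$ and a composition algebra $(C,N)$ over $k$ (a nonzero unital, not necessarily associative algebra with a non-degenerate multiplicative quadratic form $N$, and conjugation $x\mapsto\bar x$), let $\mathcal H_3(C,\Gamma)=\{X\in M_3(C):\Gamma^{-1}\overline{X}^{\,t}\Gamma=X\}$ with the product $X\cdot Y=\tfrac12(XY+YX)$; these are the reduced Freudenthal algebras over $k$. In particular, $k$ with the norm $x\mapsto x^2$ is a composition algebra. A (not necessarily associative) $k$-algebra $A$ is a Freudenthal algebra if, for some field extension $K/k$, $A\otimes_kK$ is isomorphic to a reduced Freudenthal algebra over $K$. A quaternion algebra over $k$ is a composition algebra of dimension $4$; isomorphisms of quaternion algebras are isomorphisms of the underlying algebras. Let $V=k^6$ with basis $e_1,\dots,e_6$, let $Sp_6=\{g\in GL_6: gMg^t=M\}$ with $M=\begin{pmatrix}0&I_3\\-I_3&0\end{pmatrix}$, let $X(k)\subset\wedge^3V$ be the span of the $Sp_6(k)$-orbit of $e_1\wedge e_2\wedge e_3$, and let $X_2(k)$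 be the set of all $x\in X(k)$ that lie, over the algebraic closure $\bar k$, in the $Sp_6(\bar k)$-orbit of $e_1\wedge e_4\wedge e_3+e_5\wedge e_2\wedge e_3+e_1\wedge e_2\wedge e_6$. Then: 1. There is a bijection $\Phi$ from the set of isomorphism classes of the algebras $\mathcal H_3(k,\Gamma)$, where $\Gamma=\operatorname{diag}(\gamma_1,\gamma_2,\gamma_3)$ varies over the diagonal matrices in $GL_3(k)$, onto the set of isomorphism classes of quaternion algebras over $k$, such that $\Phi$ maps the class of $\mathcal H_3(k,\Gamma)$ to the class of $Q$ if and only if the norm form of $Q$ is isometric to $\langle 1,\gamma_2\gamma_3^{-1},\gamma_3\gamma_1^{-1},\gamma_1\gamma_2^{-1}\rangle$. 2. There is a bijection $\Psi$ from the orbit space $X_2(k)/Sp_6(k)$ onto the set of isomorphism classes of quaternion algebras over $k$ such that, for all $a,b,c\in k^\times$, the element $x=a\,e_4\wedge e_2\wedge e_3+b\,e_1\wedge e_5\wedge e_3+c\,e_1\wedge e_2\wedge e_6$ lies in $X_2(k)$, and $\Psi$ maps the orbit of $x$ to the class of $Q$ if and only if the norm form of $Q$ is isometric to $\langle 1,bc,ca,ab\rangle$.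 3. A $k$-algebra $A$ is a Freudenthal algebra of dimension $6$ over $k$ if and only if $A\cong\mathcal H_3(k,\Gamma)$ for some $\Gamma=\operatorname{diag}(\gamma_1,\gamma_2,\gamma_3)\in GL_3(k)$. -/

import Mathlib

open scoped TensorProduct

universe u v


namespace Freud

/-! ### Composition algebras -/

section Composition

variable {k C : Type*} [Field k] [NonAssocRing C] [Module k C]
  [IsScalarTower k C C] [SMulCommClass k C C]

/-- `(C, N)` is a composition algebra over `k`: a nonzero unital, not necessarily associative
`k`-algebra `C` with a non-degenerate multiplicative quadratic form `N`.  Non-degeneracy refers to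
the bilinear form `b_N(x, y) = N(x + y) - N(x) - N(y)`. -/
class IsComposition (N : QuadraticForm k C) : Prop where
  nontrivial : Nontrivial C
  nondegenerate : ∀ x : C, (∀ y : C, QuadraticMap.polar N x y = 0) → x = 0
  map_mul : ∀ x y : C, N (x * y) = N x * N y

/-- The conjugation `x ↦ b_N(x, 1) 1 - x` of a composition algebra. -/
def conj (N : QuadraticForm k C) : C →ₗ[k] C :=
  (LinearMap.toSpanSingleton k C 1).comp (N.polarBilin.flip 1) - LinearMap.id

theorem conj_apply (N : QuadraticForm k C) (x : C) :
    conj N x = QuadraticMap.polar N x 1 • (1 : C) - x := by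
  simp [conj]

section

variable (N : QuadraticForm k C) [hN : IsComposition N]

theorem map_one_eq : N 1 = 1 := by
  by_contra h
  have h0 : ∀ x, N x = 0 := by
    intro x
    have := hN.map_mul 1 x
    rw [one_mul] at this
    by_contra hx
    exact h (mul_right_cancel₀ hx (by rw [one_mul]; exact this.symm))
  obtain ⟨x, y, hxy⟩ := hN.nontrivial.exists_pair_ne
  have hz : ∀ z : C, z = 0 := fun z =>
    hN.nondegenerate z fun w => by simp [QuadraticMap.polar, h0]
  exact hxy ((hz x).trans (hz y).symm)

theorem polar_mul_left (x y z : C) :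
    QuadraticMap.polar N (x * y) (x * z) = N x * QuadraticMap.polar N y z := by
  simp only [QuadraticMap.polar, ← mul_add, hN.map_mul, mul_sub]

theorem polar_mul_add (x w y z : C) :
    QuadraticMap.polar N (x * y) (w * z) + QuadraticMap.polar N (w * y) (x * z) =
      QuadraticMap.polar N x w * QuadraticMap.polar N y z := by
  have h := polar_mul_left N (x + w) y z
  have hx := polar_mul_left N x y z
  have hw := polar_mul_left N w y z
  simp only [add_mul, QuadraticMap.polar_add_left, QuadraticMap.polar_add_right] at h
  have e : N (x + w) = QuadraticMap.polar N x w + N x + N w := by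
    simp only [QuadraticMap.polar]; ring
  rw [e] at h
  linear_combination h - hx - hw

theorem polar_mul_eq_left (x y z : C) :
    QuadraticMap.polar N (x * y) z = QuadraticMap.polar N y (conj N x * z) := by
  have h := polar_mul_add N x 1 y z
  simp only [one_mul] at h
  rw [conj_apply, sub_mul, smul_mul_assoc, one_mul, QuadraticMap.polar_sub_right,
    QuadraticMap.polar_smul_right, smul_eq_mul]
  linear_combination h

theorem polar_mul_eq_right (x y z : C) :
    QuadraticMap.polar N (x * y) z = QuadraticMap.polar N x (z * conj N y) := by
  have h := polar_mul_add N x z y 1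
  simp only [mul_one] at h
  rw [conj_apply, mul_sub, mul_smul_comm, mul_one, QuadraticMap.polar_sub_right,
    QuadraticMap.polar_smul_right, smul_eq_mul]
  rw [QuadraticMap.polar_comm N (z * y) x] at h
  linear_combination h

theorem conj_conj (x : C) : conj N (conj N x) = x := by
  have h1 : QuadraticMap.polar N (1 : C) 1 = 2 := by
    have := QuadraticMap.polar_self N (1 : C)
    rw [map_one_eq N] at this
    simpa using this
  rw [conj_apply N (conj N x), conj_apply N x, QuadraticMap.polar_sub_left,
    QuadraticMap.polar_smul_left, h1, smul_eq_mul,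
    show QuadraticMap.polar N x 1 * 2 - QuadraticMap.polar N x 1 = QuadraticMap.polar N x 1 by ring]
  abel

theorem polar_conj (x y : C) :
    QuadraticMap.polar N (conj N x) y = QuadraticMap.polar N x (conj N y) := by
  rw [conj_apply, conj_apply, QuadraticMap.polar_sub_left, QuadraticMap.polar_sub_right,
    QuadraticMap.polar_smul_left, QuadraticMap.polar_smul_right, smul_eq_mul, smul_eq_mul,
    QuadraticMap.polar_comm N 1 y]
  ring

theorem conj_mul (x y : C) : conj N (x * y) = conj N y * conj N x := by
  rw [← sub_eq_zero]
  refine hN.nondegenerate _ fun z => ?_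
  rw [QuadraticMap.polar_sub_left, sub_eq_zero, polar_conj, QuadraticMap.polar_comm,
    polar_mul_eq_left N (conj N y), conj_conj, QuadraticMap.polar_comm N (conj N x),
    polar_mul_eq_right N y z, QuadraticMap.polar_comm N y, polar_mul_eq_left N (conj N x),
    conj_conj]

end

/-- The `k`-algebra `k` with the norm `x ↦ x ^ 2` is a composition algebra. -/
instance isComposition_sq [NeZero (2 : k)] :
    IsComposition (QuadraticMap.sq : QuadraticForm k k) where
  nontrivial := inferInstance
  nondegenerate x h := by
    have h1 := h 1
    simp only [QuadraticMap.polar, QuadraticMap.sq_apply] at h1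
    have h2 : (2 : k) * x = 0 := by linear_combination h1
    exact (mul_eq_zero.mp h2).resolve_left (NeZero.ne _)
  map_mul x y := by simp only [QuadraticMap.sq_apply]; ring

/-! ### Reduced Freudenthal algebras -/

/-- The map `X ↦ Γ⁻¹ X̄ᵗ Γ` on `M₃(C)`, where `Γ = diag(γ₀, γ₁, γ₂) ∈ GL₃(k)`. -/
def starGamma (N : QuadraticForm k C) (γ : Fin 3 → kˣ) (X : Matrix (Fin 3) (Fin 3) C) :
    Matrix (Fin 3) (Fin 3) C :=
  Matrix.of fun i j => (((γ i)⁻¹ * γ j : kˣ) : k) • conj N (X j i)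

/-- The subspace `H₃(C, Γ) = {X ∈ M₃(C) | Γ⁻¹ X̄ᵗ Γ = X}` of `M₃(C)`. -/
def H3 (N : QuadraticForm k C) (γ : Fin 3 → kˣ) : Submodule k (Matrix (Fin 3) (Fin 3) C) where
  carrier := {X | starGamma N γ X = X}
  add_mem' {X Y} hX hY := by
    have hX' : starGamma N γ X = X := hX
    have hY' : starGamma N γ Y = Y := hY
    change starGamma N γ (X + Y) = X + Y
    conv_rhs => rw [← hX', ← hY']
    ext i j
    simp [starGamma]
  zero_mem' := by
    change starGamma N γ 0 = 0
    ext i j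
    simp [starGamma]
  smul_mem' c X hX := by
    have hX' : starGamma N γ X = X := hX
    change starGamma N γ (c • X) = c • X
    conv_rhs => rw [← hX']
    ext i j
    simp only [starGamma, Matrix.of_apply, Matrix.smul_apply, map_smul]
    rw [smul_comm]

theorem starGamma_mul (N : QuadraticForm k C) [IsComposition N] (γ : Fin 3 → kˣ)
    (X Y : Matrix (Fin 3) (Fin 3) C) :
    starGamma N γ (X * Y) = starGamma N γ Y * starGamma N γ X := by
  ext i j
  simp only [starGamma, Matrix.of_apply, Matrix.mul_apply, map_sum, conj_mul, Finset.smul_sum]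
  refine Finset.sum_congr rfl fun l _ => ?_
  rw [smul_mul_smul_comm, ← Units.val_mul]
  congr 2
  group

theorem jordan_mem (N : QuadraticForm k C) [IsComposition N] (γ : Fin 3 → kˣ)
    {X Y : Matrix (Fin 3) (Fin 3) C} (hX : X ∈ H3 N γ) (hY : Y ∈ H3 N γ) :
    (2⁻¹ : k) • (X * Y + Y * X) ∈ H3 N γ := by
  refine (H3 N γ).smul_mem _ ?_
  have hX' : starGamma N γ X = X := hX
  have hY' : starGamma N γ Y = Y := hY
  change starGamma N γ (X * Y + Y * X) = X * Y + Y * X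
  have hadd : starGamma N γ (X * Y + Y * X) = starGamma N γ (X * Y) + starGamma N γ (Y * X) := by
    ext i j
    simp [starGamma]
  rw [hadd, starGamma_mul, starGamma_mul, hX', hY', add_comm]

/-- The product `X . Y = (XY + YX) / 2` on `H₃(C, Γ)`. -/
instance (N : QuadraticForm k C) [IsComposition N] (γ : Fin 3 → kˣ) : Mul (H3 N γ) where
  mul X Y := ⟨(2⁻¹ : k) • (X.1 * Y.1 + Y.1 * X.1), jordan_mem N γ X.2 Y.2⟩

theorem coe_mul (N : QuadraticForm k C) [IsComposition N] (γ : Fin 3 → kˣ) (X Y : H3 N γ) :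
    ((X * Y : H3 N γ) : Matrix (Fin 3) (Fin 3) C) = (2⁻¹ : k) • (X.1 * Y.1 + Y.1 * X.1) := rfl

instance (N : QuadraticForm k C) [IsComposition N] (γ : Fin 3 → kˣ) :
    NonUnitalNonAssocRing (H3 N γ) :=
  { (inferInstance : AddCommGroup (H3 N γ)), (inferInstance : Mul (H3 N γ)) with
    left_distrib := fun X Y Z => by
      apply Subtype.ext
      simp only [coe_mul, Submodule.coe_add, mul_add, add_mul, ← smul_add]
      congr 1
      abel
    right_distrib := fun X Y Z => by
      apply Subtype.ext
      simp only [coe_mul, Submodule.coe_add, mul_add, add_mul, ← smul_add]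
      congr 1
      abel
    zero_mul := fun X => by
      apply Subtype.ext
      simp [coe_mul]
    mul_zero := fun X => by
      apply Subtype.ext
      simp [coe_mul] }

end Composition

/-- Two (not necessarily associative or unital) `k`-algebras are isomorphic. -/
def AlgIso (k A B : Type*) [Field k] [NonUnitalNonAssocRing A] [Module k A]
    [NonUnitalNonAssocRing B] [Module k B] : Prop :=
  ∃ f : A →ₙₐ[k] B, Function.Bijective f

theorem AlgIso.refl (k A : Type*) [Field k] [NonUnitalNonAssocRing A] [Module k A] :
    AlgIso k A A :=
  ⟨NonUnitalAlgHom.id k A, Function.bijective_id⟩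

theorem AlgIso.symm {k A B : Type*} [Field k] [NonUnitalNonAssocRing A] [Module k A]
    [NonUnitalNonAssocRing B] [Module k B] (h : AlgIso k A B) : AlgIso k B A := by
  obtain ⟨f, hf⟩ := h
  obtain ⟨g, hg1, hg2⟩ := Function.bijective_iff_has_inverse.mp hf
  exact ⟨f.inverse g hg1 hg2, Function.bijective_iff_has_inverse.mpr ⟨f, hg2, hg1⟩⟩

theorem AlgIso.trans {k A B D : Type*} [Field k] [NonUnitalNonAssocRing A] [Module k A]
    [NonUnitalNonAssocRing B] [Module k B] [NonUnitalNonAssocRing D] [Module k D]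
    (h : AlgIso k A B) (h' : AlgIso k B D) : AlgIso k A D := by
  obtain ⟨f, hf⟩ := h
  obtain ⟨g, hg⟩ := h'
  exact ⟨g.comp f, hg.comp hf⟩

/-- A `k`-algebra `A` is a Freudenthal algebra if `K ⊗ A` is isomorphic to a reduced Freudenthal
algebra `H₃(C, Γ)` over `K`, for some field extension `K / k` and some composition algebra `C`
over `K`. -/
def IsFreudenthal (k : Type u) (A : Type v) [Field k] [NonUnitalNonAssocRing A] [Module k A]
    [IsScalarTower k A A] [SMulCommClass k A A] : Prop :=
  ∃ (K : Type u) (_ : Field K) (_ : Algebra k K) (C : Type u) (_ : NonAssocRing C) (_ : Module K C)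
    (_ : IsScalarTower K C C) (_ : SMulCommClass K C C) (N : QuadraticForm K C)
    (_ : IsComposition N) (γ : Fin 3 → Kˣ), AlgIso K (K ⊗[k] A) (H3 N γ)

/-- `H₃(k, Γ)`, where `k` is the one-dimensional composition algebra with norm `x ↦ x ^ 2`. -/
abbrev H3k {k : Type u} [Field k] (γ : Fin 3 → kˣ) : Submodule k (Matrix (Fin 3) (Fin 3) k) :=
  H3 (QuadraticMap.sq : QuadraticForm k k) γ

/-- `Γ ∼ Γ'` if and only if `H₃(k, Γ) ≃ H₃(k, Γ')`. -/
def h3Setoid (k : Type u) [Field k] [NeZero (2 : k)] : Setoid (Fin 3 → kˣ) where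
  r γ γ' := AlgIso k (H3k γ) (H3k γ')
  iseqv := ⟨fun _ => AlgIso.refl _ _, fun h => h.symm, fun h h' => h.trans h'⟩

/-- The isomorphism classes of the algebras `H₃(k, Γ)`. -/
abbrev H3Classes (k : Type u) [Field k] [NeZero (2 : k)] : Type u := Quotient (h3Setoid k)

/-! ### Quaternion algebras -/

/-- A quaternion algebra over `k`: a composition algebra of dimension `4`. -/
structure QuatAlg (k : Type u) [Field k] where
  carrier : Type u
  [ring : NonAssocRing carrier]
  [module : Module k carrier]
  [scalarTower : IsScalarTower k carrier carrier]
  [smulComm : SMulCommClass k carrier carrier]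
  norm : QuadraticForm k carrier
  isComposition : IsComposition norm
  finrank_eq : Module.finrank k carrier = 4

attribute [instance] QuatAlg.ring QuatAlg.module QuatAlg.scalarTower QuatAlg.smulComm

/-- An isomorphism of quaternion algebras is an isomorphism of the underlying algebras. -/
def quatSetoid (k : Type u) [Field k] : Setoid (QuatAlg k) where
  r Q Q' := AlgIso k Q.carrier Q'.carrier
  iseqv := ⟨fun _ => AlgIso.refl _ _, fun h => h.symm, fun h h' => h.trans h'⟩

/-- The isomorphism classes of quaternion algebras over `k`. -/
abbrev QuatClasses (k : Type u) [Field k] : Type (u + 1) := Quotient (quatSetoid k)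

/-! ### The representation of `Sp₆` -/

section Representation

/-- `Λ³ V` for `V = F⁶`, with the basis `e₁, …, e₆` of `V` indexed by `Fin 3 ⊕ Fin 3`. -/
abbrev Trivec (F : Type*) [Field F] := ⋀[F]^3 (Fin 3 ⊕ Fin 3 → F)

/-- The basis vectors `e₁, e₂, e₃` of `V`, with indices `0, 1, 2`. -/
def eL (F : Type*) [Field F] (i : Fin 3) : Fin 3 ⊕ Fin 3 → F := Pi.single (Sum.inl i) 1

/-- The basis vectors `e₄, e₅, e₆` of `V`, with indices `0, 1, 2`. -/
def eR (F : Type*) [Field F] (i : Fin 3) : Fin 3 ⊕ Fin 3 → F := Pi.single (Sum.inr i) 1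

/-- The trivector `u ∧ v ∧ w`. -/
noncomputable def wedge {F : Type*} [Field F] (u v w : Fin 3 ⊕ Fin 3 → F) : Trivec F :=
  exteriorPower.ιMulti F 3 ![u, v, w]

/-- The action of `Sp₆(F)` on `Λ³ V` induced by its natural action on `V`. -/
noncomputable def spAct {F : Type*} [Field F] (g : Matrix.symplecticGroup (Fin 3) F) :
    Trivec F →ₗ[F] Trivec F :=
  exteriorPower.map 3 (Matrix.toLin' (g : Matrix (Fin 3 ⊕ Fin 3) (Fin 3 ⊕ Fin 3) F))

theorem spAct_one {F : Type*} [Field F] (x : Trivec F) :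
    spAct (1 : Matrix.symplecticGroup (Fin 3) F) x = x := by
  simp [spAct, Matrix.toLin'_one]

theorem spAct_mul {F : Type*} [Field F] (g h : Matrix.symplecticGroup (Fin 3) F)
    (x : Trivec F) : spAct (g * h) x = spAct g (spAct h x) := by
  simp only [spAct, Submonoid.coe_mul, Matrix.toLin'_mul]
  rw [exteriorPower.map_comp, LinearMap.comp_apply]

/-- The representation `X` of `Sp₆`: the span of the orbit of `e₁ ∧ e₂ ∧ e₃`. -/
def X (F : Type*) [Field F] : Submodule F (Trivec F) :=
  Submodule.span F (Set.range fun g : Matrix.symplecticGroup (Fin 3) F =>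
    spAct g (wedge (eL F 0) (eL F 1) (eL F 2)))

/-- The extension of scalars `Λ³ (k⁶) → Λ³ (K⁶)`, `u ∧ v ∧ w ↦ u ∧ v ∧ w`. -/
noncomputable def extend (k K : Type*) [Field k] [Field K] [Algebra k K] :
    Trivec k →ₗ[k] Trivec K :=
  exteriorPower.alternatingMapLinearEquiv
    (AlternatingMap.compLinearMap
      { (exteriorPower.ιMulti K 3 (M := Fin 3 ⊕ Fin 3 → K)).toMultilinearMap.restrictScalars k with
        map_eq_zero_of_eq' := (exteriorPower.ιMulti K 3).map_eq_zero_of_eq' }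
      ((Algebra.linearMap k K).compLeft (Fin 3 ⊕ Fin 3)))

theorem extend_wedge (k K : Type*) [Field k] [Field K] [Algebra k K]
    (u v w : Fin 3 ⊕ Fin 3 → k) :
    extend k K (wedge u v w) =
      wedge (algebraMap k K ∘ u) (algebraMap k K ∘ v) (algebraMap k K ∘ w) := by
  rw [extend, wedge, exteriorPower.alternatingMapLinearEquiv_apply_ιMulti]
  change exteriorPower.ιMulti K 3 _ = _
  congr 1
  funext i
  fin_cases i <;> rfl

/-- The element `a e₄ ∧ e₂ ∧ e₃ + b e₁ ∧ e₅ ∧ e₃ + c e₁ ∧ e₂ ∧ e₆`. -/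
noncomputable def diagElt {F : Type*} [Field F] (a b c : F) : Trivec F :=
  a • wedge (eR F 0) (eL F 1) (eL F 2) + b • wedge (eL F 0) (eR F 1) (eL F 2) +
    c • wedge (eL F 0) (eL F 1) (eR F 2)

/-- `X₂(k)`: the `k`-rational points of the `Sp₆`-orbit (over the algebraic closure) of
`e₁ ∧ e₄ ∧ e₃ + e₅ ∧ e₂ ∧ e₃ + e₁ ∧ e₂ ∧ e₆`. -/
def X2 (k : Type u) [Field k] : Set (Trivec k) :=
  {x | x ∈ X k ∧ ∃ g : Matrix.symplecticGroup (Fin 3) (AlgebraicClosure k),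
    extend k (AlgebraicClosure k) x =
      spAct g (wedge (eL _ 0) (eR _ 0) (eL _ 2) + wedge (eR _ 1) (eL _ 1) (eL _ 2) +
        wedge (eL _ 0) (eL _ 1) (eR _ 2))}

/-- Two points of `X₂(k)` are equivalent if they lie in the same `Sp₆(k)`-orbit. -/
def x2Setoid (k : Type u) [Field k] : Setoid (X2 k) where
  r x y := ∃ g : Matrix.symplecticGroup (Fin 3) k, spAct g x.1 = y.1
  iseqv := by
    refine ⟨fun x => ⟨1, spAct_one _⟩, ?_, ?_⟩
    · rintro x y ⟨g, hg⟩
      exact ⟨g⁻¹, by rw [← hg, ← spAct_mul, inv_mul_cancel, spAct_one]⟩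
    · rintro x y z ⟨g, hg⟩ ⟨h, hh⟩
      exact ⟨h * g, by rw [spAct_mul, hg, hh]⟩

/-- The orbit space `X₂(k) / Sp₆(k)`. -/
abbrev X2Orbits (k : Type u) [Field k] : Type u := Quotient (x2Setoid k)

end Representation

/-- The diagonal quaternary quadratic form `⟨a, b, c, d⟩`. -/
abbrev diagForm {k : Type u} [Field k] (a b c d : k) : QuadraticForm k (Fin 4 → k) :=
  QuadraticMap.weightedSumSquares k ![a, b, c, d]

end Freud

open Freud

/-! A quaternion algebra is determined by its norm form, and every `⟨1, -a, -b, ab⟩` is such a norm,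
so parts 1 and 2 reduce to attaching ternary forms of square determinant to the algebras and to the
orbits. For `H₃(k, Γ)` the trace form `Y ↦ tr(Y²)` is `⟨1, 1, 1⟩` plus twice
`⟨γ₂γ₃⁻¹, γ₃γ₁⁻¹, γ₁γ₂⁻¹⟩`, and Witt cancellation recovers the ternary form. For a trivector `x`,
contracting `x ⊗ x` twice with the symplectic form gives a symmetric `6 × 6` matrix, quadratic in
`x` and equivariant under `Sp₆`. On `X₂(k)` it has rank three and its columns span a Lagrangian
subspace defined over `k`; moving this subspace to `⟨e₁, e₂, e₃⟩` makes `x` a symmetric `3 × 3`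
matrix, which can be diagonalised, and the `6 × 6` matrix of the resulting diagonal trivector
recovers its form.

For part 3, an algebra of dimension six which becomes reduced Freudenthal over `K` has coordinate
algebra of dimension one, and over the algebraic closure of `K` it embeds as a Jordan algebra `J`,
linear over `k` only, of symmetric `3 × 3` matrices with traces in `k`. The commutators of elements
of `J` are alternating matrices; for their axial vectors `s` and `t`, the matrices `s tᵀ + t sᵀ` lie
in `J`. A basis of such vectors has its Gram matrix over `k`, and this exhibits `J` as some
`H₃(k, Γ)`. -/

namespace Freud

open scoped Quaternion

open Matrix
open QuadraticMap (Equivalent polar weightedSumSquares)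

/-! ### Quadratic forms -/

section QuadraticForms

variable {k V V' : Type*} [Field k] [AddCommGroup V] [Module k V] [AddCommGroup V'] [Module k V']

theorem polar_isometryEquiv {Q : QuadraticForm k V} {Q' : QuadraticForm k V'}
    (f : Q.IsometryEquiv Q') (x y : V) : polar Q' (f x) (f y) = polar Q x y := by
  simp only [polar, ← map_add, QuadraticMap.IsometryEquiv.map_app]

theorem injective_of_isometry {Q : QuadraticForm k V} {Q' : QuadraticForm k V'}
    (hQ : ∀ x, (∀ y, polar Q x y = 0) → x = 0) {f : V →ₗ[k] V'} (hf : ∀ x, Q' (f x) = Q x) :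
    Function.Injective f := by
  refine LinearMap.ker_eq_bot.mp (LinearMap.ker_eq_bot'.mpr fun x hx => hQ x fun y => ?_)
  have hpolar : polar Q' (f x) (f y) = polar Q x y := by simp only [polar, ← map_add, hf]
  rw [← hpolar, hx, QuadraticMap.polar_zero_left]

theorem exists_anisotropic_orthogonal [NeZero (2 : k)] {ι : Type*} [Fintype ι]
    {Q : QuadraticForm k V} (hQ : ∀ x, (∀ y, polar Q x y = 0) → x = 0) {v : ι → V}
    (hv : Pairwise fun i j => polar Q (v i) (v j) = 0) (hv0 : ∀ i, Q (v i) ≠ 0)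
    (hcard : Fintype.card ι < Module.finrank k V) :
    ∃ x, Q x ≠ 0 ∧ ∀ i, polar Q x (v i) = 0 := by
  classical
  have : Module.Finite k V := Module.finite_of_finrank_pos (by lia)
  by_contra! hcon
  let p : V →ₗ[k] (ι → k) := LinearMap.pi fun i => Q.polarBilin.flip (v i)
  have hp (x i) : p x i = polar Q x (v i) := rfl
  have hzero {x} (hx : p x = 0) : Q x = 0 := by
    by_contra h
    obtain ⟨i, hi⟩ := hcon x h
    exact hi (congrFun hx i)
  have hker : LinearMap.ker p ≠ ⊥ := LinearMap.ker_ne_bot_of_finrank_lt (by simpa using hcard)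
  obtain ⟨x, hx, hx0⟩ := (Submodule.ne_bot_iff _).mp hker
  have hx' : p x = 0 := hx
  refine hx0 (hQ x fun y => ?_)
  let y' := y - ∑ i, (polar Q y (v i) / (2 * Q (v i))) • v i
  have hy' : p y' = 0 := by
    have hself (i) : p (v i) = Pi.single i (2 * Q (v i)) := by
      ext j
      obtain rfl | hij := eq_or_ne i j
      · simp [hp, QuadraticMap.polar_self]
      · simp [hp, hv hij, hij.symm]
    ext j
    change p (y - ∑ i, (polar Q y (v i) / (2 * Q (v i))) • v i) j = 0
    simp only [map_sub, map_sum, map_smul, hself, Pi.sub_apply, Finset.sum_apply,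
      Pi.smul_apply, smul_eq_mul, Pi.single_apply, mul_ite, mul_zero, Finset.sum_ite_eq,
      Finset.mem_univ, if_true]
    rw [hp, div_mul_cancel₀ _ (mul_ne_zero (NeZero.ne (2 : k)) (hv0 j)), sub_self]
  have hxv (i) : polar Q x (v i) = 0 := congrFun hx' i
  have hy : polar Q x y = polar Q x y' := by
    simp only [y', ← QuadraticMap.polarBilin_apply_apply, map_sub, map_sum, map_smul]
    simp [hxv]
  rw [hy, polar, hzero (by rw [map_add, hx', hy', add_zero]), hzero hx', hzero hy', sub_zero,
    sub_zero]

/-- The reflection `t ↦ t - b_Q(t, z) Q(z)⁻¹ z` of a quadratic space along an anisotropic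
vector `z`. -/
def reflection (Q : QuadraticForm k V) {z : V} (hz : Q z ≠ 0) : Q.IsometryEquiv Q where
  __ := Module.reflection (x := z) (f := (Q z)⁻¹ • Q.polarBilin.flip z) (by
    change (Q z)⁻¹ * polar Q z z = 2
    rw [QuadraticMap.polar_self, nsmul_eq_mul, mul_left_comm, inv_mul_cancel₀ hz, mul_one,
      Nat.cast_ofNat])
  map_app' t := by
    change Q (t - ((Q z)⁻¹ * polar Q t z) • z) = Q t
    rw [sub_eq_add_neg, ← neg_smul, QuadraticMap.map_add Q, QuadraticMap.map_smul,
      QuadraticMap.polar_smul_right]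
    simp only [smul_eq_mul]
    field_simp
    ring

theorem reflection_sub_apply {Q : QuadraticForm k V} {x y : V} (hxy : Q x = Q y)
    (h : Q (x - y) ≠ 0) : reflection Q h x = y := by
  have hpolar : polar Q x (x - y) = Q (x - y) := by
    rw [sub_eq_add_neg, QuadraticMap.polar_add_right, QuadraticMap.polar_self,
      QuadraticMap.map_add Q, QuadraticMap.map_neg, ← hxy, two_nsmul]
  change x - ((Q (x - y))⁻¹ * polar Q x (x - y)) • (x - y) = y
  rw [hpolar, inv_mul_cancel₀ h, one_smul, sub_sub_cancel]

theorem exists_isometryEquiv_apply_eq [NeZero (2 : k)] {Q : QuadraticForm k V} {x y : V}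
    (hxy : Q x = Q y) (hx : Q x ≠ 0) : ∃ r : Q.IsometryEquiv Q, r x = y := by
  by_cases h : Q (x - y) = 0
  · -- By the parallelogram law, one of `x - y` and `x + y` is anisotropic.
    have hadd : Q (x - -y) ≠ 0 := fun h' => by
      have : Q (x - y) + Q (x - -y) = 2 * (2 * Q x) := by
        rw [sub_neg_eq_add, sub_eq_add_neg, QuadraticMap.map_add Q, QuadraticMap.map_add Q,
          QuadraticMap.map_neg, QuadraticMap.polar_neg_right, ← hxy]
        ring
      have h2 := NeZero.ne (2 : k)
      rw [h, h', add_zero] at this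
      exact mul_ne_zero h2 (mul_ne_zero h2 hx) this.symm
    let neg : Q.IsometryEquiv Q := ⟨LinearEquiv.neg k, Q.map_neg⟩
    refine ⟨(reflection Q hadd).trans neg, ?_⟩
    change -reflection Q hadd x = y
    rw [reflection_sub_apply (by rw [hxy, Q.map_neg]), neg_neg]
  · exact ⟨reflection Q h, reflection_sub_apply hxy h⟩

theorem apply_inr_fst_eq_zero [NeZero (2 : k)] {a : k} (ha : a ≠ 0) {Q : QuadraticForm k V}
    {Q' : QuadraticForm k V'}
    (g : ((a • QuadraticMap.sq).prod Q).IsometryEquiv ((a • QuadraticMap.sq).prod Q'))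
    (hg : g (1, 0) = (1, 0)) (x : V) : (g (0, x)).1 = 0 := by
  have hpolar := polar_isometryEquiv g (0, x) (1, 0)
  have h2a : 2 * a * (g (0, x)).1 = 0 := by
    simp only [hg, polar, QuadraticMap.prod_apply, _root_.smul_apply, QuadraticMap.sq_apply,
      Prod.fst_add, Prod.snd_add, smul_eq_mul, add_zero, map_zero] at hpolar
    linear_combination hpolar
  exact (mul_eq_zero.mp h2a).resolve_left (mul_ne_zero (NeZero.ne 2) ha)

theorem equivalent_of_equivalent_prod [NeZero (2 : k)] {a : k} (ha : a ≠ 0)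
    {Q : QuadraticForm k V} {Q' : QuadraticForm k V'}
    (h : Equivalent ((a • QuadraticMap.sq).prod Q) ((a • QuadraticMap.sq).prod Q')) :
    Equivalent Q Q' := by
  obtain ⟨f⟩ := h
  obtain ⟨r, hr⟩ := exists_isometryEquiv_apply_eq (Q := (a • QuadraticMap.sq).prod Q')
    (x := f (1, 0)) (y := (1, 0)) (by rw [f.map_app]; simp) (by rw [f.map_app]; simpa using ha)
  let g := f.trans r
  have hg : g (1, 0) = (1, 0) := hr
  have hg_symm : g.symm (1, 0) = (1, 0) := by rw [← hg, g.symm_apply_apply]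
  have hsnd (x : V) : ((0 : k), (g (0, x)).2) = g (0, x) :=
    Prod.ext (apply_inr_fst_eq_zero ha g hg x).symm rfl
  have hsnd_symm (y : V') : ((0 : k), (g.symm (0, y)).2) = g.symm (0, y) :=
    Prod.ext (apply_inr_fst_eq_zero ha g.symm hg_symm y).symm rfl
  refine ⟨⟨LinearEquiv.ofLinearMap
    (LinearMap.snd k k V' ∘ₗ g.toLinearEquiv.toLinearMap ∘ₗ LinearMap.inr k k V)
    (LinearMap.snd k k V ∘ₗ g.symm.toLinearEquiv.toLinearMap ∘ₗ LinearMap.inr k k V')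
    (LinearMap.ext fun y => ?_) (LinearMap.ext fun x => ?_), fun x => ?_⟩⟩
  · change (g (0, (g.symm (0, y)).2)).2 = y
    rw [hsnd_symm, g.apply_symm_apply]
  · change (g.symm (0, (g (0, x)).2)).2 = x
    rw [hsnd, g.symm_apply_apply]
  · change Q' (g (0, x)).2 = Q x
    have := g.map_app (0, x)
    rwa [QuadraticMap.prod_apply, QuadraticMap.prod_apply, apply_inr_fst_eq_zero ha g hg x,
      map_zero, zero_add, zero_add] at this

end QuadraticForms

section DiagonalForms

variable {k n : Type*} [Field k]

theorem equivalent_weightedSumSquares_vecCons {m : ℕ} (a : k) (w : Fin m → k) :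
    Equivalent (weightedSumSquares k (vecCons a w))
      ((a • QuadraticMap.sq).prod (weightedSumSquares k w)) := by
  refine ⟨⟨(Fin.consLinearEquiv k fun _ => k).symm, fun x => ?_⟩⟩
  simp [Fin.consLinearEquiv, QuadraticMap.weightedSumSquares_apply, Fin.sum_univ_succ, Fin.tail]

theorem equivalent_vecCons_iff [NeZero (2 : k)] {m : ℕ} {a : k} (ha : a ≠ 0) {w w' : Fin m → k} :
    Equivalent (weightedSumSquares k (vecCons a w)) (weightedSumSquares k (vecCons a w')) ↔
      Equivalent (weightedSumSquares k w) (weightedSumSquares k w') := by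
  have hw := equivalent_weightedSumSquares_vecCons a w
  have hw' := equivalent_weightedSumSquares_vecCons a w'
  exact ⟨fun h => equivalent_of_equivalent_prod ha ((hw.symm.trans h).trans hw'),
    fun h => (hw.trans ((QuadraticMap.Equivalent.refl _).prod h)).trans hw'.symm⟩

variable [Fintype n]

theorem equivalent_weightedSumSquares_of_sq {w w' : n → k} (c : n → k) (hc : ∀ i, c i ≠ 0)
    (h : ∀ i, w i = w' i * c i ^ 2) :
    Equivalent (weightedSumSquares k w) (weightedSumSquares k w') := by
  refine ⟨⟨LinearEquiv.piCongrRight fun i => LinearEquiv.smulOfUnit (Units.mk0 (c i) (hc i)),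
    fun x => ?_⟩⟩
  simp only [QuadraticMap.weightedSumSquares_apply, AddHom.toFun_eq_coe, LinearMap.coe_toAddHom,
    LinearEquiv.coe_coe, LinearEquiv.piCongrRight_apply, smul_eq_mul, h]
  refine Finset.sum_congr rfl fun i _ => ?_
  change w' i * (c i * x i * (c i * x i)) = _
  ring

theorem equivalent_weightedSumSquares_smul_iff {c : k} (hc : c ≠ 0) {w w' : n → k} :
    Equivalent (weightedSumSquares k (c • w)) (weightedSumSquares k (c • w')) ↔
      Equivalent (weightedSumSquares k w) (weightedSumSquares k w') := by
  have hsmul (v x : n → k) :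
      weightedSumSquares k (c • v) x = c * weightedSumSquares k v x := by
    simp [QuadraticMap.weightedSumSquares_apply, Finset.mul_sum, mul_assoc]
  refine ⟨fun ⟨f⟩ => ⟨⟨f.toLinearEquiv, fun x => mul_left_cancel₀ hc ?_⟩⟩,
    fun ⟨f⟩ => ⟨⟨f.toLinearEquiv, fun x => ?_⟩⟩⟩
  · rw [← hsmul, ← hsmul]
    exact f.map_app x
  · rw [hsmul, hsmul]
    exact congrArg (c * ·) (f.map_app x)

variable [DecidableEq n]

theorem weightedSumSquares_eq_dotProduct (w x : n → k) :
    weightedSumSquares k w x = x ⬝ᵥ (diagonal w *ᵥ x) := by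
  simp only [QuadraticMap.weightedSumSquares_apply, dotProduct, mulVec_diagonal, smul_eq_mul]
  exact Finset.sum_congr rfl fun i _ => by ring

theorem polar_weightedSumSquares (w x y : n → k) :
    polar (weightedSumSquares k w) x y = 2 * (x ⬝ᵥ (diagonal w *ᵥ y)) := by
  simp only [polar, QuadraticMap.weightedSumSquares_apply, dotProduct, mulVec_diagonal,
    smul_eq_mul, Pi.add_apply, ← Finset.sum_sub_distrib, Finset.mul_sum]
  exact Finset.sum_congr rfl fun i _ => by ring

theorem equivalent_weightedSumSquares_of_congr {w w' : n → k} {P : Matrix n n k}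
    (hP : IsUnit P.det) (h : Pᵀ * diagonal w' * P = diagonal w) :
    Equivalent (weightedSumSquares k w) (weightedSumSquares k w') := by
  have : Invertible P := P.invertibleOfIsUnitDet hP
  refine ⟨⟨P.toLinearEquiv' ‹_›, fun x => ?_⟩⟩
  change weightedSumSquares k w' (P *ᵥ x) = _
  rw [weightedSumSquares_eq_dotProduct, weightedSumSquares_eq_dotProduct, ← h]
  simp only [← mulVec_mulVec, dotProduct_mulVec, vecMul_mulVec, vecMul_transpose]

theorem equivalent_weightedSumSquares_iff_congr [NeZero (2 : k)] {w w' : n → k} :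
    Equivalent (weightedSumSquares k w) (weightedSumSquares k w') ↔
      ∃ P : Matrix n n k, IsUnit P.det ∧ Pᵀ * diagonal w' * P = diagonal w := by
  refine ⟨fun ⟨f⟩ => ?_, fun ⟨P, hP, h⟩ => equivalent_weightedSumSquares_of_congr hP h⟩
  let P := LinearMap.toMatrix' f.toLinearEquiv.toLinearMap
  have hPx (x) : P *ᵥ x = f x := LinearMap.toMatrix'_mulVec _ x
  refine ⟨P, by simpa [P] using LinearEquiv.isUnit_det' f.toLinearEquiv, ?_⟩
  have hform (x y : n → k) : x ⬝ᵥ ((Pᵀ * diagonal w' * P) *ᵥ y) = x ⬝ᵥ (diagonal w *ᵥ y) := by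
    refine mul_left_cancel₀ (NeZero.ne (2 : k)) ?_
    rw [← polar_weightedSumSquares, ← polar_isometryEquiv f, polar_weightedSumSquares, ← hPx,
      ← hPx]
    simp only [← mulVec_mulVec, dotProduct_mulVec, vecMul_mulVec, vecMul_transpose]
  ext i j
  have hij := hform (Pi.single i 1) (Pi.single j 1)
  simpa only [single_one_dotProduct, mulVec_single_one, col_apply] using hij

theorem exists_eq_mul_diagonal_mul_transpose [NeZero (2 : k)] {S : Matrix n n k} (hS : S.IsSymm) :
    ∃ (P : Matrix n n k) (d : n → k), IsUnit P.det ∧ S = P * diagonal d * Pᵀ := by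
  have : Invertible (2 : k) := invertibleOfNonzero (NeZero.ne _)
  have hsymm : LinearMap.IsSymm (Matrix.toBilin' S) := ⟨fun x y => by
    rw [RingHom.id_apply, toBilin'_apply', toBilin'_apply', dotProduct_mulVec, ← mulVec_transpose,
      hS.eq, dotProduct_comm]⟩
  obtain ⟨v, hv⟩ := LinearMap.BilinForm.exists_orthogonal_basis hsymm
  let b := v.reindex (Fintype.equivOfCardEq (by simp) : Fin (Module.finrank k (n → k)) ≃ n)
  let P := b.toMatrix (Pi.basisFun k n)
  have hP : IsUnit P.det := by
    rw [← Module.Basis.det_apply]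
    exact b.isUnit_det _
  refine ⟨Pᵀ, fun i => toBilin' S (b i) (b i), by rwa [det_transpose], ?_⟩
  have hdiag : LinearMap.BilinForm.toMatrix b (toBilin' S) =
      diagonal fun i => toBilin' S (b i) (b i) := by
    ext i j
    obtain rfl | hij := eq_or_ne i j
    · simp
    · rw [LinearMap.BilinForm.toMatrix_apply, diagonal_apply_ne _ hij]
      simpa [b] using hv fun h => hij ((Equiv.symm _).injective h)
  rw [transpose_transpose, ← hdiag, LinearMap.BilinForm.toMatrix_mul_basis_toMatrix]
  simp [LinearMap.BilinForm.toMatrix_basisFun]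

end DiagonalForms

/-! ### Composition algebras of dimension four -/

section Quaternions

section

variable {k : Type u} [Field k]

/-- The norm form `⟨1, a, b, ab⟩` of the quaternion algebra `ℍ[k, -a, -b]`. -/
def quaternionNorm (a b : k) : QuadraticForm k ℍ[k,-a,0,-b] :=
  (diagForm 1 a b (a * b)).comp (QuaternionAlgebra.linearEquivTuple (-a) 0 (-b)).toLinearMap

theorem quaternionNorm_apply (a b : k) (q : ℍ[k,-a,0,-b]) :
    quaternionNorm a b q = q.re ^ 2 + a * q.imI ^ 2 + b * q.imJ ^ 2 + a * b * q.imK ^ 2 := by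
  change diagForm 1 a b (a * b) ![q.re, q.imI, q.imJ, q.imK] = _
  simp only [QuadraticMap.weightedSumSquares_apply, Fin.sum_univ_four, cons_val, smul_eq_mul]
  ring

theorem equivalent_quaternionNorm_diagForm (a b : k) :
    Equivalent (quaternionNorm a b) (diagForm 1 a b (a * b)) :=
  ⟨⟨QuaternionAlgebra.linearEquivTuple (-a) 0 (-b), fun _ => rfl⟩⟩

theorem isComposition_quaternionNorm [NeZero (2 : k)] {a b : k} (ha : a ≠ 0) (hb : b ≠ 0) :
    IsComposition (quaternionNorm a b) where
  nontrivial := inferInstance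
  nondegenerate x h := by
    have h2 := NeZero.ne (2 : k)
    have hre := h ⟨1, 0, 0, 0⟩
    have hI := h ⟨0, 1, 0, 0⟩
    have hJ := h ⟨0, 0, 1, 0⟩
    have hK := h ⟨0, 0, 0, 1⟩
    simp only [polar, quaternionNorm_apply, QuaternionAlgebra.re_add, QuaternionAlgebra.imI_add,
      QuaternionAlgebra.imJ_add, QuaternionAlgebra.imK_add] at hre hI hJ hK
    ext
    · exact (mul_eq_zero.mp (by linear_combination hre : 2 * x.re = 0)).resolve_left h2
    · exact (mul_eq_zero.mp (by linear_combination hI : 2 * a * x.imI = 0)).resolve_left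
        (mul_ne_zero h2 ha)
    · exact (mul_eq_zero.mp (by linear_combination hJ : 2 * b * x.imJ = 0)).resolve_left
        (mul_ne_zero h2 hb)
    · exact (mul_eq_zero.mp (by linear_combination hK : 2 * (a * b) * x.imK = 0)).resolve_left
        (mul_ne_zero h2 (mul_ne_zero ha hb))
  map_mul x y := by
    simp only [quaternionNorm_apply, QuaternionAlgebra.re_mul, QuaternionAlgebra.imI_mul,
      QuaternionAlgebra.imJ_mul, QuaternionAlgebra.imK_mul]
    ring

end

variable {k C : Type*} [Field k] [NonAssocRing C] [Module k C]

/-- Orthogonal pure elements `i`, `j` of a composition algebra: `1`, `i`, `j` are orthogonal for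
the norm, so that `1, i, j, ij` multiply like the standard basis of a quaternion algebra. -/
structure IsPurePair (N : QuadraticForm k C) (i j : C) : Prop where
  polar_left_one : polar N i 1 = 0
  polar_right_one : polar N j 1 = 0
  polar_left_right : polar N i j = 0

theorem IsPurePair.map_isometryEquiv {C' : Type*} [NonAssocRing C'] [Module k C']
    {N : QuadraticForm k C} {N' : QuadraticForm k C'} {i j : C}
    (h : IsPurePair N i j) (f : N.IsometryEquiv N') (hf : f 1 = 1) :
    IsPurePair N' (f i) (f j) := by
  obtain ⟨hi, hj, hij⟩ := h
  exact ⟨by rwa [← hf, polar_isometryEquiv], by rwa [← hf, polar_isometryEquiv],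
    by rwa [polar_isometryEquiv]⟩

/-- The linear map `ℍ[k, -N i, -N j] → C` sending the standard basis to `1, i, j, ij`. -/
def ofQuaternion (N : QuadraticForm k C) (i j : C) : ℍ[k,-N i,0,-N j] →ₗ[k] C where
  toFun q := q.re • (1 : C) + q.imI • i + q.imJ • j + q.imK • (i * j)
  map_add' p q := by
    simp only [QuaternionAlgebra.re_add, QuaternionAlgebra.imI_add,
      QuaternionAlgebra.imJ_add, QuaternionAlgebra.imK_add]
    module
  map_smul' c q := by
    simp only [QuaternionAlgebra.re_smul, QuaternionAlgebra.imI_smul, QuaternionAlgebra.imJ_smul,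
      QuaternionAlgebra.imK_smul, RingHom.id_apply, smul_eq_mul]
    module

variable [IsScalarTower k C C] [SMulCommClass k C C]

theorem conj_eq_neg {N : QuadraticForm k C} {x : C} (hx : polar N x 1 = 0) : conj N x = -x := by
  rw [conj_apply, hx, zero_smul, zero_sub]

variable (N : QuadraticForm k C) [hN : IsComposition N]

theorem conj_mul_mul_self (x y : C) : conj N x * (x * y) = N x • y := by
  rw [← sub_eq_zero]
  refine hN.nondegenerate _ fun z => ?_
  rw [QuadraticMap.polar_sub_left, polar_mul_eq_left, conj_conj, polar_mul_left,
    QuadraticMap.polar_smul_left, smul_eq_mul, sub_self]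

theorem mul_self_mul_conj (x y : C) : y * x * conj N x = N x • y := by
  have h := congrArg (conj N) (conj_mul_mul_self N (conj N x) (conj N y))
  rw [Freud.conj_mul, Freud.conj_mul, conj_conj, conj_conj, map_smul, conj_conj] at h
  rw [h]
  congr 1
  rw [← sub_eq_zero]
  have hx : N (conj N x) • (1 : C) = N x • 1 := by
    have h1 := conj_mul_mul_self N (conj N x) 1
    have h2 := conj_mul_mul_self N x 1
    rw [mul_one, conj_conj] at h1
    rw [mul_one] at h2
    rw [← h1, ← h2, conj_apply, sub_mul, mul_sub, smul_mul_assoc, mul_smul_comm, one_mul, mul_one]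
  rw [← sub_eq_zero, ← sub_smul] at hx
  have := hN.nontrivial
  exact (smul_eq_zero.mp hx).resolve_right one_ne_zero

variable {N}

theorem mul_self_eq (x : C) : x * x = polar N x 1 • x - N x • (1 : C) := by
  have h := conj_mul_mul_self N x 1
  rw [mul_one, conj_apply, sub_mul, smul_mul_assoc, one_mul] at h
  rw [← h, sub_sub_cancel]

theorem mul_mul_self_of_pure {x : C} (hx : polar N x 1 = 0) (y : C) :
    x * (x * y) = -N x • y := by
  have := conj_mul_mul_self N x y
  rw [conj_eq_neg hx, neg_mul] at this
  rw [neg_smul, ← this, neg_neg]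

theorem mul_self_mul_of_pure {x : C} (hx : polar N x 1 = 0) (y : C) :
    y * x * x = -N x • y := by
  have := mul_self_mul_conj N x y
  rw [conj_eq_neg hx, mul_neg] at this
  rw [neg_smul, ← this, neg_neg]

theorem mul_self_of_pure {x : C} (hx : polar N x 1 = 0) :
    x * x = -N x • (1 : C) := by
  simpa using mul_mul_self_of_pure hx 1

theorem mul_comm_neg_of_pure {x y : C} (hx : polar N x 1 = 0)
    (hy : polar N y 1 = 0) (hxy : polar N x y = 0) :
    y * x = -(x * y) := by
  have h1 : polar N (x + y) 1 = 0 := by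
    rw [QuadraticMap.polar_add_left, hx, hy, add_zero]
  have h := mul_self_of_pure h1
  rw [QuadraticMap.map_add N, hxy, add_zero, mul_add, add_mul, add_mul, mul_self_of_pure hx,
    mul_self_of_pure hy] at h
  have h2 : y * x + x * y = 0 := by
    have : y * x + x * y = -N x • (1 : C) + y * x + (x * y + -N y • 1) -
      (-N x • (1 : C) + -N y • 1) := by abel
    rw [this, h]
    module
  exact eq_neg_of_add_eq_zero_left h2

namespace IsPurePair

variable {i j : C}

theorem polar_mul_one (h : IsPurePair N i j) : polar N (i * j) 1 = 0 := by
  rw [polar_mul_eq_left, mul_one, conj_eq_neg h.polar_left_one, QuadraticMap.polar_neg_right,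
    QuadraticMap.polar_comm, h.polar_left_right, neg_zero]

theorem polar_mul_left (h : IsPurePair N i j) : polar N (i * j) i = 0 := by
  simpa only [mul_one, h.polar_right_one, mul_zero] using Freud.polar_mul_left N i j 1

theorem polar_mul_right (h : IsPurePair N i j) : polar N (i * j) j = 0 := by
  rw [polar_mul_eq_right, conj_eq_neg h.polar_right_one, mul_neg,
    mul_self_of_pure h.polar_right_one, QuadraticMap.polar_neg_right,
    QuadraticMap.polar_smul_right, h.polar_left_one, smul_zero, neg_zero]

theorem ofQuaternion_mul (h : IsPurePair N i j) (p q) :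
    ofQuaternion N i j (p * q) = ofQuaternion N i j p * ofQuaternion N i j q := by
  have hkk := mul_self_of_pure h.polar_mul_one
  obtain ⟨hi, hj, hij⟩ := h
  have hji := mul_comm_neg_of_pure hi hj hij
  have hki : i * j * i = N i • j := by
    rw [← neg_neg (i * j), ← hji, neg_mul, mul_self_mul_of_pure hi, neg_smul, neg_neg]
  have hjk : j * (i * j) = N j • i := by
    rw [← neg_neg (i * j), ← hji, mul_neg, mul_mul_self_of_pure hj, neg_smul, neg_neg]
  simp only [ofQuaternion, LinearMap.coe_mk, AddHom.coe_mk, QuaternionAlgebra.re_mul,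
    QuaternionAlgebra.imI_mul, QuaternionAlgebra.imJ_mul, QuaternionAlgebra.imK_mul, add_mul,
    mul_add, smul_mul_assoc, mul_smul_comm, one_mul, mul_one, mul_self_of_pure hi,
    mul_self_of_pure hj, mul_mul_self_of_pure hi, mul_self_mul_of_pure hj, hji, hki, hjk, hkk,
    hN.map_mul]
  module

theorem norm_ofQuaternion (h : IsPurePair N i j) (q) :
    N (ofQuaternion N i j q) = quaternionNorm (N i) (N j) q := by
  have hk1 := h.polar_mul_one
  have hki := h.polar_mul_left
  have hkj := h.polar_mul_right
  obtain ⟨hi, hj, hij⟩ := h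
  rw [QuadraticMap.polar_comm] at hk1 hki hkj hi hj
  simp only [ofQuaternion, LinearMap.coe_mk, AddHom.coe_mk, QuadraticMap.map_add N,
    QuadraticMap.map_smul, QuadraticMap.polar_add_left, QuadraticMap.polar_smul_left,
    QuadraticMap.polar_smul_right, smul_eq_mul, map_one_eq N, hki, hkj, hij, hi, hj, hk1,
    hN.map_mul, quaternionNorm_apply]
  ring

theorem bijective_ofQuaternion [NeZero (2 : k)] (h : IsPurePair N i j) (hi : N i ≠ 0)
    (hj : N j ≠ 0) (hfin : Module.finrank k C = 4) : Function.Bijective (ofQuaternion N i j) := by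
  have : Module.Finite k C := Module.finite_of_finrank_pos (by lia)
  have hinj := injective_of_isometry (isComposition_quaternionNorm hi hj).nondegenerate
    h.norm_ofQuaternion
  exact ⟨hinj, (LinearMap.injective_iff_surjective_of_finrank_eq_finrank
    (by rw [hfin, QuaternionAlgebra.finrank_eq_four])).mp hinj⟩

theorem algIso_quaternion [NeZero (2 : k)] (h : IsPurePair N i j) (hi : N i ≠ 0) (hj : N j ≠ 0)
    (hfin : Module.finrank k C = 4) : AlgIso k ℍ[k,-N i,0,-N j] C :=
  ⟨{ ofQuaternion N i j with
      map_zero' := map_zero (ofQuaternion N i j)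
      map_mul' := h.ofQuaternion_mul }, h.bijective_ofQuaternion hi hj hfin⟩

theorem equivalent_diagForm [NeZero (2 : k)] (h : IsPurePair N i j) (hi : N i ≠ 0) (hj : N j ≠ 0)
    (hfin : Module.finrank k C = 4) : Equivalent N (diagForm 1 (N i) (N j) (N i * N j)) :=
  .trans (.symm ⟨⟨.ofBijective _ (h.bijective_ofQuaternion hi hj hfin), h.norm_ofQuaternion⟩⟩)
    (equivalent_quaternionNorm_diagForm _ _)

end IsPurePair

theorem exists_isPurePair [NeZero (2 : k)] (hfin : Module.finrank k C = 4) :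
    ∃ i j : C, IsPurePair N i j ∧ N i ≠ 0 ∧ N j ≠ 0 := by
  have h1 : N 1 ≠ 0 := by
    rw [map_one_eq]
    exact one_ne_zero
  obtain ⟨i, hi0, hi⟩ := exists_anisotropic_orthogonal hN.nondegenerate (v := ![1])
    (Subsingleton.pairwise) (by simpa using h1) (by simp [hfin])
  replace hi : polar N i 1 = 0 := hi 0
  obtain ⟨j, hj0, hj⟩ := exists_anisotropic_orthogonal hN.nondegenerate (v := ![1, i])
    (by
      intro a b hab
      fin_cases a <;> fin_cases b <;> simp_all [QuadraticMap.polar_comm N 1 i])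
    (Fin.forall_fin_two.mpr ⟨h1, hi0⟩) (by simp [hfin])
  exact ⟨i, j, ⟨hi, hj 0, by rw [QuadraticMap.polar_comm]; exact hj 1⟩, hi0, hj0⟩

end Quaternions

section QuaternionIsomorphism

variable {k C C' : Type*} [Field k] [NonAssocRing C] [Module k C]
  [IsScalarTower k C C] [SMulCommClass k C C] [NonAssocRing C'] [Module k C']
  [IsScalarTower k C' C'] [SMulCommClass k C' C'] (N : QuadraticForm k C) [hN : IsComposition N]
  (N' : QuadraticForm k C') [hN' : IsComposition N']

theorem norm_map_of_bijective (f : C →ₙₐ[k] C') (hf : Function.Bijective f) (x : C) :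
    N' (f x) = N x := by
  have := hN'.nontrivial
  have hone : f 1 = 1 := by
    obtain ⟨y, hy⟩ := hf.2 1
    rw [← mul_one (f 1), ← hy, ← map_mul, one_mul]
  -- `f x` is a root of two quadratic polynomials, so they agree unless `f x` is a scalar.
  have hquad : (polar N' (f x) 1 - polar N x 1) • f x = (N' (f x) - N x) • (1 : C') := by
    have hfx := congrArg f (mul_self_eq (N := N) x)
    rw [map_mul, map_sub, map_smul, map_smul, hone, mul_self_eq (N := N') (f x)] at hfx
    rw [sub_smul, sub_smul, sub_eq_sub_iff_sub_eq_sub, hfx]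
  by_cases htrace : polar N' (f x) 1 - polar N x 1 = 0
  · rw [htrace, zero_smul] at hquad
    exact sub_eq_zero.mp ((smul_eq_zero.mp hquad.symm).resolve_right one_ne_zero)
  · obtain ⟨c, hc⟩ : ∃ c : k, f x = c • (1 : C') :=
      ⟨(polar N' (f x) 1 - polar N x 1)⁻¹ * (N' (f x) - N x), by
        rw [mul_smul, ← hquad, smul_smul, inv_mul_cancel₀ htrace, one_smul]⟩
    have hx : x = c • (1 : C) := hf.1 (by rw [hc, map_smul, hone])
    rw [hc, hx, QuadraticMap.map_smul, QuadraticMap.map_smul, map_one_eq, map_one_eq]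

theorem equivalent_norm_of_algIso (h : AlgIso k C C') : Equivalent N N' := by
  obtain ⟨f, hf⟩ := h
  exact ⟨⟨LinearEquiv.ofBijective (f : C →ₗ[k] C') hf, norm_map_of_bijective N N' f hf⟩⟩

theorem algIso_of_equivalent_norm [NeZero (2 : k)] (hfin : Module.finrank k C = 4)
    (h : Equivalent N N') : AlgIso k C C' := by
  obtain ⟨f⟩ := h
  have hone : N' (f 1) = N' 1 := by rw [f.map_app, map_one_eq, map_one_eq]
  obtain ⟨r, hr⟩ := exists_isometryEquiv_apply_eq hone (by
    rw [hone, map_one_eq]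
    exact one_ne_zero)
  let g := f.trans r
  obtain ⟨i, j, hij, hi, hj⟩ := exists_isPurePair (N := N) hfin
  have hC := hij.algIso_quaternion hi hj hfin
  have hC' := (hij.map_isometryEquiv g hr).algIso_quaternion (by rwa [g.map_app])
    (by rwa [g.map_app]) (by rw [← f.toLinearEquiv.finrank_eq, hfin])
  rw [g.map_app, g.map_app] at hC'
  exact hC.symm.trans hC'

end QuaternionIsomorphism

section QuaternionClasses

variable {k : Type u} [Field k] [NeZero (2 : k)]

theorem quatSetoid_iff (Q Q' : QuatAlg k) :
    (quatSetoid k).r Q Q' ↔ Equivalent Q.norm Q'.norm := by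
  have := Q.isComposition
  have := Q'.isComposition
  exact ⟨equivalent_norm_of_algIso _ _, algIso_of_equivalent_norm _ _ Q.finrank_eq⟩

theorem exists_norm_equivalent_diagForm (Q : QuatAlg k) :
    ∃ a b : k, a ≠ 0 ∧ b ≠ 0 ∧ Equivalent Q.norm (diagForm 1 a b (a * b)) := by
  have := Q.isComposition
  obtain ⟨i, j, hij, hi, hj⟩ := exists_isPurePair (N := Q.norm) Q.finrank_eq
  exact ⟨_, _, hi, hj, hij.equivalent_diagForm hi hj Q.finrank_eq⟩

theorem exists_quatAlg_norm_equivalent {a b : k} (ha : a ≠ 0) (hb : b ≠ 0) :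
    ∃ Q : QuatAlg k, Equivalent Q.norm (diagForm 1 a b (a * b)) :=
  ⟨{ carrier := ℍ[k,-a,0,-b]
     norm := quaternionNorm a b
     isComposition := isComposition_quaternionNorm ha hb
     finrank_eq := QuaternionAlgebra.finrank_eq_four _ _ _ },
    equivalent_quaternionNorm_diagForm a b⟩

theorem exists_equiv_quatClasses {α : Type*} (s : Setoid α)
    (F : α → QuadraticForm k (Fin 4 → k))
    (hs : ∀ x y, s.r x y ↔ Equivalent (F x) (F y))
    (hF : ∀ x, ∃ Q : QuatAlg k, Equivalent Q.norm (F x))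
    (hQ : ∀ Q : QuatAlg k, ∃ x, Equivalent Q.norm (F x)) :
    ∃ Φ : Quotient s ≃ QuatClasses k, ∀ (x : α) (Q : QuatAlg k),
      Φ (Quotient.mk s x) = Quotient.mk (quatSetoid k) Q ↔
        Equivalent Q.norm (F x) := by
  choose R hR using hF
  let φ : Quotient s → QuatClasses k := Quotient.lift (fun x => Quotient.mk (quatSetoid k) (R x))
    fun x y h => Quotient.sound ((quatSetoid_iff _ _).mpr
      ((hR x).trans (((hs x y).mp h).trans (hR y).symm)))
  have hφ : ∀ x Q, φ (Quotient.mk s x) = Quotient.mk (quatSetoid k) Q ↔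
      Equivalent Q.norm (F x) := by
    intro x Q
    change Quotient.mk (quatSetoid k) (R x) = Quotient.mk (quatSetoid k) Q ↔ _
    rw [Quotient.eq]
    refine (quatSetoid_iff _ _).trans ⟨fun h => h.symm.trans (hR x), fun h => (hR x).trans h.symm⟩
  refine ⟨Equiv.ofBijective φ ⟨?_, ?_⟩, hφ⟩
  · intro x y
    induction x, y using Quotient.inductionOn₂ with
    | _ x y =>
      intro h
      exact Quotient.sound ((hs x y).mpr ((hR x).symm.trans
        ((hφ y (R x)).mp h.symm)))
  · intro q
    induction q using Quotient.inductionOn with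
    | _ Q =>
      obtain ⟨x, hx⟩ := hQ Q
      exact ⟨Quotient.mk s x, (hφ x Q).mpr hx⟩

end QuaternionClasses

/-! ### The algebras `H₃(k, Γ)` -/

theorem trace_mulLeft_map_of_bijective {k A B : Type*} [Field k] [NonUnitalNonAssocRing A]
    [Module k A] [SMulCommClass k A A] [NonUnitalNonAssocRing B] [Module k B]
    [SMulCommClass k B B] (f : A →ₙₐ[k] B) (hf : Function.Bijective f) (a : A) :
    LinearMap.trace k B (LinearMap.mulLeft k (f a)) =
      LinearMap.trace k A (LinearMap.mulLeft k a) := by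
  let e : A ≃ₗ[k] B := .ofBijective (f : A →ₗ[k] B) hf
  have hconj : LinearMap.mulLeft k (f a) = e.conj (LinearMap.mulLeft k a) := by
    ext1 y
    obtain ⟨x, rfl⟩ := e.surjective y
    rw [LinearEquiv.conj_apply_apply, LinearEquiv.symm_apply_apply]
    exact (map_mul f a x).symm
  rw [hconj, LinearMap.trace_conj']

section H3

variable {k C C' : Type*} [Field k] [NonAssocRing C] [Module k C] [IsScalarTower k C C]
  [SMulCommClass k C C] [NonAssocRing C'] [Module k C'] [IsScalarTower k C' C']
  [SMulCommClass k C' C'] (N : QuadraticForm k C) [IsComposition N] (N' : QuadraticForm k C')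
  [IsComposition N'] (γ γ' : Fin 3 → kˣ)

instance : IsScalarTower k (H3 N γ) (H3 N γ) where
  smul_assoc c X Y := by
    apply Subtype.ext
    simp only [smul_eq_mul, coe_mul, Submodule.coe_smul, Matrix.smul_mul, Matrix.mul_smul,
      ← smul_add]
    rw [smul_comm]

instance : SMulCommClass k (H3 N γ) (H3 N γ) where
  smul_comm c X Y := by
    apply Subtype.ext
    simp only [smul_eq_mul, coe_mul, Submodule.coe_smul, Matrix.smul_mul, Matrix.mul_smul,
      ← smul_add]
    rw [smul_comm]

theorem coe_mul_self [NeZero (2 : k)] (Y : H3 N γ) : (Y * Y).1 = Y.1 * Y.1 := by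
  rw [coe_mul, ← two_smul k, smul_smul, inv_mul_cancel₀ (NeZero.ne _), one_smul]

variable {N N' γ γ'} in
theorem algIso_H3_of_linearEquiv
    (σ : Matrix (Fin 3) (Fin 3) C ≃ₗ[k] Matrix (Fin 3) (Fin 3) C')
    (hmul : ∀ X Y, σ (X * Y) = σ X * σ Y) (hmem : ∀ X, X ∈ H3 N γ ↔ σ X ∈ H3 N' γ') :
    AlgIso k (H3 N γ) (H3 N' γ') :=
  have hmap : (H3 N γ).map σ.toLinearMap = H3 N' γ' := by
    ext Y
    obtain ⟨X, rfl⟩ := σ.surjective Y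
    simp [hmem]
  let e := σ.ofSubmodules _ _ hmap
  ⟨{ e with
      map_zero' := map_zero e
      map_mul' := fun X Y => Subtype.ext (by
        change σ ((2⁻¹ : k) • (X.1 * Y.1 + Y.1 * X.1)) =
          (2⁻¹ : k) • (σ X.1 * σ Y.1 + σ Y.1 * σ X.1)
        rw [map_smul, map_add, hmul, hmul]) }, e.bijective⟩

end H3

section H3k

variable {k : Type u} [Field k]

theorem conj_sq (x : k) : conj (QuadraticMap.sq : QuadraticForm k k) x = x := by
  simp only [conj_apply, polar, QuadraticMap.sq_apply, smul_eq_mul]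
  ring

theorem mem_H3k_iff (γ : Fin 3 → kˣ) (Y : Matrix (Fin 3) (Fin 3) k) :
    Y ∈ H3k γ ↔ ∀ i j, (γ i : k) * Y i j = γ j * Y j i := by
  change starGamma _ γ Y = Y ↔ _
  simp only [← Matrix.ext_iff, starGamma, of_apply, conj_sq, smul_eq_mul, Units.val_mul, mul_assoc,
    Units.inv_mul_eq_iff_eq_mul]
  exact forall₂_congr fun _ _ => eq_comm

theorem mem_H3k_iff_transpose_mul (γ : Fin 3 → kˣ) {c : k} (hc : c ≠ 0)
    (Y : Matrix (Fin 3) (Fin 3) k) :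
    Y ∈ H3k γ ↔ Yᵀ * diagonal (fun i => c * γ i) = diagonal (fun i => c * γ i) * Y := by
  rw [mem_H3k_iff, ← Matrix.ext_iff]
  simp only [mul_diagonal, diagonal_mul, transpose_apply, mul_comm (Y _ _), mul_assoc,
    mul_right_inj' hc]
  exact forall₂_congr fun _ _ => eq_comm

/-- The entries of an element of `H₃(k, Γ)` on and cyclically above the diagonal. -/
def h3Equiv (γ : Fin 3 → kˣ) : H3k γ ≃ₗ[k] (Fin 6 → k) where
  toFun Y := ![Y.1 0 0, Y.1 1 1, Y.1 2 2, Y.1 1 2, Y.1 2 0, Y.1 0 1]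
  map_add' Y Z := by simp
  map_smul' c Y := by simp
  invFun x := ⟨!![x 0, x 5, γ 2 / γ 0 * x 4; γ 0 / γ 1 * x 5, x 1, x 3;
      x 4, γ 1 / γ 2 * x 3, x 2], by
    rw [mem_H3k_iff]
    intro i j
    fin_cases i <;> fin_cases j <;> simp <;> field_simp⟩
  left_inv Y := by
    have h := (mem_H3k_iff γ Y.1).mp Y.2
    have h01 := h 0 1
    have h12 := h 1 2
    have h20 := h 2 0
    ext i j
    fin_cases i <;> fin_cases j <;> simp <;> field_simp <;> assumption
  right_inv x := by
    ext i
    fin_cases i <;> rfl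

theorem h3Equiv_apply (γ : Fin 3 → kˣ) (Y : H3k γ) :
    h3Equiv γ Y = ![Y.1 0 0, Y.1 1 1, Y.1 2 2, Y.1 1 2, Y.1 2 0, Y.1 0 1] := rfl

theorem coe_h3Equiv_symm (γ : Fin 3 → kˣ) (x : Fin 6 → k) :
    ((h3Equiv γ).symm x).1 = !![x 0, x 5, γ 2 / γ 0 * x 4; γ 0 / γ 1 * x 5, x 1, x 3;
      x 4, γ 1 / γ 2 * x 3, x 2] := rfl

theorem finrank_H3k (γ : Fin 3 → kˣ) : Module.finrank k (H3k γ) = 6 := by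
  rw [(h3Equiv γ).finrank_eq, Module.finrank_fin_fun]

instance (γ : Fin 3 → kˣ) : Module.Finite k (H3k γ) := Module.Finite.equiv (h3Equiv γ).symm

theorem trace_mul_self_H3k (γ : Fin 3 → kˣ) (Y : H3k γ) :
    trace (Y.1 * Y.1) = weightedSumSquares k
      ![1, 1, 1, 2 * (γ 1 / γ 2 : k), 2 * (γ 2 / γ 0), 2 * (γ 0 / γ 1)] (h3Equiv γ Y) := by
  obtain ⟨x, rfl⟩ := (h3Equiv γ).symm.surjective Y
  simp only [LinearEquiv.apply_symm_apply, coe_h3Equiv_symm, QuadraticMap.weightedSumSquares_apply,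
    trace_fin_three, mul_apply, Fin.sum_univ_three, Fin.sum_univ_six]
  simp only [of_apply, cons_val, smul_eq_mul]
  ring

variable [NeZero (2 : k)]

theorem trace_mulLeft_H3k (γ : Fin 3 → kˣ) (Y : H3k γ) :
    LinearMap.trace k (H3k γ) (LinearMap.mulLeft k Y) = 2 * trace Y.1 := by
  have h2 := NeZero.ne (2 : k)
  have hdiag (i) : LinearMap.toMatrix (.ofEquivFun (h3Equiv γ)) (.ofEquivFun (h3Equiv γ))
      (LinearMap.mulLeft k Y) i i = h3Equiv γ (Y * (h3Equiv γ).symm (Pi.single i 1)) i := by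
    simp [LinearMap.toMatrix_apply]
  rw [LinearMap.trace_eq_matrix_trace k (Module.Basis.ofEquivFun (h3Equiv γ))]
  simp only [trace, diag, hdiag, Fin.sum_univ_six, Fin.sum_univ_three]
  simp [h3Equiv_apply, coe_h3Equiv_symm, coe_mul, mul_apply, Fin.sum_univ_three, vecMul, dotProduct]
  field_simp
  ring

theorem trace_map_of_bijective {γ γ' : Fin 3 → kˣ} (f : H3k γ →ₙₐ[k] H3k γ')
    (hf : Function.Bijective f) (Y : H3k γ) : trace (f Y).1 = trace Y.1 := by
  refine mul_left_cancel₀ (NeZero.ne (2 : k)) ?_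
  rw [← trace_mulLeft_H3k, ← trace_mulLeft_H3k, trace_mulLeft_map_of_bijective f hf]

-- The trace form `Y ↦ tr(Y²)` is an isomorphism invariant; cancel its common part `⟨1, 1, 1⟩`.
theorem equivalent_of_algIso_H3k {γ γ' : Fin 3 → kˣ} (h : AlgIso k (H3k γ) (H3k γ')) :
    Equivalent (weightedSumSquares k ![(γ 1 / γ 2 : k), γ 2 / γ 0, γ 0 / γ 1])
      (weightedSumSquares k ![(γ' 1 / γ' 2 : k), γ' 2 / γ' 0, γ' 0 / γ' 1]) := by
  obtain ⟨f, hf⟩ := h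
  let e : H3k γ ≃ₗ[k] H3k γ' := .ofBijective (f : H3k γ →ₗ[k] H3k γ') hf
  have htraceForm : Equivalent
      (weightedSumSquares k ![1, 1, 1, 2 * (γ 1 / γ 2 : k), 2 * (γ 2 / γ 0), 2 * (γ 0 / γ 1)])
      (weightedSumSquares k
        ![1, 1, 1, 2 * (γ' 1 / γ' 2 : k), 2 * (γ' 2 / γ' 0), 2 * (γ' 0 / γ' 1)]) := by
    refine ⟨⟨((h3Equiv γ).symm.trans e).trans (h3Equiv γ'), fun x => ?_⟩⟩
    obtain ⟨Y, rfl⟩ := (h3Equiv γ).surjective x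
    change weightedSumSquares k _ (h3Equiv γ' (e ((h3Equiv γ).symm (h3Equiv γ Y)))) = _
    rw [LinearEquiv.symm_apply_apply, ← trace_mul_self_H3k, ← trace_mul_self_H3k,
      ← coe_mul_self, ← coe_mul_self]
    exact (congrArg (fun Z => trace Z.1) (map_mul f Y Y)).symm.trans
      (trace_map_of_bijective f hf _)
  rw [equivalent_vecCons_iff one_ne_zero, equivalent_vecCons_iff one_ne_zero,
    equivalent_vecCons_iff one_ne_zero] at htraceForm
  rw [← equivalent_weightedSumSquares_smul_iff (NeZero.ne (2 : k))]
  simpa only [smul_cons, smul_empty, smul_eq_mul] using htraceForm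

omit [NeZero (2 : k)] in
theorem mem_H3k_iff_conj_mem {γ γ' : Fin 3 → kˣ} {c c' : k} (hc : c ≠ 0) (hc' : c' ≠ 0)
    (P : (Matrix (Fin 3) (Fin 3) k)ˣ)
    (h : P.1ᵀ * diagonal (fun i => c' * γ' i) * P = diagonal (fun i => c * γ i))
    (Y : Matrix (Fin 3) (Fin 3) k) : Y ∈ H3k γ ↔ P.1 * Y * P⁻¹.1 ∈ H3k γ' := by
  rw [mem_H3k_iff_transpose_mul γ hc, mem_H3k_iff_transpose_mul γ' hc', ← h]
  set D := diagonal fun i => c' * (γ' i : k)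
  have hPP : P.1ᵀ * P⁻¹.1ᵀ = 1 := by rw [← transpose_mul, P.inv_mul, transpose_one]
  have hl : Yᵀ * (P.1ᵀ * D * P.1) = P.1ᵀ * ((P.1 * Y * P⁻¹.1)ᵀ * D) * P.1 := by
    simp only [transpose_mul, ← Matrix.mul_assoc, hPP, Matrix.one_mul]
  have hr : P.1ᵀ * D * P.1 * Y = P.1ᵀ * (D * (P.1 * Y * P⁻¹.1)) * P.1 := by
    simp only [Matrix.mul_assoc, P.inv_mul, Matrix.mul_one]
  rw [hl, hr, P.isUnit.mul_left_inj, ((isUnit_transpose _).mpr P.isUnit).mul_right_inj]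

theorem algIso_H3k_of_congr {γ γ' : Fin 3 → kˣ} {c c' : k} (hc : c ≠ 0) (hc' : c' ≠ 0)
    {P : Matrix (Fin 3) (Fin 3) k} (hP : IsUnit P.det)
    (h : Pᵀ * diagonal (fun i => c' * γ' i) * P = diagonal (fun i => c * γ i)) :
    AlgIso k (H3k γ) (H3k γ') := by
  lift P to (Matrix (Fin 3) (Fin 3) k)ˣ using (isUnit_iff_isUnit_det P).mpr hP
  let σ := MulSemiringAction.toAlgEquiv k (Matrix (Fin 3) (Fin 3) k) (ConjAct.toConjAct P)
  exact algIso_H3_of_linearEquiv σ.toLinearEquiv (map_mul σ) (mem_H3k_iff_conj_mem hc hc' P h)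

theorem algIso_H3k_iff (γ γ' : Fin 3 → kˣ) : AlgIso k (H3k γ) (H3k γ') ↔
    Equivalent (diagForm 1 (γ 1 / γ 2 : k) (γ 2 / γ 0) (γ 0 / γ 1))
      (diagForm 1 (γ' 1 / γ' 2 : k) (γ' 2 / γ' 0) (γ' 0 / γ' 1)) := by
  rw [equivalent_vecCons_iff one_ne_zero]
  refine ⟨equivalent_of_algIso_H3k, fun h => ?_⟩
  have hscale (δ : Fin 3 → kˣ) : Equivalent
      (weightedSumSquares k fun i => (δ 0 * δ 1 * δ 2 : k) * δ i)
      (weightedSumSquares k ![(δ 1 / δ 2 : k), δ 2 / δ 0, δ 0 / δ 1]) := by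
    refine equivalent_weightedSumSquares_of_sq ![(δ 0 * δ 2 : k), δ 0 * δ 1, δ 1 * δ 2] ?_ ?_
    · intro i; fin_cases i <;> simp
    · intro i; fin_cases i <;> simp <;> field_simp
  obtain ⟨P, hP, hPw⟩ := equivalent_weightedSumSquares_iff_congr.mp
    (((hscale γ).trans h).trans (hscale γ').symm)
  exact algIso_H3k_of_congr (by simp) (by simp) hP hPw

omit [NeZero (2 : k)] in
theorem equivalent_diagForm_of_mul_eq_one {a b c : k} (h : a * b * c = 1) :
    Equivalent (diagForm 1 a b (a * b)) (diagForm 1 a b c) := by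
  have hab := left_ne_zero_of_mul_eq_one h
  refine equivalent_weightedSumSquares_of_sq ![1, 1, 1, a * b] ?_ ?_
  · intro i; fin_cases i <;> simp_all
  · intro i
    fin_cases i <;> simp
    linear_combination (-a * b) * h

theorem exists_equiv_H3Classes :
    ∃ Φ : H3Classes k ≃ QuatClasses k, ∀ (γ : Fin 3 → kˣ) (Q : QuatAlg k),
      Φ (Quotient.mk (h3Setoid k) γ) = Quotient.mk (quatSetoid k) Q ↔
        Equivalent Q.norm (diagForm 1 ((γ 1 : k) / γ 2) ((γ 2 : k) / γ 0) ((γ 0 : k) / γ 1)) := by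
  refine exists_equiv_quatClasses (h3Setoid k)
    (fun γ => diagForm 1 ((γ 1 : k) / γ 2) ((γ 2 : k) / γ 0) ((γ 0 : k) / γ 1))
    algIso_H3k_iff ?_ ?_
  · intro γ
    obtain ⟨Q, hQ⟩ := exists_quatAlg_norm_equivalent (a := (γ 1 / γ 2 : k)) (b := γ 2 / γ 0)
      (by simp) (by simp)
    exact ⟨Q, hQ.trans (equivalent_diagForm_of_mul_eq_one (by field_simp))⟩
  · intro Q
    obtain ⟨a, b, ha, hb, hQ⟩ := exists_norm_equivalent_diagForm Q
    refine ⟨![1, Units.mk0 (a * b) (mul_ne_zero ha hb), Units.mk0 b hb], hQ.trans ?_⟩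
    convert equivalent_diagForm_of_mul_eq_one (a := a) (b := b) (c := 1 / (a * b)) (by field_simp)
      using 2 <;> simp
    field_simp

end H3k

/-! ### Trivectors on the symplectic space -/

section Trivectors

variable {F : Type*} [Field F]

theorem trivec_hom_ext {M : Type*} [AddCommGroup M] [Module F M]
    {f g : Trivec F →ₗ[F] M} (h : ∀ u v w, f (wedge u v w) = g (wedge u v w)) : f = g := by
  refine exteriorPower.linearMap_ext (AlternatingMap.ext fun m => ?_)
  have hm : m = ![m 0, m 1, m 2] := by
    funext i; fin_cases i <;> rfl
  rw [hm]
  exact h _ _ _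

theorem spAct_wedge (g : symplecticGroup (Fin 3) F) (u v w : Fin 3 ⊕ Fin 3 → F) :
    spAct g (wedge u v w) = wedge (g.1 *ᵥ u) (g.1 *ᵥ v) (g.1 *ᵥ w) := by
  rw [spAct, wedge, exteriorPower.map_apply_ιMulti, wedge]
  congr 1
  funext i
  fin_cases i <;> rfl

/-- The coordinate of a trivector at `e_i ∧ e_j ∧ e_l`. -/
noncomputable def coord (i j l : Fin 3 ⊕ Fin 3) : Trivec F →ₗ[F] F :=
  exteriorPower.alternatingMapLinearEquiv
    (detRowAlternating.compLinearMap (LinearMap.funLeft F F ![i, j, l]))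

theorem coord_wedge_eq_det (i j l : Fin 3 ⊕ Fin 3) (u v w : Fin 3 ⊕ Fin 3 → F) :
    coord i j l (wedge u v w) = det (of fun a b => ![u, v, w] a (![i, j, l] b)) := by
  rw [coord, wedge, exteriorPower.alternatingMapLinearEquiv_apply_ιMulti]
  rfl

theorem coord_wedge (i j l : Fin 3 ⊕ Fin 3) (u v w : Fin 3 ⊕ Fin 3 → F) :
    coord i j l (wedge u v w) = u i * v j * w l - u i * v l * w j - u j * v i * w l +
      u j * v l * w i + u l * v i * w j - u l * v j * w i := by
  rw [coord_wedge_eq_det, det_fin_three]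
  simp

theorem coord_swap_left (i j l : Fin 3 ⊕ Fin 3) (x : Trivec F) :
    coord i j l x = -coord j i l x := by
  have h : coord i j l = -coord (F := F) j i l := trivec_hom_ext fun u v w => by
    rw [LinearMap.neg_apply, coord_wedge, coord_wedge]; ring
  rw [h, LinearMap.neg_apply]

theorem coord_swap_right (i j l : Fin 3 ⊕ Fin 3) (x : Trivec F) :
    coord i j l x = -coord i l j x := by
  have h : coord i j l = -coord (F := F) i l j := trivec_hom_ext fun u v w => by
    rw [LinearMap.neg_apply, coord_wedge, coord_wedge]; ring
  rw [h, LinearMap.neg_apply]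

theorem coord_self_left (i l : Fin 3 ⊕ Fin 3) (x : Trivec F) : coord i i l x = 0 := by
  have h : coord i i l = (0 : Trivec F →ₗ[F] F) := trivec_hom_ext fun u v w => by
    rw [LinearMap.zero_apply, coord_wedge]; ring
  rw [h, LinearMap.zero_apply]

theorem trivec_ext {x y : Trivec F} (h : ∀ i j l, toLex i < toLex j → toLex j < toLex l →
    coord i j l x = coord i j l y) : x = y := by
  let b : Module.Basis (Fin 3 ⊕ₗ Fin 3) F (Fin 3 ⊕ Fin 3 → F) :=
      (Pi.basisFun F (Fin 3 ⊕ Fin 3)).reindex toLex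
  refine (b.exteriorPower 3).ext_elem fun s => ?_
  let f : Fin 3 ↪o Fin 3 ⊕ₗ Fin 3 := Set.powersetCard.ofFinEmbEquiv.symm s
  have hs : exteriorPower.ιMultiDual F 3 b s =
      coord (ofLex (f 0)) (ofLex (f 1)) (ofLex (f 2)) := trivec_hom_ext fun u v w => by
    rw [coord_wedge_eq_det, wedge, exteriorPower.ιMultiDual_apply_ιMulti]
    congr 1
    ext i j
    fin_cases j <;> simp [b, f]
  rw [exteriorPower.basis_repr_apply, exteriorPower.basis_repr_apply, hs]
  exact h _ _ _ (f.strictMono (by decide)) (f.strictMono (by decide))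

/-- The contraction of a trivector with the `a`-th vector of the dual basis, as a skew-symmetric
matrix. -/
noncomputable def slice (a : Fin 3 ⊕ Fin 3) :
    Trivec F →ₗ[F] Matrix (Fin 3 ⊕ Fin 3) (Fin 3 ⊕ Fin 3) F where
  toFun x := of fun i j => coord a i j x
  map_add' x y := by ext i j; simp
  map_smul' c x := by ext i j; simp

theorem slice_apply (a i j : Fin 3 ⊕ Fin 3) (x : Trivec F) : slice a x i j = coord a i j x := rfl

theorem slice_wedge (a : Fin 3 ⊕ Fin 3) (u v w : Fin 3 ⊕ Fin 3 → F) :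
    slice a (wedge u v w) = u a • (vecMulVec v w - vecMulVec w v) -
      v a • (vecMulVec u w - vecMulVec w u) + w a • (vecMulVec u v - vecMulVec v u) := by
  ext i j
  simp only [slice_apply, coord_wedge, Matrix.add_apply, Matrix.sub_apply, Matrix.smul_apply,
    vecMulVec_apply, smul_eq_mul]
  ring

theorem slice_spAct (g : symplecticGroup (Fin 3) F) (a : Fin 3 ⊕ Fin 3) (x : Trivec F) :
    slice a (spAct g x) = ∑ b, g.1 a b • (g.1 * slice b x * g.1ᵀ) := by
  have h : slice a ∘ₗ spAct g =
      ∑ b, g.1 a b • LinearMap.mulLeftRight F (g.1, g.1ᵀ) ∘ₗ slice b := by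
    refine trivec_hom_ext fun u v w => ?_
    have e (v w : Fin 3 ⊕ Fin 3 → F) :
        g.1 * vecMulVec v w * g.1ᵀ = vecMulVec (g.1 *ᵥ v) (g.1 *ᵥ w) := by
      rw [mul_vecMulVec, vecMulVec_mul, vecMul_transpose]
    simp only [LinearMap.comp_apply, LinearMap.sum_apply, LinearMap.smul_apply, spAct_wedge,
      LinearMap.mulLeftRight_apply, slice_wedge, Matrix.mul_add, Matrix.mul_sub, Matrix.add_mul,
      Matrix.sub_mul, Matrix.mul_smul, Matrix.smul_mul, e, smul_sub, smul_add, smul_smul,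
      Finset.sum_add_distrib, Finset.sum_sub_distrib, ← Finset.sum_smul]
    rfl
  simpa only [LinearMap.comp_apply, LinearMap.sum_apply, LinearMap.smul_apply,
    LinearMap.mulLeftRight_apply] using LinearMap.congr_fun h x

section Symplectic

variable {l : Type*} [Fintype l] [DecidableEq l] (g : symplecticGroup l F)
  (M M' : Matrix (l ⊕ l) (l ⊕ l) F)

theorem mul_mul_transpose_mul_J_mul :
    g.1 * M * g.1ᵀ * J l F * (g.1 * M' * g.1ᵀ) = g.1 * (M * J l F * M') * g.1ᵀ := by
  have h : g.1ᵀ * J l F * g.1 = J l F := SymplecticGroup.mem_iff'.mp g.2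
  calc g.1 * M * g.1ᵀ * J l F * (g.1 * M' * g.1ᵀ)
      = g.1 * (M * (g.1ᵀ * J l F * g.1) * M') * g.1ᵀ := by simp only [Matrix.mul_assoc]
    _ = g.1 * (M * J l F * M') * g.1ᵀ := by rw [h]

theorem trace_mul_mul_transpose_mul_J : trace (g.1 * M * g.1ᵀ * J l F) = trace (M * J l F) := by
  rw [Matrix.mul_assoc, Matrix.mul_assoc, trace_mul_comm, Matrix.mul_assoc,
    SymplecticGroup.mem_iff'.mp g.2]

end Symplectic

/-- The contraction of a trivector with the symplectic form. -/
noncomputable def contraction : Trivec F →ₗ[F] (Fin 3 ⊕ Fin 3 → F) :=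
  LinearMap.pi fun a => traceLinearMap _ F F ∘ₗ LinearMap.mulRight F (J (Fin 3) F) ∘ₗ slice a

theorem contraction_apply (x : Trivec F) (a : Fin 3 ⊕ Fin 3) :
    contraction x a = trace (slice a x * J (Fin 3) F) := rfl

theorem contraction_spAct (g : symplecticGroup (Fin 3) F) (x : Trivec F) :
    contraction (spAct g x) = g.1 *ᵥ contraction x := by
  ext a
  simp only [contraction_apply, slice_spAct, Matrix.sum_mul, Matrix.smul_mul, trace_sum,
    trace_smul, trace_mul_mul_transpose_mul_J, smul_eq_mul, mulVec, dotProduct]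

theorem contraction_eq_zero_of_mem_X {x : Trivec F} (hx : x ∈ X F) : contraction x = 0 := by
  have h0 : contraction (wedge (eL F 0) (eL F 1) (eL F 2)) = 0 := by
    ext a
    simp [contraction_apply, slice_wedge, vecMulVec_mul, trace_vecMulVec, eL, J,
      Matrix.add_mul, Matrix.sub_mul]
  suffices X F ≤ LinearMap.ker contraction from this hx
  rw [X, Submodule.span_le]
  rintro _ ⟨g, rfl⟩
  rw [SetLike.mem_coe, LinearMap.mem_ker, contraction_spAct, h0, mulVec_zero]

/-- The quadratic covariant of a trivector with values in the symmetric matrices. -/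
noncomputable def covariant (x : Trivec F) : Matrix (Fin 3 ⊕ Fin 3) (Fin 3 ⊕ Fin 3) F :=
  of fun a b => trace (slice a x * J (Fin 3) F * slice b x * J (Fin 3) F)

theorem covariant_apply (x : Trivec F) (a b : Fin 3 ⊕ Fin 3) :
    covariant x a b = trace (slice a x * J (Fin 3) F * slice b x * J (Fin 3) F) := rfl

theorem covariant_isSymm (x : Trivec F) : (covariant x).IsSymm := by
  ext a b
  rw [transpose_apply, covariant_apply, covariant_apply, Matrix.mul_assoc, trace_mul_comm,
    ← Matrix.mul_assoc]

theorem covariant_spAct (g : symplecticGroup (Fin 3) F) (x : Trivec F) :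
    covariant (spAct g x) = g.1 * covariant x * g.1ᵀ := by
  ext a b
  simp only [covariant_apply, slice_spAct, Matrix.smul_mul, Matrix.mul_smul,
    mul_mul_transpose_mul_J_mul, trace_sum, trace_smul, trace_mul_mul_transpose_mul_J,
    smul_eq_mul, Matrix.mul_apply, transpose_apply, Finset.sum_mul, Finset.mul_sum]
  refine Finset.sum_congr rfl fun i _ => Finset.sum_congr rfl fun j _ => ?_
  ring

/-- The matrix `K J S_a J K`, where `K` is the covariant of a trivector and `S_a` its `a`-th slice.
When `K` has Lagrangian image `L`, its vanishing for all `a` places the trivector in `L ∧ L ∧ V`. -/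
noncomputable def covariantSlice (a : Fin 3 ⊕ Fin 3) (x : Trivec F) :
    Matrix (Fin 3 ⊕ Fin 3) (Fin 3 ⊕ Fin 3) F :=
  covariant x * J (Fin 3) F * slice a x * J (Fin 3) F * covariant x

theorem covariantSlice_spAct (g : symplecticGroup (Fin 3) F) (a : Fin 3 ⊕ Fin 3) (x : Trivec F) :
    covariantSlice a (spAct g x) = ∑ b, g.1 a b • (g.1 * covariantSlice b x * g.1ᵀ) := by
  simp only [covariantSlice, slice_spAct, covariant_spAct, Matrix.sum_mul, Matrix.mul_sum,
    Matrix.smul_mul, Matrix.mul_smul, mul_mul_transpose_mul_J_mul]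

section Extension

variable {k K : Type*} [Field k] [Field K] [Algebra k K]

theorem coord_extend (i j l : Fin 3 ⊕ Fin 3) (x : Trivec k) :
    coord i j l (extend k K x) = algebraMap k K (coord i j l x) := by
  have h : (coord i j l).restrictScalars k ∘ₗ extend k K =
      Algebra.linearMap k K ∘ₗ coord i j l := by
    refine trivec_hom_ext fun u v w => ?_
    simp only [LinearMap.comp_apply, extend_wedge, LinearMap.restrictScalars_apply, coord_wedge,
      Algebra.linearMap_apply, map_sub, map_add, map_mul, Function.comp_apply]
  exact LinearMap.congr_fun h x

theorem slice_extend (a : Fin 3 ⊕ Fin 3) (x : Trivec k) :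
    slice a (extend k K x) = (slice a x).map (algebraMap k K) := by
  ext i j
  simp only [slice_apply, coord_extend, map_apply]

theorem covariant_extend (x : Trivec k) :
    covariant (extend k K x) = (covariant x).map (algebraMap k K) := by
  ext a b
  rw [map_apply, covariant_apply, covariant_apply, slice_extend, slice_extend,
    ← map_J (l := Fin 3) (algebraMap k K), ← Matrix.map_mul, ← Matrix.map_mul, ← Matrix.map_mul]
  exact (AddMonoidHom.map_trace (algebraMap k K) _).symm

theorem covariantSlice_extend (a : Fin 3 ⊕ Fin 3) (x : Trivec k) :
    covariantSlice a (extend k K x) = (covariantSlice a x).map (algebraMap k K) := by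
  simp only [covariantSlice, covariant_extend, slice_extend, Matrix.map_mul,
    map_J (l := Fin 3) (algebraMap k K)]

end Extension

end Trivectors

/-! ### Tangent trivectors -/

section Tangent

variable {F : Type*} [Field F]

/-- Trivectors in `L ∧ L ∧ V`, where `L` is the span of `e₁, e₂, e₃`: the tangent space to the cone
over the Lagrangian Grassmannian at `e₁ ∧ e₂ ∧ e₃`, up to the condition of lying in `X`. -/
def IsTangent (x : Trivec F) : Prop := ∀ a i j, coord a (Sum.inr i) (Sum.inr j) x = 0

/-- The component of a trivector in `Λ² L ⊗ L'`, where `L` and `L'` are the spans of `e₁, e₂, e₃`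
and `e₄, e₅, e₆`, as a matrix: `Λ² L` has the basis `e_{i+1} ∧ e_{i+2}`, with indices modulo `3`. -/
noncomputable def symPart : Trivec F →ₗ[F] Matrix (Fin 3) (Fin 3) F where
  toFun x := of fun i l => coord (Sum.inl (i + 1)) (Sum.inl (i + 2)) (Sum.inr l) x
  map_add' x y := by ext i j; simp
  map_smul' c x := by ext i j; simp

theorem symPart_apply (x : Trivec F) (i l : Fin 3) :
    symPart x i l = coord (Sum.inl (i + 1)) (Sum.inl (i + 2)) (Sum.inr l) x := rfl

theorem coord_inl_inl_inr (x : Trivec F) (i j l : Fin 3) :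
    coord (Sum.inl i) (Sum.inl j) (Sum.inr l) x =
      !![0, symPart x 2 l, -symPart x 1 l; -symPart x 2 l, 0, symPart x 0 l;
        symPart x 1 l, -symPart x 0 l, 0] i j := by
  fin_cases i <;> fin_cases j
  exacts [coord_self_left _ _ x, rfl, coord_swap_left _ _ _ x,
    coord_swap_left _ _ _ x, coord_self_left _ _ x, rfl,
    rfl, coord_swap_left _ _ _ x, coord_self_left _ _ x]

theorem IsTangent.add {x y : Trivec F} (hx : IsTangent x) (hy : IsTangent y) :
    IsTangent (x + y) := fun a i j => by
  rw [map_add, hx, hy, add_zero]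

theorem IsTangent.ext {x y : Trivec F} (hx : IsTangent x) (hy : IsTangent y)
    (h : symPart x = symPart y) (h0 : coord (Sum.inl 0) (Sum.inl 1) (Sum.inl 2) x =
      coord (Sum.inl 0) (Sum.inl 1) (Sum.inl 2) y) : x = y := by
  refine trivec_ext fun i j l hij hjl => ?_
  rcases i with i | i <;> rcases j with j | j <;> rcases l with l | l
  · simp only [Sum.Lex.toLex_lt_toLex, Sum.lex_inl_inl] at hij hjl
    obtain ⟨rfl, rfl, rfl⟩ : i = 0 ∧ j = 1 ∧ l = 2 := by lia
    exact h0
  · rw [coord_inl_inl_inr, coord_inl_inl_inr, h]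
  · simp at hjl
  · rw [hx, hy]
  · simp at hij
  · simp at hij
  · simp at hjl
  · rw [hx, hy]

theorem IsTangent.slice_inl {x : Trivec F} (hx : IsTangent x) (a : Fin 3) :
    slice (Sum.inl a) x = fromBlocks (toBlocks₁₁ (slice (Sum.inl a) x))
      (toBlocks₁₂ (slice (Sum.inl a) x)) (-(toBlocks₁₂ (slice (Sum.inl a) x))ᵀ) 0 := by
  ext (i | i) (j | j)
  · rfl
  · rfl
  · exact coord_swap_right _ _ _ x
  · exact hx _ i j

theorem IsTangent.slice_inr {x : Trivec F} (hx : IsTangent x) (a : Fin 3) :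
    slice (Sum.inr a) x = fromBlocks (toBlocks₁₁ (slice (Sum.inr a) x)) 0 0 0 := by
  ext (i | i) (j | j)
  · rfl
  · exact (coord_swap_left _ _ _ x).trans (neg_eq_zero.mpr (hx _ _ _))
  · exact (coord_swap_right _ _ _ x).trans (neg_eq_zero.mpr
      ((coord_swap_left _ _ _ x).trans (neg_eq_zero.mpr (hx _ _ _))))
  · exact hx _ i j

theorem toBlocks₁₂_slice_apply (x : Trivec F) (a i l : Fin 3) :
    toBlocks₁₂ (slice (Sum.inl a) x) i l = coord (Sum.inl a) (Sum.inl i) (Sum.inr l) x := (rfl)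

theorem trace_fromBlocks {m n R : Type*} [Fintype m] [Fintype n] [AddCommMonoid R]
    (A : Matrix m m R) (B : Matrix m n R) (C : Matrix n m R) (D : Matrix n n R) :
    trace (fromBlocks A B C D) = trace A + trace D := by
  simp [trace]

theorem trace_fromBlocks_mul_J (A B : Matrix (Fin 3) (Fin 3) F) :
    trace (fromBlocks A B (-Bᵀ) 0 * J (Fin 3) F) = 2 * trace B := by
  simp [J, fromBlocks_multiply, trace_fromBlocks, two_mul]

theorem IsTangent.isSymm_symPart [NeZero (2 : F)] {x : Trivec F} (hx : IsTangent x)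
    (h : contraction x = 0) : (symPart x).IsSymm := by
  have htrace (a) : trace (toBlocks₁₂ (slice (Sum.inl a) x)) = 0 := by
    have ha : contraction x (Sum.inl a) = 2 * trace (toBlocks₁₂ (slice (Sum.inl a) x)) := by
      rw [contraction_apply]
      exact (congrArg (fun M => trace (M * J (Fin 3) F)) (hx.slice_inl a)).trans
        (trace_fromBlocks_mul_J _ _)
    rw [h, Pi.zero_apply, eq_comm, mul_eq_zero] at ha
    exact ha.resolve_left (NeZero.ne 2)
  simp only [trace_fin_three, toBlocks₁₂_slice_apply, coord_inl_inl_inr] at htrace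
  have h12 : symPart x 2 1 = symPart x 1 2 := by simpa [add_eq_zero_iff_eq_neg] using htrace 0
  have h20 : symPart x 2 0 = symPart x 0 2 := by simpa [neg_add_eq_zero] using htrace 1
  have h01 : symPart x 1 0 = symPart x 0 1 := by simpa [add_eq_zero_iff_eq_neg] using htrace 2
  refine IsSymm.ext fun i j => ?_
  fin_cases i <;> fin_cases j <;> simp [h12, h20, h01]

theorem trace_fromBlocks_mul_J_mul_fromBlocks_mul_J (A B A' B' : Matrix (Fin 3) (Fin 3) F) :
    trace (fromBlocks A B (-Bᵀ) 0 * J (Fin 3) F * fromBlocks A' B' (-B'ᵀ) 0 * J (Fin 3) F) =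
      2 * trace (B * B') := by
  simp only [J, fromBlocks_multiply, trace_fromBlocks, Matrix.mul_zero, Matrix.mul_one,
    Matrix.zero_mul, Matrix.mul_neg, Matrix.neg_mul, neg_neg, add_zero, zero_add,
    ← transpose_mul, trace_transpose]
  rw [trace_mul_comm, two_mul]

theorem IsTangent.exists_slice_eq {x : Trivec F} (hx : IsTangent x) :
    ∃ A B : Fin 3 ⊕ Fin 3 → Matrix (Fin 3) (Fin 3) F,
      (∀ a, slice a x = fromBlocks (A a) (B a) (-(B a)ᵀ) 0) ∧
      (∀ a, B (Sum.inl a) = toBlocks₁₂ (slice (Sum.inl a) x)) ∧ ∀ a, B (Sum.inr a) = 0 := by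
  refine ⟨fun a => toBlocks₁₁ (slice a x), Sum.elim (fun a => toBlocks₁₂ (slice (Sum.inl a) x)) 0,
    Sum.rec hx.slice_inl fun a => ?_, fun a => rfl, fun a => rfl⟩
  simpa using hx.slice_inr a

theorem IsTangent.covariant_eq {x : Trivec F} (hx : IsTangent x) :
    covariant x = fromBlocks (of fun a b => 2 * trace
      (toBlocks₁₂ (slice (Sum.inl a) x) * toBlocks₁₂ (slice (Sum.inl b) x))) 0 0 0 := by
  obtain ⟨A, B, hAB, hl, hr⟩ := hx.exists_slice_eq
  ext (a | a) (b | b) <;>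
    rw [covariant_apply, hAB, hAB, trace_fromBlocks_mul_J_mul_fromBlocks_mul_J] <;>
    simp [hl, hr]

theorem IsTangent.covariant_of_isSymm {x : Trivec F} (hx : IsTangent x) (h : (symPart x).IsSymm) :
    covariant x = fromBlocks ((-4 : F) • (symPart x).adjugate) 0 0 0 := by
  rw [hx.covariant_eq]
  congr 1
  have h01 := h.apply 0 1
  have h02 := h.apply 0 2
  have h12 := h.apply 1 2
  ext a b
  rw [of_apply, trace_fin_three, adjugate_fin_three]
  simp only [Matrix.mul_apply, Fin.sum_univ_three, toBlocks₁₂_slice_apply,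
    coord_inl_inl_inr, h01, h02, h12]
  fin_cases a <;> fin_cases b <;> simp <;> ring

theorem IsTangent.covariant_mul_J_mul_covariant {x : Trivec F} (hx : IsTangent x) :
    covariant x * J (Fin 3) F * covariant x = 0 := by
  rw [hx.covariant_eq, J, fromBlocks_multiply, fromBlocks_multiply]
  simp

theorem IsTangent.covariantSlice_eq_zero {x : Trivec F} (hx : IsTangent x) (a : Fin 3 ⊕ Fin 3) :
    covariantSlice a x = 0 := by
  have h : toBlocks₂₂ (slice a x) = 0 := by
    ext i j
    exact hx a i j
  rw [covariantSlice, ← fromBlocks_toBlocks (slice a x), h, hx.covariant_eq, J]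
  simp [fromBlocks_multiply]

theorem isTangent_of_covariantSlice_eq_zero {x : Trivec F} {d : Fin 3 → F} (hd : ∀ i, d i ≠ 0)
    (hK : covariant x = fromBlocks (diagonal d) 0 0 0) (h : ∀ a, covariantSlice a x = 0) :
    IsTangent x := by
  intro a i j
  have ha := h a
  rw [covariantSlice, hK, ← fromBlocks_toBlocks (slice a x), J] at ha
  have hij := congrFun (congrFun (congrArg toBlocks₁₁ ha) i) j
  have hdd : d i * (coord a (Sum.inr i) (Sum.inr j) x * d j) = 0 := by
    simpa [fromBlocks_multiply, Matrix.mul_assoc, toBlocks₁₁, toBlocks₂₂, slice_apply] using hij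
  exact ((mul_eq_zero.mp hdd).resolve_left (hd i) |> mul_eq_zero.mp).resolve_right (hd j)

end Tangent

section DiagElt

variable {F : Type*} [Field F]

theorem coord_diagElt (a b c : F) (i j l : Fin 3 ⊕ Fin 3) :
    coord i j l (diagElt a b c) = a * coord i j l (wedge (eR F 0) (eL F 1) (eL F 2)) +
      b * coord i j l (wedge (eL F 0) (eR F 1) (eL F 2)) +
      c * coord i j l (wedge (eL F 0) (eL F 1) (eR F 2)) := by
  simp only [diagElt, map_add, map_smul, smul_eq_mul]

theorem isTangent_diagElt (a b c : F) : IsTangent (diagElt a b c) := fun s i j => by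
  rw [coord_diagElt]
  simp [coord_wedge, eL]

theorem symPart_diagElt (a b c : F) : symPart (diagElt a b c) = diagonal ![a, b, c] := by
  ext i j
  rw [symPart_apply, coord_diagElt]
  fin_cases i <;> fin_cases j <;> simp [coord_wedge, eL, eR]

theorem coord_inl_diagElt (a b c : F) (i j l : Fin 3) :
    coord (Sum.inl i) (Sum.inl j) (Sum.inl l) (diagElt a b c) = 0 := by
  rw [coord_diagElt]
  simp [coord_wedge, eR]

theorem covariant_diagElt (a b c : F) : covariant (diagElt a b c) =
    fromBlocks (diagonal ((-4 : F) • ![b * c, c * a, a * b])) 0 0 0 := by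
  rw [(isTangent_diagElt a b c).covariant_of_isSymm (by simp [symPart_diagElt, IsSymm]),
    symPart_diagElt, adjugate_fin_three, diagonal_smul]
  congr 2
  ext i j
  fin_cases i <;> fin_cases j <;> simp [mul_comm]

end DiagElt

section SpBlockDiag

/-- The element of `Sp` acting by `P` on the Lagrangian subspace spanned by the first half of the
basis and by the contragredient `Z` of `P` on the one spanned by the second half. -/
def spBlockDiag {l R : Type*} [Fintype l] [DecidableEq l] [CommRing R] (P Z : Matrix l l R)
    (h : Pᵀ * Z = 1) : symplecticGroup l R :=
  ⟨fromBlocks P 0 0 Z, by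
    have hPZ : P * Zᵀ = 1 := by
      rw [← transpose_transpose P, ← transpose_mul, mul_eq_one_comm.mp h, transpose_one]
    rw [SymplecticGroup.mem_iff, J, fromBlocks_transpose, fromBlocks_multiply, fromBlocks_multiply]
    simp [hPZ, mul_eq_one_comm.mp h]⟩

theorem adjugate_fin_three_apply {R : Type*} [CommRing R] (P : Matrix (Fin 3) (Fin 3) R)
    (i j : Fin 3) : P.adjugate j i =
      P (i + 1) (j + 1) * P (i + 2) (j + 2) - P (i + 1) (j + 2) * P (i + 2) (j + 1) := by
  rw [adjugate_fin_three]
  fin_cases i <;> fin_cases j <;> simp <;> ring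

variable {F : Type*} [Field F] (P Z : Matrix (Fin 3) (Fin 3) F) (h : Pᵀ * Z = 1) (a b c : F)

theorem spBlockDiag_mulVec_eL (i : Fin 3) :
    (spBlockDiag P Z h).1 *ᵥ eL F i = Sum.elim (Pᵀ i) 0 := by
  rw [eL, mulVec_single_one]
  ext (j | j) <;> rfl

theorem spBlockDiag_mulVec_eR (i : Fin 3) :
    (spBlockDiag P Z h).1 *ᵥ eR F i = Sum.elim (0 : Fin 3 → F) (Zᵀ i) := by
  rw [eR, mulVec_single_one]
  ext (j | j) <;> rfl

theorem coord_spBlockDiag_diagElt (i j l : Fin 3 ⊕ Fin 3) :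
    coord i j l (spAct (spBlockDiag P Z h) (diagElt a b c)) =
      a * coord i j l (wedge (Sum.elim (0 : Fin 3 → F) (Zᵀ 0)) (Sum.elim (Pᵀ 1) 0)
        (Sum.elim (Pᵀ 2) 0)) +
      b * coord i j l (wedge (Sum.elim (Pᵀ 0) 0) (Sum.elim (0 : Fin 3 → F) (Zᵀ 1))
        (Sum.elim (Pᵀ 2) 0)) +
      c * coord i j l (wedge (Sum.elim (Pᵀ 0) 0) (Sum.elim (Pᵀ 1) 0)
        (Sum.elim (0 : Fin 3 → F) (Zᵀ 2))) := by
  simp only [diagElt, map_add, map_smul, spAct_wedge, spBlockDiag_mulVec_eL, spBlockDiag_mulVec_eR,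
    smul_eq_mul]

theorem isTangent_spBlockDiag_diagElt :
    IsTangent (spAct (spBlockDiag P Z h) (diagElt a b c)) := fun s i j => by
  rw [coord_spBlockDiag_diagElt]
  simp [coord_wedge]

theorem coord_inl_spBlockDiag_diagElt (i j l : Fin 3) :
    coord (Sum.inl i) (Sum.inl j) (Sum.inl l) (spAct (spBlockDiag P Z h) (diagElt a b c)) = 0 := by
  rw [coord_spBlockDiag_diagElt]
  simp [coord_wedge]

theorem symPart_spBlockDiag_diagElt : symPart (spAct (spBlockDiag P Z h) (diagElt a b c)) =
    P.det • (Z * diagonal ![a, b, c] * Zᵀ) := by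
  have hadj : P.adjugateᵀ = P.det • Z := by
    rw [← Matrix.mul_one P.adjugateᵀ, ← h, ← Matrix.mul_assoc, ← transpose_mul, mul_adjugate,
      transpose_smul, transpose_one, Matrix.smul_mul, Matrix.one_mul]
  rw [← Matrix.smul_mul, ← Matrix.smul_mul, ← hadj]
  ext i l
  have h0 := adjugate_fin_three_apply P i 0
  have h1 := adjugate_fin_three_apply P i 1
  have h2 := adjugate_fin_three_apply P i 2
  rw [symPart_apply, coord_spBlockDiag_diagElt, Matrix.mul_apply]
  simp only [Fin.sum_univ_three, mul_diagonal, transpose_apply, coord_wedge, Sum.elim_inl,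
    Sum.elim_inr, Pi.zero_apply, cons_val_zero, cons_val_one, cons_val, h0, h1, h2]
  simp only [Fin.reduceAdd, Fin.isValue]
  ring

theorem spAct_spBlockDiag_diagElt {a b c a' b' c' : F}
    (hS : P.det • (Z * diagonal ![a, b, c] * Zᵀ) = diagonal ![a', b', c']) :
    spAct (spBlockDiag P Z h) (diagElt a b c) = diagElt a' b' c' :=
  (isTangent_spBlockDiag_diagElt P Z h a b c).ext (isTangent_diagElt a' b' c')
    (by rw [symPart_spBlockDiag_diagElt, hS, symPart_diagElt])
    (by rw [coord_inl_spBlockDiag_diagElt, coord_inl_diagElt])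

end SpBlockDiag

theorem exists_eq_diagonal_of_smul_adjugate_eq {n F : Type*} [Fintype n] [DecidableEq n]
    [Nontrivial n] [Field F] {S : Matrix n n F} {c : F} {d : n → F} (hd : ∀ i, d i ≠ 0)
    (h : c • S.adjugate = diagonal d) : ∃ s : n → F, (∀ i, s i ≠ 0) ∧ S = diagonal s := by
  have hS : S * diagonal d = diagonal fun _ => c * S.det := by
    rw [← h, Matrix.mul_smul, mul_adjugate, smul_smul, smul_one_eq_diagonal]
  have happly (i j) : S i j * d j = diagonal (fun _ => c * S.det) i j := by
    rw [← hS, mul_diagonal]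
  have hdet : c * S.det ≠ 0 := by
    intro h0
    have hS0 : S = 0 := by
      ext i j
      exact (mul_eq_zero.mp ((happly i j).trans (by simp [h0]))).resolve_right (hd j)
    obtain ⟨i⟩ : Nonempty n := inferInstance
    have := congrFun (congrFun h i) i
    rw [hS0, adjugate_zero, smul_zero, diagonal_apply_eq] at this
    exact hd i this.symm
  refine ⟨fun i => S i i, fun i hi => hdet ?_, ?_⟩
  · simpa [hi] using (happly i i).symm
  · ext i j
    obtain rfl | hij := eq_or_ne i j
    · rw [diagonal_apply_eq]
    · have := happly i j
      rw [diagonal_apply_ne _ hij] at this ⊢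
      exact (mul_eq_zero.mp this).resolve_right (hd j)

/-! ### Symmetric matrices with Lagrangian column space -/

section SymplecticNormalForm

variable {F : Type*} [Field F]

theorem exists_eq_mul_diagonal_mul_transpose_of_rank_eq [NeZero (2 : F)] {n m : Type*} [Fintype n]
    [Fintype m] [DecidableEq m] {K : Matrix n n F} (hK : K.IsSymm)
    (hrank : K.rank = Fintype.card m) : ∃ (L : Matrix n m F) (Λ : Matrix m n F) (d : m → F),
      (∀ i, d i ≠ 0) ∧ Λ * L = 1 ∧ K = L * diagonal d * Lᵀ := by
  classical
  obtain ⟨P, w, hP, hPK⟩ := exists_eq_mul_diagonal_mul_transpose hK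
  have hcard : Fintype.card {i // w i ≠ 0} = Fintype.card m := by
    rw [← rank_diagonal, ← hrank, hPK,
      rank_mul_eq_left_of_isUnit_det _ _ (isUnit_det_transpose P hP),
      rank_mul_eq_right_of_isUnit_det _ _ hP]
  let e : m ≃ {i // w i ≠ 0} := (Fintype.equivOfCardEq hcard).symm
  have hf : Function.Injective fun i => (e i).1 := Subtype.val_injective.comp e.injective
  refine ⟨P.submatrix id fun i => (e i).1, P⁻¹.submatrix (fun i => (e i).1) id,
    fun i => w (e i).1, fun i => (e i).2, ?_, ?_⟩
  · rw [← submatrix_mul _ _ _ id _ Function.bijective_id, nonsing_inv_mul _ hP, submatrix_one _ hf]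
  · ext a b
    rw [hPK, Matrix.mul_apply, Matrix.mul_apply]
    simp only [mul_diagonal, transpose_apply, submatrix_apply, id]
    rw [Equiv.sum_comp e (fun i => P a i.1 * w i.1 * P b i.1),
      ← Finset.sum_filter_of_ne (p := fun i => w i ≠ 0) fun i _ h hw => h (by simp [hw])]
    exact Finset.sum_subtype _ (by simp) _

theorem transpose_mul_mul_eq_zero {n m : Type*} [Fintype n] [Fintype m] [DecidableEq m]
    {L : Matrix n m F} {Λ : Matrix m n F} {d : m → F} (hd : ∀ i, d i ≠ 0) (hΛ : Λ * L = 1)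
    {M : Matrix n n F} (h : L * diagonal d * Lᵀ * M * (L * diagonal d * Lᵀ) = 0) :
    Lᵀ * M * L = 0 := by
  have hdunit : IsUnit (diagonal d) :=
    isUnit_diagonal.mpr (Pi.isUnit_iff.mpr fun i => (hd i).isUnit)
  have hD : diagonal d * (Lᵀ * M * L) * diagonal d = 0 := calc
    _ = (Λ * L) * diagonal d * (Lᵀ * M * L) * diagonal d * (Λ * L)ᵀ := by
      rw [hΛ, transpose_one, Matrix.one_mul, Matrix.mul_one]
    _ = Λ * (L * diagonal d * Lᵀ * M * (L * diagonal d * Lᵀ)) * Λᵀ := by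
      simp only [transpose_mul, Matrix.mul_assoc]
    _ = 0 := by rw [h, Matrix.mul_zero, Matrix.zero_mul]
  exact hdunit.mul_right_eq_zero.mp (hdunit.mul_left_eq_zero.mp hD)

variable {l : Type*} [Fintype l] [DecidableEq l]

-- The columns of `J Λᵀ` are dual to those of `L`; subtracting half of `L (Λ J Λᵀ)` makes them span
-- a Lagrangian subspace.
theorem exists_fromCols_mem_symplecticGroup [NeZero (2 : F)] {L : Matrix (l ⊕ l) l F}
    {Λ : Matrix l (l ⊕ l) F} (hΛ : Λ * L = 1) (hL : Lᵀ * J l F * L = 0) :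
    ∃ R, fromCols L R ∈ symplecticGroup l F := by
  have hΛt : Lᵀ * Λᵀ = 1 := by rw [← transpose_mul, hΛ, transpose_one]
  have hJJ (M : Matrix (l ⊕ l) l F) : J l F * (J l F * M) = -M := by
    rw [← Matrix.mul_assoc, J_squared, Matrix.neg_mul, Matrix.one_mul]
  set N := Λ * J l F * Λᵀ with hNdef
  have hNt : Nᵀ = -N := by
    simp only [N, transpose_mul, transpose_transpose, J_transpose, Matrix.mul_neg, Matrix.neg_mul,
      Matrix.mul_assoc]
  have hN : N = (2⁻¹ : F) • N + (2⁻¹ : F) • N := by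
    rw [← add_smul, ← two_mul, mul_inv_cancel₀ (NeZero.ne 2), one_smul]
  set R := J l F * Λᵀ - L * ((2⁻¹ : F) • N) with hR
  have hLR : Lᵀ * J l F * R = -1 := by
    rw [hR, Matrix.mul_sub, ← Matrix.mul_assoc _ L, hL, Matrix.zero_mul, sub_zero,
      Matrix.mul_assoc, hJJ, Matrix.mul_neg, hΛt]
  have hRL : Rᵀ * J l F * L = 1 := by
    simpa [transpose_mul, J_transpose, Matrix.mul_assoc] using congrArg transpose hLR
  have hRΛ : Rᵀ * Λᵀ = -((2⁻¹ : F) • N) := by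
    rw [hR, transpose_sub, transpose_mul, transpose_mul, transpose_smul, hNt, transpose_transpose,
      J_transpose, Matrix.sub_mul, Matrix.mul_assoc _ Lᵀ, hΛt, Matrix.mul_one, Matrix.mul_neg,
      Matrix.neg_mul, ← hNdef]
    nth_rw 1 [hN]
    module
  have hRR : Rᵀ * J l F * R = 0 := by
    rw [hR, Matrix.mul_sub, ← hR, ← Matrix.mul_assoc _ L, hRL, Matrix.mul_assoc, hJJ,
      Matrix.mul_neg, hRΛ, Matrix.one_mul, neg_neg, sub_self]
  refine ⟨R, ?_⟩
  rw [SymplecticGroup.mem_iff', transpose_fromCols, fromRows_mul, fromRows_mul_fromCols,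
    hL, hLR, hRL, hRR, J]

theorem exists_symplecticGroup_mul_fromBlocks_mul_transpose_eq [NeZero (2 : F)]
    {K : Matrix (l ⊕ l) (l ⊕ l) F} (hK : K.IsSymm) (hrank : K.rank = Fintype.card l)
    (hKJK : K * J l F * K = 0) : ∃ (g : symplecticGroup l F) (d : l → F), (∀ i, d i ≠ 0) ∧
      g.1 * fromBlocks (diagonal d) 0 0 0 * g.1ᵀ = K := by
  obtain ⟨L, Λ, d, hd, hΛ, rfl⟩ := exists_eq_mul_diagonal_mul_transpose_of_rank_eq hK hrank
  obtain ⟨R, hR⟩ := exists_fromCols_mem_symplecticGroup hΛ (transpose_mul_mul_eq_zero hd hΛ hKJK)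
  refine ⟨⟨fromCols L R, hR⟩, d, hd, ?_⟩
  rw [fromCols_mul_fromBlocks, transpose_fromCols, fromCols_mul_fromRows]
  simp

end SymplecticNormalForm

/-! ### The orbits of `Sp₆` in `X₂` -/

section UnipotentElements

variable {F : Type*} [Field F]

theorem wedge_add_left (u u' v w : Fin 3 ⊕ Fin 3 → F) :
    wedge (u + u') v w = wedge u v w + wedge u' v w :=
  trivec_ext fun i j l _ _ => by simp only [map_add, coord_wedge, Pi.add_apply]; ring

theorem wedge_add_middle (u v v' w : Fin 3 ⊕ Fin 3 → F) :
    wedge u (v + v') w = wedge u v w + wedge u v' w :=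
  trivec_ext fun i j l _ _ => by simp only [map_add, coord_wedge, Pi.add_apply]; ring

theorem wedge_add_right (u v w w' : Fin 3 ⊕ Fin 3 → F) :
    wedge u v (w + w') = wedge u v w + wedge u v w' :=
  trivec_ext fun i j l _ _ => by simp only [map_add, coord_wedge, Pi.add_apply]; ring

theorem wedge_smul_left (c : F) (u v w : Fin 3 ⊕ Fin 3 → F) :
    wedge (c • u) v w = c • wedge u v w :=
  trivec_ext fun i j l _ _ => by
    simp only [map_smul, coord_wedge, Pi.smul_apply, smul_eq_mul]; ring

/-- The element `e_i ↦ e_i`, `e_{i+3} ↦ e_{i+3} + s_i e_i` of `Sp₆`. -/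
def spUpper (s : Fin 3 → F) : symplecticGroup (Fin 3) F :=
  ⟨fromBlocks 1 (diagonal s) 0 1, by
    rw [SymplecticGroup.mem_iff, J, fromBlocks_transpose, fromBlocks_multiply, fromBlocks_multiply]
    simp⟩

/-- The element `e_i ↦ e_i + s_i e_{i+3}`, `e_{i+3} ↦ e_{i+3}` of `Sp₆`. -/
def spLower (s : Fin 3 → F) : symplecticGroup (Fin 3) F :=
  ⟨fromBlocks 1 0 (diagonal s) 1, by
    rw [SymplecticGroup.mem_iff, J, fromBlocks_transpose, fromBlocks_multiply, fromBlocks_multiply]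
    simp⟩

theorem spUpper_mulVec_eL (s : Fin 3 → F) (i : Fin 3) : (spUpper s).1 *ᵥ eL F i = eL F i := by
  rw [eL, mulVec_single_one]
  ext (j | j) <;> simp [spUpper, Matrix.one_apply, Pi.single_apply]

theorem spUpper_mulVec_eR (s : Fin 3 → F) (i : Fin 3) :
    (spUpper s).1 *ᵥ eR F i = eR F i + s i • eL F i := by
  rw [eL, eR, mulVec_single_one]
  ext (j | j) <;> simp +contextual [spUpper, Matrix.one_apply, Pi.single_apply, diagonal_apply]

theorem spLower_mulVec_eL (s : Fin 3 → F) (i : Fin 3) :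
    (spLower s).1 *ᵥ eL F i = eL F i + s i • eR F i := by
  rw [eL, eR, mulVec_single_one]
  ext (j | j) <;> simp +contextual [spLower, Matrix.one_apply, Pi.single_apply, diagonal_apply]

theorem spAct_spUpper_diagElt (s a b c : F) :
    spAct (spUpper ![s, 0, 0]) (diagElt a b c) =
      diagElt a b c + (a * s) • wedge (eL F 0) (eL F 1) (eL F 2) := by
  simp only [diagElt, map_add, map_smul, spAct_wedge, spUpper_mulVec_eL, spUpper_mulVec_eR,
    cons_val_zero, cons_val_one, cons_val, zero_smul, add_zero, wedge_add_left, wedge_smul_left]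
  module

theorem diagElt_mem_X (a b c : F) : diagElt a b c ∈ X F := by
  have hmem (g) : spAct g (wedge (eL F 0) (eL F 1) (eL F 2)) ∈ X F := Submodule.subset_span ⟨g, rfl⟩
  have h : wedge (eL F 0) (eL F 1) (eL F 2) ∈ X F := by simpa only [spAct_one] using hmem 1
  have h0 : wedge (eR F 0) (eL F 1) (eL F 2) ∈ X F := by
    simpa [spAct_wedge, spLower_mulVec_eL, wedge_add_left, Submodule.add_mem_iff_right _ h]
      using hmem (spLower ![1, 0, 0])
  have h1 : wedge (eL F 0) (eR F 1) (eL F 2) ∈ X F := by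
    simpa [spAct_wedge, spLower_mulVec_eL, wedge_add_middle, Submodule.add_mem_iff_right _ h]
      using hmem (spLower ![0, 1, 0])
  have h2 : wedge (eL F 0) (eL F 1) (eR F 2) ∈ X F := by
    simpa [spAct_wedge, spLower_mulVec_eL, wedge_add_right, Submodule.add_mem_iff_right _ h]
      using hmem (spLower ![0, 0, 1])
  exact add_mem (add_mem (Submodule.smul_mem _ _ h0) (Submodule.smul_mem _ _ h1))
    (Submodule.smul_mem _ _ h2)

-- `spUpper` removes the coordinate at `e₁ ∧ e₂ ∧ e₃` and leaves the symmetric part unchanged.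
theorem IsTangent.exists_spAct_eq_diagElt {x : Trivec F} (hx : IsTangent x) {a b c : F}
    (ha : a ≠ 0) (h : symPart x = diagonal ![a, b, c]) : ∃ g, spAct g x = diagElt a b c := by
  set t := coord (Sum.inl 0) (Sum.inl 1) (Sum.inl 2) x
  have hx' : x = diagElt a b c + t • wedge (eL F 0) (eL F 1) (eL F 2) := by
    refine hx.ext ((isTangent_diagElt a b c).add fun s i j => ?_) ?_ ?_
    · simp [coord_wedge, eL]
    · have hsymPart : symPart (wedge (eL F 0) (eL F 1) (eL F 2)) = 0 := by
        ext i j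
        simp [symPart_apply, coord_wedge, eL]
      rw [map_add, map_smul, hsymPart, smul_zero, add_zero, symPart_diagElt, h]
    · rw [map_add, coord_inl_diagElt]
      simp [coord_wedge, eL, t]
  refine ⟨spUpper ![-(t / a), 0, 0], ?_⟩
  rw [hx', map_add, spAct_spUpper_diagElt, map_smul, spAct_wedge, spUpper_mulVec_eL,
    spUpper_mulVec_eL, spUpper_mulVec_eL, mul_neg, mul_div_cancel₀ _ ha]
  module

end UnipotentElements

section ClosedOrbit

variable {F : Type*} [Field F]

theorem exists_spAct_diagElt_eq_one [IsAlgClosed F] {a b c : F} (ha : a ≠ 0) (hb : b ≠ 0)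
    (hc : c ≠ 0) : ∃ g, spAct g (diagElt a b c) = diagElt 1 1 1 := by
  have hsq {a : F} (ha : a ≠ 0) : ∃ α ≠ 0, α ^ 2 = a := by
    obtain ⟨α, rfl⟩ := IsAlgClosed.exists_pow_nat_eq a two_pos
    exact ⟨α, ne_zero_pow two_ne_zero ha, rfl⟩
  obtain ⟨α, hα, rfl⟩ := hsq ha
  obtain ⟨β, hβ, rfl⟩ := hsq hb
  obtain ⟨δ, hδ, rfl⟩ := hsq hc
  refine ⟨spBlockDiag (diagonal ![(β * δ)⁻¹, (α * δ)⁻¹, (α * β)⁻¹])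
    (diagonal ![β * δ, α * δ, α * β]) ?_, spAct_spBlockDiag_diagElt _ _ _ ?_⟩
  · rw [diagonal_transpose, diagonal_mul_diagonal, ← diagonal_one]
    congr 1
    ext i
    fin_cases i <;> exact inv_mul_cancel₀ (mul_ne_zero ‹_› ‹_›)
  · rw [diagonal_transpose, diagonal_mul_diagonal, diagonal_mul_diagonal, det_diagonal,
      ← diagonal_smul, Fin.prod_univ_three]
    congr 1
    ext i
    fin_cases i <;> simp <;> field_simp

theorem exists_spAct_diagElt_eq_basePoint [NeZero (2 : F)] :
    ∃ g, spAct g (diagElt (-1) 1 (-2⁻¹) : Trivec F) =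
      wedge (eL _ 0) (eR _ 0) (eL _ 2) + wedge (eR _ 1) (eL _ 1) (eL _ 2) +
        wedge (eL _ 0) (eL _ 1) (eR _ 2) := by
  have h2 := NeZero.ne (2 : F)
  have hPZ : (!![1, 1, 0; 1, -1, 0; 0, 0, 1] : Matrix (Fin 3) (Fin 3) F)ᵀ *
      !![2⁻¹, 2⁻¹, 0; 2⁻¹, -2⁻¹, 0; 0, 0, 1] = 1 := by
    ext i j
    fin_cases i <;> fin_cases j <;> simp [Matrix.mul_apply, Fin.sum_univ_three] <;>
      field_simp <;> norm_num
  refine ⟨spBlockDiag _ _ hPZ, (isTangent_spBlockDiag_diagElt _ _ _ _ _ _).ext ?_ ?_ ?_⟩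
  · intro s i j
    simp [coord_wedge, eL]
  · rw [symPart_spBlockDiag_diagElt]
    ext i j
    rw [symPart_apply, Matrix.smul_apply, Matrix.mul_apply]
    simp only [mul_diagonal, Fin.sum_univ_three, transpose_apply]
    fin_cases i <;> fin_cases j <;> simp [det_fin_three, coord_wedge, eL, eR] <;>
      field_simp <;> norm_num
  · rw [coord_inl_spBlockDiag_diagElt]
    simp [coord_wedge, eR]

end ClosedOrbit

section X2

variable {k : Type u} [Field k]

theorem rank_map_of_isSymm {F : Type*} (K : Type*) [Field F] [Field K] [Algebra F K]
    [NeZero (2 : F)] {n : Type*} [Fintype n] {S : Matrix n n F} (hS : S.IsSymm) :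
    (S.map (algebraMap F K)).rank = S.rank := by
  classical
  obtain ⟨P, w, hP, rfl⟩ := exists_eq_mul_diagonal_mul_transpose hS
  have hP' : IsUnit (P.map (algebraMap F K)).det := by
    simpa [RingHom.map_det] using hP.map (algebraMap F K)
  rw [Matrix.map_mul, Matrix.map_mul, diagonal_map (map_zero _), transpose_map,
    rank_mul_eq_left_of_isUnit_det _ _ (isUnit_det_transpose _ hP'),
    rank_mul_eq_right_of_isUnit_det _ _ hP',
    rank_mul_eq_left_of_isUnit_det _ _ (isUnit_det_transpose _ hP),
    rank_mul_eq_right_of_isUnit_det _ _ hP, rank_diagonal, rank_diagonal]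
  simp

theorem rank_fromBlocks_diagonal {l F : Type*} [Fintype l] [DecidableEq l] [Field F] {d : l → F}
    (hd : ∀ i, d i ≠ 0) :
    (fromBlocks (diagonal d) 0 0 0 : Matrix (l ⊕ l) (l ⊕ l) F).rank = Fintype.card l := by
  classical
  have h : fromBlocks (diagonal d) 0 0 0 = diagonal (Sum.elim d fun _ : l => 0) := by
    rw [← fromBlocks_diagonal, diagonal_zero]
  rw [h, rank_diagonal]
  refine (Fintype.card_congr
    (Equiv.ofBijective (fun i => ⟨Sum.inl i, hd i⟩) ⟨fun i j h => ?_, ?_⟩)).symm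
  · exact Sum.inl_injective (congrArg Subtype.val h)
  · rintro ⟨i | i, hi⟩
    · exact ⟨i, rfl⟩
    · exact absurd rfl hi

theorem neZero_two_of_algebra (F K : Type*) [Field F] [Field K] [Algebra F K] [NeZero (2 : F)] :
    NeZero (2 : K) :=
  ⟨by
    rw [← map_ofNat (algebraMap F K) 2]
    exact (map_ne_zero _).mpr (NeZero.ne 2)⟩

section Descent

variable {K : Type*} [Field K] [Algebra k K] {x : Trivec k} {y : Trivec K}
  {g : symplecticGroup (Fin 3) K}

theorem rank_covariant_of_extend_eq [NeZero (2 : k)] (h : extend k K x = spAct g y) :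
    (covariant x).rank = (covariant y).rank := by
  have hdet := SymplecticGroup.symplectic_det g.2
  rw [← rank_map_of_isSymm K (covariant_isSymm x), ← covariant_extend, h, covariant_spAct,
    rank_mul_eq_left_of_isUnit_det _ _ (isUnit_det_transpose _ hdet),
    rank_mul_eq_right_of_isUnit_det _ _ hdet]

theorem covariant_mul_J_mul_covariant_of_extend_eq (h : extend k K x = spAct g y)
    (hy : IsTangent y) : covariant x * J (Fin 3) k * covariant x = 0 := by
  refine Matrix.map_injective (algebraMap k K).injective ?_
  simp only [Matrix.map_mul, ← covariant_extend, map_J, h, covariant_spAct,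
    mul_mul_transpose_mul_J_mul, hy.covariant_mul_J_mul_covariant, Matrix.mul_zero,
    Matrix.zero_mul, Matrix.map_zero _ (map_zero _)]

theorem covariantSlice_eq_zero_of_extend_eq (h : extend k K x = spAct g y) (hy : IsTangent y)
    (a : Fin 3 ⊕ Fin 3) : covariantSlice a x = 0 := by
  refine Matrix.map_injective (algebraMap k K).injective ?_
  simp only [← covariantSlice_extend, h, covariantSlice_spAct, hy.covariantSlice_eq_zero,
    Matrix.mul_zero, Matrix.zero_mul, smul_zero, Finset.sum_const_zero,
    Matrix.map_zero _ (map_zero _)]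

end Descent

theorem extend_diagElt {K : Type*} [Field K] [Algebra k K] (a b c : k) :
    extend k K (diagElt a b c) =
      diagElt (algebraMap k K a) (algebraMap k K b) (algebraMap k K c) := by
  have hL (i) : algebraMap k K ∘ eL k i = eL K i := by
    ext j
    simp [eL, Pi.single_apply]
  have hR (i) : algebraMap k K ∘ eR k i = eR K i := by
    ext j
    simp [eR, Pi.single_apply]
  simp only [diagElt, map_add, map_smul, extend_wedge, hL, hR, algebraMap_smul]

variable [NeZero (2 : k)]

theorem mem_X2_iff (x : Trivec k) : x ∈ X2 k ↔ x ∈ X k ∧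
    ∃ g : symplecticGroup (Fin 3) (AlgebraicClosure k),
      extend k (AlgebraicClosure k) x = spAct g (diagElt 1 1 1) := by
  have := neZero_two_of_algebra k (AlgebraicClosure k)
  obtain ⟨g₁, h₁⟩ := exists_spAct_diagElt_eq_basePoint (F := AlgebraicClosure k)
  obtain ⟨g₂, h₂⟩ := exists_spAct_diagElt_eq_one (F := AlgebraicClosure k) (a := -1) (b := 1)
    (c := -2⁻¹) (by simp) one_ne_zero (by simp [NeZero.ne])
  refine and_congr_right fun _ => ⟨fun ⟨g, hg⟩ => ⟨g * g₁ * g₂⁻¹, ?_⟩,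
    fun ⟨g, hg⟩ => ⟨g * g₂ * g₁⁻¹, ?_⟩⟩ <;>
  rw [hg, ← h₁, ← h₂, ← spAct_mul, ← spAct_mul, inv_mul_cancel_right]

theorem diagElt_mem_X2 (a b c : kˣ) : diagElt (a : k) (b : k) (c : k) ∈ X2 k := by
  refine (mem_X2_iff _).mpr ⟨diagElt_mem_X _ _ _, ?_⟩
  obtain ⟨g, hg⟩ := exists_spAct_diagElt_eq_one (F := AlgebraicClosure k)
    (a := algebraMap k _ a) (b := algebraMap k _ b) (c := algebraMap k _ c) (by simp) (by simp)
    (by simp)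
  exact ⟨g⁻¹, by rw [extend_diagElt, ← hg, ← spAct_mul, inv_mul_cancel, spAct_one]⟩

theorem exists_isTangent_spAct {x : Trivec k} (hrank : (covariant x).rank = 3)
    (hJ : covariant x * J (Fin 3) k * covariant x = 0) (hslice : ∀ a, covariantSlice a x = 0) :
    ∃ (g : symplecticGroup (Fin 3) k) (d : Fin 3 → k), (∀ i, d i ≠ 0) ∧
      covariant (spAct g x) = fromBlocks (diagonal d) 0 0 0 ∧ IsTangent (spAct g x) := by
  obtain ⟨g, d, hd, hg⟩ :=
    exists_symplecticGroup_mul_fromBlocks_mul_transpose_eq (covariant_isSymm x) hrank hJ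
  have hcov : covariant (spAct g⁻¹ x) = fromBlocks (diagonal d) 0 0 0 := by
    have hgg : (g⁻¹).1 * g.1 = 1 := congrArg Subtype.val (inv_mul_cancel g)
    calc covariant (spAct g⁻¹ x)
        = ((g⁻¹).1 * g.1) * fromBlocks (diagonal d) 0 0 0 * ((g⁻¹).1 * g.1)ᵀ := by
          rw [covariant_spAct, ← hg]; simp only [Matrix.mul_assoc, transpose_mul]
      _ = fromBlocks (diagonal d) 0 0 0 := by
          rw [hgg, transpose_one, Matrix.one_mul, Matrix.mul_one]
  refine ⟨g⁻¹, d, hd, hcov, isTangent_of_covariantSlice_eq_zero hd hcov fun a => ?_⟩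
  simp only [covariantSlice_spAct, hslice, Matrix.mul_zero, Matrix.zero_mul, smul_zero,
    Finset.sum_const_zero]

theorem exists_spAct_eq_diagElt {x : Trivec k} (hx : x ∈ X2 k) :
    ∃ (g : symplecticGroup (Fin 3) k) (a b c : kˣ), spAct g x = diagElt (a : k) b c := by
  obtain ⟨hX, g₀, hg₀⟩ := (mem_X2_iff x).mp hx
  have hrank : (covariant x).rank = 3 := by
    have := neZero_two_of_algebra k (AlgebraicClosure k)
    rw [rank_covariant_of_extend_eq hg₀, covariant_diagElt]
    refine rank_fromBlocks_diagonal fun i => ?_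
    have h4 : (4 : AlgebraicClosure k) ≠ 0 := by
      rw [← two_add_two_eq_four, ← two_mul]
      exact mul_ne_zero (NeZero.ne 2) (NeZero.ne 2)
    fin_cases i <;> simpa using h4
  have htangent := isTangent_diagElt (1 : AlgebraicClosure k) 1 1
  obtain ⟨g, d, hd, hcov, hy⟩ := exists_isTangent_spAct hrank
    (covariant_mul_J_mul_covariant_of_extend_eq hg₀ htangent)
    (covariantSlice_eq_zero_of_extend_eq hg₀ htangent)
  have hsymm : (symPart (spAct g x)).IsSymm := hy.isSymm_symPart (by
    rw [contraction_spAct, contraction_eq_zero_of_mem_X hX, mulVec_zero])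
  obtain ⟨s, hs, hdiag⟩ := exists_eq_diagonal_of_smul_adjugate_eq hd
    (congrArg toBlocks₁₁ ((hy.covariant_of_isSymm hsymm).symm.trans hcov))
  obtain ⟨h, hh⟩ := hy.exists_spAct_eq_diagElt (a := s 0) (b := s 1) (c := s 2) (hs 0) (by
    rw [hdiag]
    congr 1
    ext i
    fin_cases i <;> rfl)
  exact ⟨h * g, .mk0 _ (hs 0), .mk0 _ (hs 1), .mk0 _ (hs 2), by rw [spAct_mul, hh]; rfl⟩

end X2

section OrbitClassification

variable {k : Type u} [Field k]

theorem exists_det_eq_of_mul_mul_transpose_eq {n F : Type*} [Fintype n] [DecidableEq n] [Field F]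
    (hn : Odd (Fintype.card n)) {P D D' : Matrix n n F} {t : F} (h : P * D * Pᵀ = D')
    (hD : D.det ≠ 0) (ht : D'.det = t ^ 2 * D.det) :
    ∃ R : Matrix n n F, R.det = t ∧ R * D * Rᵀ = D' := by
  have hsq : P.det ^ 2 = t ^ 2 := by
    refine mul_right_cancel₀ hD ?_
    rw [← ht, ← h, det_mul, det_mul, det_transpose]
    ring
  rcases sq_eq_sq_iff_eq_or_eq_neg.mp hsq with hP | hP
  · exact ⟨P, hP, h⟩
  · refine ⟨-P, ?_, by simpa [transpose_neg] using h⟩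
    rw [det_neg, hn.neg_one_pow, hP, neg_one_mul, neg_neg]

theorem det_diagonal_mul_cyclic (a b c : k) :
    (diagonal ![b * c, c * a, a * b]).det = (a * b * c) ^ 2 := by
  rw [det_diagonal, Fin.prod_univ_three]
  simp only [cons_val_zero, cons_val_one, cons_val]
  ring

theorem diagonal_mul_cyclic_mul_diagonal (a b c : k) :
    diagonal ![b * c, c * a, a * b] * diagonal ![a, b, c] =
      (a * b * c) • (1 : Matrix (Fin 3) (Fin 3) k) := by
  rw [diagonal_mul_diagonal, ← diagonal_one, ← diagonal_smul]
  congr 1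
  funext i
  fin_cases i <;> simp <;> ring

theorem equivalent_of_spAct_diagElt_eq [NeZero (2 : k)] {a b c a' b' c' : kˣ}
    {g : symplecticGroup (Fin 3) k}
    (hg : spAct g (diagElt (a : k) b c) = diagElt (a' : k) b' c') :
    Equivalent (diagForm 1 ((b : k) * c) (c * a) (a * b))
      (diagForm 1 ((b' : k) * c') (c' * a') (a' * b')) := by
  have h4 : (-4 : k) ≠ 0 := by
    rw [show (-4 : k) = -(2 * 2) by norm_num]
    exact neg_ne_zero.mpr (mul_ne_zero (NeZero.ne 2) (NeZero.ne 2))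
  have hcov := covariant_spAct g (diagElt (a : k) b c)
  rw [hg, covariant_diagElt, covariant_diagElt, ← fromBlocks_toBlocks g.1, fromBlocks_transpose,
    fromBlocks_multiply, fromBlocks_multiply] at hcov
  have hblock := congrArg toBlocks₁₁ hcov
  simp only [toBlocks_fromBlocks₁₁, Matrix.mul_zero, add_zero, Matrix.zero_mul] at hblock
  rw [diagonal_smul, diagonal_smul, Matrix.mul_smul, Matrix.smul_mul] at hblock
  have hcongr := smul_right_injective _ h4 hblock
  refine (equivalent_vecCons_iff one_ne_zero).mpr (equivalent_weightedSumSquares_iff_congr.mpr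
    ⟨(toBlocks₁₁ g.1)ᵀ, ?_, by rw [transpose_transpose]; exact hcongr.symm⟩).symm
  have hdet := congrArg det hcongr
  rw [det_mul, det_diagonal_mul_cyclic] at hdet
  rw [isUnit_iff_ne_zero]
  intro h0
  simp [h0] at hdet

theorem exists_spAct_diagElt_eq_of_equivalent [NeZero (2 : k)] {a b c a' b' c' : kˣ}
    (h : Equivalent (diagForm 1 ((b : k) * c) (c * a) (a * b))
      (diagForm 1 ((b' : k) * c') (c' * a') (a' * b'))) :
    ∃ g, spAct g (diagElt (a : k) b c) = diagElt (a' : k) b' c' := by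
  obtain ⟨P, -, hP⟩ := equivalent_weightedSumSquares_iff_congr.mp
    ((equivalent_vecCons_iff one_ne_zero).mp h).symm
  obtain ⟨R, hR, hcongr⟩ := exists_det_eq_of_mul_mul_transpose_eq (P := Pᵀ)
    (D := diagonal ![(b : k) * c, c * a, a * b])
    (D' := diagonal ![(b' : k) * c', c' * a', a' * b']) (t := a' * b' * c' / (a * b * c))
    (by decide) (by rw [transpose_transpose]; exact hP)
    (by rw [det_diagonal_mul_cyclic]; simp)
    (by
      rw [det_diagonal_mul_cyclic, det_diagonal_mul_cyclic, ← mul_pow, div_mul_cancel₀]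
      simp)
  have hu : IsUnit R.det := by simp [hR]
  have hu' : IsUnit Rᵀ.det := by rwa [det_transpose]
  refine ⟨spBlockDiag R (Rᵀ)⁻¹ (mul_nonsing_inv _ hu'), spAct_spBlockDiag_diagElt _ _ _ ?_⟩
  have hunit : IsUnit (diagonal ![(b' : k) * c', c' * a', a' * b']) := by
    rw [Matrix.isUnit_iff_isUnit_det, det_diagonal_mul_cyclic]
    simp
  refine hunit.mul_left_cancel ?_
  calc _ = R.det • (R * (diagonal ![(b : k) * c, c * a, a * b] *
          (Rᵀ * (Rᵀ)⁻¹) * diagonal ![(a : k), b, c]) * R⁻¹) := by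
        rw [← hcongr, Matrix.mul_smul, transpose_nonsing_inv, transpose_transpose]
        simp only [Matrix.mul_assoc]
    _ = (R.det * (a * b * c)) • 1 := by
        rw [mul_nonsing_inv _ hu', Matrix.mul_one, diagonal_mul_cyclic_mul_diagonal,
          Matrix.mul_smul, Matrix.smul_mul, Matrix.mul_one, mul_nonsing_inv _ hu, smul_smul]
    _ = _ := by
        rw [diagonal_mul_cyclic_mul_diagonal, hR, div_mul_cancel₀]
        simp

theorem exists_spAct_diagElt_iff [NeZero (2 : k)] (a b c a' b' c' : kˣ) :
    (∃ g, spAct g (diagElt (a : k) b c) = diagElt (a' : k) b' c') ↔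
      Equivalent (diagForm 1 ((b : k) * c) (c * a) (a * b))
        (diagForm 1 ((b' : k) * c') (c' * a') (a' * b')) :=
  ⟨fun ⟨_, hg⟩ => equivalent_of_spAct_diagElt_eq hg, exists_spAct_diagElt_eq_of_equivalent⟩

theorem x2Setoid_iff_of_spAct_eq {x y : X2 k} {g h : symplecticGroup (Fin 3) k} {x' y' : Trivec k}
    (hx : spAct g x.1 = x') (hy : spAct h y.1 = y') :
    x2Setoid k x y ↔ ∃ f, spAct f x' = y' := by
  subst hx hy
  constructor
  · rintro ⟨f, hf⟩
    exact ⟨h * f * g⁻¹, by rw [← spAct_mul, inv_mul_cancel_right, spAct_mul, hf]⟩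
  · rintro ⟨f, hf⟩
    exact ⟨h⁻¹ * f * g, by rw [spAct_mul, spAct_mul, hf, ← spAct_mul, inv_mul_cancel, spAct_one]⟩

theorem exists_quatAlg_norm_equivalent_mul_cyclic [NeZero (2 : k)] (a b c : kˣ) :
    ∃ Q : QuatAlg k, Equivalent Q.norm (diagForm 1 ((b : k) * c) (c * a) (a * b)) := by
  obtain ⟨Q, hQ⟩ := exists_quatAlg_norm_equivalent (a := (b : k) * c) (b := (c : k) * a)
    (by simp) (by simp)
  refine ⟨Q, hQ.trans (equivalent_weightedSumSquares_of_sq ![1, 1, 1, (c : k)] ?_ ?_)⟩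
  · intro i
    fin_cases i <;> simp
  · intro i
    fin_cases i <;> simp
    ring

theorem exists_norm_equivalent_mul_cyclic [NeZero (2 : k)] (Q : QuatAlg k) :
    ∃ a b c : kˣ, Equivalent Q.norm (diagForm 1 ((b : k) * c) (c * a) (a * b)) := by
  obtain ⟨u, v, hu, hv, hQ⟩ := exists_norm_equivalent_diagForm Q
  exact ⟨Units.mk0 v hv, Units.mk0 u hu, 1, by simpa [mul_comm v u] using hQ⟩

theorem exists_equiv_X2Orbits [NeZero (2 : k)] :
    ∃ Ψ : X2Orbits k ≃ QuatClasses k, ∀ a b c : kˣ,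
      ∃ hx : diagElt (a : k) (b : k) (c : k) ∈ X2 k, ∀ Q : QuatAlg k,
        Ψ (Quotient.mk (x2Setoid k) ⟨diagElt (a : k) (b : k) (c : k), hx⟩) =
            Quotient.mk (quatSetoid k) Q ↔
          Equivalent Q.norm (diagForm 1 ((b : k) * c) (c * a) (a * b)) := by
  choose g a b c hg using fun x : X2 k => exists_spAct_eq_diagElt x.2
  let F (x : X2 k) : QuadraticForm k (Fin 4 → k) :=
    diagForm 1 ((b x : k) * c x) (c x * a x) (a x * b x)
  have hs (x y : X2 k) : x2Setoid k x y ↔ Equivalent (F x) (F y) := by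
    rw [x2Setoid_iff_of_spAct_eq (hg x) (hg y)]
    exact exists_spAct_diagElt_iff (a x) (b x) (c x) (a y) (b y) (c y)
  have hF (a' b' c' : kˣ) : Equivalent (F ⟨_, diagElt_mem_X2 a' b' c'⟩)
      (diagForm 1 ((b' : k) * c') (c' * a') (a' * b')) := by
    refine (exists_spAct_diagElt_iff ..).mp ⟨(g ⟨_, diagElt_mem_X2 a' b' c'⟩)⁻¹, ?_⟩
    rw [← hg, ← spAct_mul, inv_mul_cancel, spAct_one]
  obtain ⟨Ψ, hΨ⟩ := exists_equiv_quatClasses (x2Setoid k) F hs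
    (fun x => exists_quatAlg_norm_equivalent_mul_cyclic (a x) (b x) (c x))
    (fun Q => by
      obtain ⟨a', b', c', hQ⟩ := exists_norm_equivalent_mul_cyclic Q
      exact ⟨⟨_, diagElt_mem_X2 a' b' c'⟩, hQ.trans (hF a' b' c').symm⟩)
  refine ⟨Ψ, fun a' b' c' => ⟨diagElt_mem_X2 a' b' c', fun Q => ?_⟩⟩
  rw [hΨ]
  exact ⟨fun h => h.trans (hF a' b' c'), fun h => h.trans (hF a' b' c').symm⟩

end OrbitClassification

/-! ### Jordan algebras of symmetric matrices of degree three -/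

section SpecialJordan

variable {k A : Type*} [Field k] [Ring A] [Algebra k A] {J : Submodule k A}

/-- The submodule `J` of the associative algebra `A` is closed under the anticommutator, so that it
is a special Jordan algebra when `2` is invertible. -/
def IsSpecialJordan (J : Submodule k A) : Prop :=
  ∀ x ∈ J, ∀ y ∈ J, x * y + y * x ∈ J

theorem mem_of_two_smul_mem [NeZero (2 : k)] {x : A} (h : (2 : k) • x ∈ J) : x ∈ J :=
  (J.smul_mem_iff (NeZero.ne 2)).mp h

namespace IsSpecialJordan

variable [NeZero (2 : k)]

theorem mul_self_mem (hJ : IsSpecialJordan J) {x : A} (hx : x ∈ J) : x * x ∈ J :=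
  mem_of_two_smul_mem (by rw [two_smul]; exact hJ x hx x hx)

theorem mul_mul_mem (hJ : IsSpecialJordan J) {x y : A} (hx : x ∈ J) (hy : y ∈ J) :
    x * y * x ∈ J := by
  refine mem_of_two_smul_mem ?_
  have h := J.sub_mem (hJ x hx _ (hJ x hx y hy)) (hJ _ (hJ.mul_self_mem hx) y hy)
  convert h using 1
  rw [two_smul]
  noncomm_ring

theorem lie_mul_lie_mem (hJ : IsSpecialJordan J) {x y : A} (hx : x ∈ J) (hy : y ∈ J) :
    ⁅x, y⁆ * ⁅x, y⁆ ∈ J := by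
  have h := J.sub_mem (J.sub_mem (hJ x hx _ (hJ.mul_mul_mem hy hx))
    (hJ.mul_mul_mem hx (hJ.mul_self_mem hy))) (hJ.mul_mul_mem hy (hJ.mul_self_mem hx))
  convert h using 1
  simp only [Ring.lie_def]
  noncomm_ring

omit [NeZero (2 : k)] in
theorem lie_lie_mem (hJ : IsSpecialJordan J) {x y z : A} (hx : x ∈ J) (hy : y ∈ J) (hz : z ∈ J) :
    ⁅⁅x, y⁆, z⁆ ∈ J := by
  have h := J.sub_mem (hJ x hx _ (hJ y hy z hz)) (hJ y hy _ (hJ x hx z hz))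
  convert h using 1
  simp only [Ring.lie_def]
  noncomm_ring

end IsSpecialJordan

end SpecialJordan

section CrossMatrix

variable {R : Type*} [CommRing R]

/-- The matrix of `v ↦ s × v`. -/
def crossMatrix (s : Fin 3 → R) : Matrix (Fin 3) (Fin 3) R :=
  !![0, -s 2, s 1; s 2, 0, -s 0; -s 1, s 0, 0]

/-- The inverse of `crossMatrix` on alternating matrices. -/
def axialVector : Matrix (Fin 3) (Fin 3) R →ₗ[R] (Fin 3 → R) where
  toFun M := ![M 2 1, M 0 2, M 1 0]
  map_add' M N := by simp
  map_smul' c M := by simp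

theorem axialVector_apply (M : Matrix (Fin 3) (Fin 3) R) :
    axialVector M = ![M 2 1, M 0 2, M 1 0] := rfl

theorem crossMatrix_axialVector_lie {x y : Matrix (Fin 3) (Fin 3) R} (hx : x.IsSymm)
    (hy : y.IsSymm) : crossMatrix (axialVector ⁅x, y⁆) = ⁅x, y⁆ := by
  ext i j
  fin_cases i <;> fin_cases j <;>
    simp [crossMatrix, axialVector_apply, Ring.lie_def, Matrix.mul_apply, Fin.sum_univ_three,
      hx.apply 0 1, hx.apply 0 2, hx.apply 1 2, hy.apply 0 1, hy.apply 0 2, hy.apply 1 2] <;> ring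

theorem crossMatrix_mul_self (s : Fin 3 → R) :
    crossMatrix s * crossMatrix s = vecMulVec s s - (s ⬝ᵥ s) • 1 := by
  ext i j
  fin_cases i <;> fin_cases j <;>
    simp [crossMatrix, Matrix.mul_apply, Fin.sum_univ_three, vecMulVec_apply, dotProduct] <;> ring

theorem trace_crossMatrix_mul (s t : Fin 3 → R) :
    trace (crossMatrix s * crossMatrix t) = -2 * (s ⬝ᵥ t) := by
  simp only [crossMatrix, trace, diag_apply, Matrix.mul_apply, Fin.sum_univ_three, dotProduct,
    of_apply, cons_val]
  ring

theorem trace_lie_mul_add_mul_lie {n : Type*} [Fintype n] (a b c : Matrix n n R) :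
    trace (⁅a, b⁆ * c + c * ⁅a, b⁆) = 2 * trace (a * ⁅b, c⁆) := by
  simp only [Ring.lie_def, mul_sub, sub_mul, trace_add, trace_sub, ← Matrix.mul_assoc]
  rw [trace_mul_cycle b a c, trace_mul_cycle c b a, ← trace_mul_cycle a b c]
  ring

theorem lie_crossMatrix_lie_crossMatrix_vecMulVec (s t : Fin 3 → R) :
    ⁅crossMatrix t, ⁅crossMatrix s, vecMulVec t t⁆⁆ =
      (t ⬝ᵥ t) • (vecMulVec s t + vecMulVec t s) - (2 * (s ⬝ᵥ t)) • vecMulVec t t := by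
  ext i j
  simp only [Ring.lie_def, Matrix.mul_apply, Matrix.sub_apply, Matrix.add_apply,
    Matrix.smul_apply, Fin.sum_univ_three, vecMulVec_apply, dotProduct, smul_eq_mul]
  fin_cases i <;> fin_cases j <;> simp [crossMatrix] <;> ring

theorem vecMulVec_mul_add_mul {n : Type*} [Fintype n] (s t : n → R) :
    vecMulVec s s * vecMulVec t t + vecMulVec t t * vecMulVec s s =
      (s ⬝ᵥ t) • (vecMulVec s t + vecMulVec t s) := by
  rw [vecMulVec_mul_vecMulVec, vecMulVec_mul_vecMulVec, dotProduct_comm t s, smul_add,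
    vecMulVec_smul, vecMulVec_smul]

theorem transpose_mul_mul_eq_sum {m n : Type*} [Fintype m] (S : Matrix m n R) (Z : Matrix m m R) :
    Sᵀ * Z * S = ∑ i, ∑ j, Z i j • vecMulVec (S i) (S j) := by
  ext p q
  simp only [Matrix.mul_apply, Matrix.sum_apply, Matrix.smul_apply, vecMulVec_apply,
    transpose_apply, Finset.sum_mul, smul_eq_mul]
  rw [Finset.sum_comm]
  refine Finset.sum_congr rfl fun i _ => Finset.sum_congr rfl fun j _ => ?_
  ring

theorem two_smul_transpose_mul_mul_eq_sum {m n : Type*} [Fintype m] (S : Matrix m n R)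
    {Z : Matrix m m R} (hZ : Z.IsSymm) :
    (2 : R) • (Sᵀ * Z * S) =
      ∑ i, ∑ j, Z i j • (vecMulVec (S i) (S j) + vecMulVec (S j) (S i)) := by
  simp only [smul_add, Finset.sum_add_distrib]
  rw [two_smul, transpose_mul_mul_eq_sum, add_right_inj, Finset.sum_comm]
  simp only [hZ.apply]

theorem det_eq_zero_of_principal_submatrix_eq_zero {M : Matrix (Fin 3) (Fin 3) R} {i j : Fin 3}
    (hij : i ≠ j) (hii : M i i = 0) (hij₀ : M i j = 0) (hji₀ : M j i = 0) (hjj : M j j = 0) :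
    M.det = 0 := by
  rw [det_fin_three]
  fin_cases i <;> fin_cases j <;> first | exact absurd rfl hij | skip
  all_goals
    simp only [Fin.zero_eta, Fin.mk_one, Fin.reduceFinMk] at hii hij₀ hji₀ hjj
    simp only [hii, hij₀, hji₀, hjj]
    ring

/-- The axial vectors of the commutators of the elements of `J`. -/
def axialVectors (J : Set (Matrix (Fin 3) (Fin 3) R)) : Set (Fin 3 → R) :=
  Set.image2 (fun a b => axialVector ⁅a, b⁆) J J

theorem span_axialVectors (J : Set (Matrix (Fin 3) (Fin 3) R)) :
    Submodule.span R (axialVectors J) =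
      Submodule.map₂ (LinearMap.compr₂ (LinearMap.mul R (Matrix (Fin 3) (Fin 3) R) -
          (LinearMap.mul R (Matrix (Fin 3) (Fin 3) R)).flip) axialVector)
        (Submodule.span R J) (Submodule.span R J) := by
  rw [Submodule.map₂_span_span]
  rfl

theorem span_axialVectors_eq_top_of_subset_span {J J' : Set (Matrix (Fin 3) (Fin 3) R)}
    (h : J ⊆ Submodule.span R J') (hJ : Submodule.span R (axialVectors J) = ⊤) :
    Submodule.span R (axialVectors J') = ⊤ := by
  rw [eq_top_iff, ← hJ, span_axialVectors, span_axialVectors]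
  exact Submodule.map₂_le_map₂ (Submodule.span_le.mpr h) (Submodule.span_le.mpr h)

end CrossMatrix

section SymmetricJordan

variable {k K : Type*} [Field k] [Field K] [Algebra k K]
  {J : Submodule k (Matrix (Fin 3) (Fin 3) K)} {s t : Fin 3 → K}

theorem crossMatrix_mul_self_mem [NeZero (2 : k)] (hJ : IsSpecialJordan J)
    (hsymm : ∀ x ∈ J, x.IsSymm) (hs : s ∈ axialVectors (J : Set (Matrix (Fin 3) (Fin 3) K))) :
    crossMatrix s * crossMatrix s ∈ J := by
  obtain ⟨a, ha, b, hb, rfl⟩ := hs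
  rw [crossMatrix_axialVector_lie (hsymm a ha) (hsymm b hb)]
  exact hJ.lie_mul_lie_mem ha hb

theorem lie_crossMatrix_mem (hJ : IsSpecialJordan J) (hsymm : ∀ x ∈ J, x.IsSymm)
    (hs : s ∈ axialVectors (J : Set (Matrix (Fin 3) (Fin 3) K))) {z : Matrix (Fin 3) (Fin 3) K}
    (hz : z ∈ J) : ⁅crossMatrix s, z⁆ ∈ J := by
  obtain ⟨a, ha, b, hb, rfl⟩ := hs
  rw [crossMatrix_axialVector_lie (hsymm a ha) (hsymm b hb)]
  exact hJ.lie_lie_mem ha hb hz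

theorem dotProduct_mem_range [NeZero (2 : k)] (hJ : IsSpecialJordan J)
    (hsymm : ∀ x ∈ J, x.IsSymm) (htr : ∀ x ∈ J, trace x ∈ (algebraMap k K).range)
    (hs : s ∈ axialVectors (J : Set (Matrix (Fin 3) (Fin 3) K)))
    (ht : t ∈ axialVectors (J : Set (Matrix (Fin 3) (Fin 3) K))) :
    s ⬝ᵥ t ∈ (algebraMap k K).range := by
  have := neZero_two_of_algebra k K
  obtain ⟨c, hc, d, hd, rfl⟩ := ht
  set z := ⁅crossMatrix s, c⁆
  have htrace : trace (z * d + d * z) = -4 * (s ⬝ᵥ axialVector ⁅c, d⁆) := by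
    have h := trace_crossMatrix_mul s (axialVector ⁅c, d⁆)
    rw [crossMatrix_axialVector_lie (hsymm c hc) (hsymm d hd)] at h
    rw [trace_lie_mul_add_mul_lie, h]
    ring
  obtain ⟨r, hr⟩ := htr _ (hJ z (lie_crossMatrix_mem hJ hsymm hs hc) d hd)
  refine ⟨-(2⁻¹ * 2⁻¹) * r, ?_⟩
  have h2 : (2 : K) ≠ 0 := NeZero.ne 2
  rw [map_mul, hr, htrace, map_neg, map_mul, map_inv₀, map_ofNat]
  field_simp
  ring

theorem vecMulVec_self_mem [NeZero (2 : k)] (hJ : IsSpecialJordan J)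
    (hsymm : ∀ x ∈ J, x.IsSymm) (htr : ∀ x ∈ J, trace x ∈ (algebraMap k K).range) (h1 : 1 ∈ J)
    (hs : s ∈ axialVectors (J : Set (Matrix (Fin 3) (Fin 3) K))) : vecMulVec s s ∈ J := by
  have h := crossMatrix_mul_self_mem hJ hsymm hs
  obtain ⟨r, hr⟩ := dotProduct_mem_range hJ hsymm htr hs hs
  rw [crossMatrix_mul_self, ← hr, algebraMap_smul] at h
  simpa using J.add_mem h (J.smul_mem r h1)

theorem mem_of_smul_mem {M : Type*} [AddCommGroup M] [Module k M] [Module K M]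
    [IsScalarTower k K M] {J : Submodule k M} {c : K} (hc : c ∈ (algebraMap k K).range)
    (hc0 : c ≠ 0) {x : M} (h : c • x ∈ J) : x ∈ J := by
  obtain ⟨r, rfl⟩ := hc
  rw [algebraMap_smul] at h
  exact (J.smul_mem_iff (ne_of_apply_ne _ (hc0.trans_eq (map_zero (algebraMap k K)).symm))).mp h

theorem vecMulVec_add_vecMulVec_mem [NeZero (2 : k)] (hJ : IsSpecialJordan J)
    (hsymm : ∀ x ∈ J, x.IsSymm) (htr : ∀ x ∈ J, trace x ∈ (algebraMap k K).range) (h1 : 1 ∈ J)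
    (hs : s ∈ axialVectors (J : Set (Matrix (Fin 3) (Fin 3) K)))
    (ht : t ∈ axialVectors (J : Set (Matrix (Fin 3) (Fin 3) K)))
    (hst : s ⬝ᵥ t ≠ 0 ∨ t ⬝ᵥ t ≠ 0) : vecMulVec s t + vecMulVec t s ∈ J := by
  have hss := vecMulVec_self_mem hJ hsymm htr h1 hs
  have htt := vecMulVec_self_mem hJ hsymm htr h1 ht
  by_cases h : s ⬝ᵥ t = 0
  · refine mem_of_smul_mem (dotProduct_mem_range hJ hsymm htr ht ht)
      (hst.resolve_left (not_not.mpr h)) ?_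
    have hlie := lie_crossMatrix_lie_crossMatrix_vecMulVec s t
    rw [h, mul_zero, zero_smul, sub_zero] at hlie
    rw [← hlie]
    exact lie_crossMatrix_mem hJ hsymm ht (lie_crossMatrix_mem hJ hsymm hs htt)
  · refine mem_of_smul_mem (dotProduct_mem_range hJ hsymm htr hs ht) h ?_
    rw [← vecMulVec_mul_add_mul]
    exact hJ _ hss _ htt

theorem vecMulVec_add_vecMulVec_mem_of_isUnit_det [NeZero (2 : k)] (hJ : IsSpecialJordan J)
    (hsymm : ∀ x ∈ J, x.IsSymm) (htr : ∀ x ∈ J, trace x ∈ (algebraMap k K).range) (h1 : 1 ∈ J)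
    {S : Matrix (Fin 3) (Fin 3) K} (hS : IsUnit S.det)
    (hmem : ∀ i, S i ∈ axialVectors (J : Set (Matrix (Fin 3) (Fin 3) K))) (i j : Fin 3) :
    vecMulVec (S i) (S j) + vecMulVec (S j) (S i) ∈ J := by
  by_cases hij : i = j
  · subst hij
    have h := vecMulVec_self_mem hJ hsymm htr h1 (hmem i)
    exact J.add_mem h h
  by_cases hj : S i ⬝ᵥ S j ≠ 0 ∨ S j ⬝ᵥ S j ≠ 0
  · exact vecMulVec_add_vecMulVec_mem hJ hsymm htr h1 (hmem i) (hmem j) hj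
  by_cases hi : S i ⬝ᵥ S i ≠ 0
  · rw [add_comm]
    exact vecMulVec_add_vecMulVec_mem hJ hsymm htr h1 (hmem j) (hmem i) (.inr hi)
  push Not at hj hi
  have hdet : (S * Sᵀ).det ≠ 0 := by
    rw [det_mul, det_transpose]
    exact mul_ne_zero hS.ne_zero hS.ne_zero
  exact absurd (det_eq_zero_of_principal_submatrix_eq_zero hij hi hj.1
    ((dotProduct_comm _ _).trans hj.1) hj.2) hdet

theorem exists_isUnit_det_of_span_eq_top {n : ℕ} {s : Set (Fin n → K)}
    (hs : Submodule.span K s = ⊤) :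
    ∃ S : Matrix (Fin n) (Fin n) K, IsUnit S.det ∧ ∀ i, S i ∈ s := by
  have hex := Submodule.exists_fun_fin_finrank_span_eq K s
  rw [hs, finrank_top, Module.finrank_fin_fun] at hex
  obtain ⟨S, hS, -, hli⟩ := hex
  refine ⟨.of S, ?_, hS⟩
  rw [← isUnit_iff_isUnit_det, ← linearIndependent_rows_iff_isUnit]
  exact hli

theorem exists_gram_transpose_mul_mul_mem [NeZero (2 : k)] (hJ : IsSpecialJordan J)
    (hsymm : ∀ x ∈ J, x.IsSymm) (htr : ∀ x ∈ J, trace x ∈ (algebraMap k K).range) (h1 : 1 ∈ J)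
    (hspan : Submodule.span K (axialVectors (J : Set (Matrix (Fin 3) (Fin 3) K))) = ⊤) :
    ∃ (S : Matrix (Fin 3) (Fin 3) K) (G : Matrix (Fin 3) (Fin 3) k), IsUnit S.det ∧ G.IsSymm ∧
      S * Sᵀ = G.map (algebraMap k K) ∧
      ∀ Z : Matrix (Fin 3) (Fin 3) k, Z.IsSymm → Sᵀ * Z.map (algebraMap k K) * S ∈ J := by
  obtain ⟨S, hS, hmem⟩ := exists_isUnit_det_of_span_eq_top hspan
  choose G hG using fun i j => dotProduct_mem_range hJ hsymm htr (hmem i) (hmem j)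
  refine ⟨S, .of G, hS, ?_, ?_, fun Z hZ => mem_of_two_smul_mem ?_⟩
  · refine Matrix.IsSymm.ext fun i j => (algebraMap k K).injective ?_
    rw [of_apply, of_apply, hG, hG, dotProduct_comm]
  · ext i j
    exact (hG i j).symm
  · rw [← algebraMap_smul K (2 : k), map_ofNat, two_smul_transpose_mul_mul_eq_sum S (hZ.map _)]
    refine J.sum_mem fun i _ => J.sum_mem fun j _ => ?_
    rw [map_apply, algebraMap_smul]
    exact J.smul_mem _ (vecMulVec_add_vecMulVec_mem_of_isUnit_det hJ hsymm htr h1 hS hmem i j)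

theorem exists_diagonal_mul_mul_transpose_mem [NeZero (2 : k)] (hJ : IsSpecialJordan J)
    (hsymm : ∀ x ∈ J, x.IsSymm) (htr : ∀ x ∈ J, trace x ∈ (algebraMap k K).range) (h1 : 1 ∈ J)
    (hspan : Submodule.span K (axialVectors (J : Set (Matrix (Fin 3) (Fin 3) K))) = ⊤) :
    ∃ (P : (Matrix (Fin 3) (Fin 3) K)ˣ) (d : Fin 3 → kˣ),
      P.1ᵀ * P = (diagonal fun i => (d i : k)).map (algebraMap k K) ∧
      ∀ Z : Matrix (Fin 3) (Fin 3) k, Z.IsSymm → P.1 * Z.map (algebraMap k K) * P.1ᵀ ∈ J := by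
  obtain ⟨S, G, hS, hG, hSS, hmem⟩ := exists_gram_transpose_mul_mul_mem hJ hsymm htr h1 hspan
  obtain ⟨R, d, hR, rfl⟩ := exists_eq_mul_diagonal_mul_transpose hG
  have hR' : IsUnit Rᵀ.det := by rwa [det_transpose]
  have hPP : (R⁻¹.map (algebraMap k K) * S) * (R⁻¹.map (algebraMap k K) * S)ᵀ =
      (diagonal d).map (algebraMap k K) := by
    calc _ = R⁻¹.map (algebraMap k K) * (S * Sᵀ) * (R⁻¹.map (algebraMap k K))ᵀ := by
          simp only [transpose_mul, Matrix.mul_assoc]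
      _ = (R⁻¹ * (R * diagonal d * Rᵀ) * R⁻¹ᵀ).map (algebraMap k K) := by
          simp only [hSS, Matrix.map_mul, transpose_map]
      _ = _ := by
          rw [transpose_nonsing_inv, Matrix.mul_assoc R, nonsing_inv_mul_cancel_left _ _ hR,
            mul_nonsing_inv_cancel_right _ _ hR']
  have hP : IsUnit (R⁻¹.map (algebraMap k K) * S)ᵀ.det := by
    rw [det_transpose, det_mul]
    refine IsUnit.mul ?_ hS
    rw [← RingHom.mapMatrix_apply, ← RingHom.map_det]
    exact (isUnit_nonsing_inv_det _ hR).map _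
  have hd (i) : d i ≠ 0 := by
    have h := congrArg det hPP
    rw [det_mul, diagonal_map (map_zero _), det_diagonal] at h
    have h' := Finset.prod_ne_zero_iff.mp (h ▸ (mul_ne_zero
      (by rw [← det_transpose]; exact hP.ne_zero) hP.ne_zero)) i (Finset.mem_univ i)
    exact ne_of_apply_ne _ (h'.trans_eq (map_zero (algebraMap k K)).symm)
  refine ⟨((isUnit_iff_isUnit_det _).mpr hP).unit, fun i => Units.mk0 (d i) (hd i), ?_,
    fun Z hZ => ?_⟩
  · simpa using hPP
  · have h := hmem (R⁻¹ᵀ * Z * R⁻¹) (by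
      simp [Matrix.IsSymm, Matrix.mul_assoc, hZ.eq])
    simpa [Matrix.map_mul, transpose_map, Matrix.mul_assoc] using h

end SymmetricJordan

section ConjMap

variable {n k K : Type*} [Fintype n] [DecidableEq n] [Field k] [Field K] [Algebra k K]

/-- The homomorphism `X ↦ P X P⁻¹` from matrices over `k` to matrices over an extension field. -/
def conjMap (P : (Matrix n n K)ˣ) : Matrix n n k →ₐ[k] Matrix n n K :=
  (MulSemiringAction.toAlgHom k _ (ConjAct.toConjAct P)).comp (Algebra.ofId k K).mapMatrix

theorem conjMap_apply (P : (Matrix n n K)ˣ) (X : Matrix n n k) :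
    conjMap P X = P.1 * X.map (algebraMap k K) * P⁻¹.1 := rfl

theorem conjMap_injective (P : (Matrix n n K)ˣ) :
    Function.Injective (conjMap P : Matrix n n k → Matrix n n K) := fun _ _ h =>
  map_injective (algebraMap k K).injective
    (P.isUnit.mul_left_cancel (P⁻¹.isUnit.mul_right_cancel h))

theorem trace_conjMap (P : (Matrix n n K)ˣ) (X : Matrix n n k) :
    trace (conjMap P X) = algebraMap k K (trace X) := by
  rw [conjMap_apply, trace_units_conj]
  exact (AddMonoidHom.map_trace (algebraMap k K) X).symm

theorem conjMap_eq_mul_mul_transpose {d : n → kˣ} {P : (Matrix n n K)ˣ}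
    (hP : P.1ᵀ * P = (diagonal fun i => (d i : k)).map (algebraMap k K)) (X : Matrix n n k) :
    conjMap P X =
      P.1 * (X * diagonal fun i => ((d i)⁻¹ : k)).map (algebraMap k K) * P.1ᵀ := by
  have hinv : P⁻¹.1 = (diagonal fun i => ((d i)⁻¹ : k)).map (algebraMap k K) * P.1ᵀ := by
    refine Units.inv_eq_of_mul_eq_one_left ?_
    rw [Matrix.mul_assoc, hP, ← Matrix.map_mul, diagonal_mul_diagonal]
    simp
  rw [conjMap_apply, hinv, Matrix.map_mul]
  simp only [Matrix.mul_assoc]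

theorem isSymm_mul_diagonal_inv_of_mem_H3k {k : Type u} [Field k] {γ : Fin 3 → kˣ}
    {X : Matrix (Fin 3) (Fin 3) k} (hX : X ∈ H3k γ) :
    (X * diagonal fun i => ((γ i)⁻¹ : k)).IsSymm := by
  refine Matrix.IsSymm.ext fun i j => ?_
  have h := (mem_H3k_iff γ X).mp hX i j
  simp only [mul_diagonal]
  field_simp
  linear_combination -h

/-- The diagonal matrix with given units on the diagonal, as an invertible matrix. -/
def diagonalUnit (δ : n → Kˣ) : (Matrix n n K)ˣ where
  val := diagonal fun i => δ i
  inv := diagonal fun i => (δ i)⁻¹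
  val_inv := by simp
  inv_val := by simp

theorem conjMap_diagonalUnit_apply (δ : n → Kˣ) (X : Matrix n n k) (i j : n) :
    conjMap (diagonalUnit δ) X i j = δ i * algebraMap k K (X i j) * (δ j : K)⁻¹ := by
  change (diagonal (fun i => (δ i : K)) * X.map (algebraMap k K) *
    diagonal fun i => ((δ i)⁻¹ : K)) i j = _
  rw [mul_diagonal, diagonal_mul, map_apply]

theorem exists_transpose_mul_self_eq_diagonal [IsAlgClosed K] (d : n → kˣ) :
    ∃ δ : n → Kˣ, (diagonalUnit δ).1ᵀ * diagonalUnit δ =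
      (diagonal fun i => (d i : k)).map (algebraMap k K) := by
  choose δ hδ using fun i => IsAlgClosed.exists_pow_nat_eq (algebraMap k K (d i)) two_pos
  have hδ0 (i) : δ i ≠ 0 := by
    rw [← pow_ne_zero_iff two_ne_zero, hδ]
    simp
  refine ⟨fun i => Units.mk0 (δ i) (hδ0 i), ?_⟩
  simp [diagonalUnit, diagonal_map, ← hδ, sq]

end ConjMap

section ConjMapSpan

variable {k : Type u} {K : Type*} [Field k] [Field K] [Algebra k K]

theorem span_axialVectors_conjMap_H3k (γ : Fin 3 → kˣ) (δ : Fin 3 → Kˣ) :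
    Submodule.span K (axialVectors (Set.range fun X : H3k γ => conjMap (diagonalUnit δ) X.1)) =
      ⊤ := by
  rw [eq_top_iff, ← (Pi.basisFun K (Fin 3)).span_eq, Submodule.span_le]
  have mem_span (l : Fin 3) (c : K) (x y : Fin 6 → k) (hc : c ≠ 0)
      (h : axialVector ⁅conjMap (diagonalUnit δ) ((h3Equiv γ).symm x).1,
        conjMap (diagonalUnit δ) ((h3Equiv γ).symm y).1⁆ = c • Pi.single l 1) :
      Pi.single l 1 ∈ Submodule.span K
        (axialVectors (Set.range fun X : H3k γ => conjMap (diagonalUnit δ) X.1)) := by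
    rw [← Submodule.smul_mem_iff _ hc, ← h]
    exact Submodule.subset_span ⟨_, ⟨_, rfl⟩, _, ⟨_, rfl⟩, rfl⟩
  rintro _ ⟨l, rfl⟩
  rw [Pi.basisFun_apply]
  fin_cases l
  · refine mem_span _ (-(δ 2 * algebraMap k K (γ 1 / γ 2) * (δ 1)⁻¹)) ![0, 1, 0, 0, 0, 0]
      ![0, 0, 0, 1, 0, 0] (by simp) ?_
    ext i
    fin_cases i <;> simp [axialVector_apply, Ring.lie_def, Matrix.mul_apply, Fin.sum_univ_three,
      conjMap_diagonalUnit_apply, coe_h3Equiv_symm]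
  · refine mem_span _ (-(δ 0 * algebraMap k K (γ 2 / γ 0) * (δ 2)⁻¹)) ![0, 0, 1, 0, 0, 0]
      ![0, 0, 0, 0, 1, 0] (by simp) ?_
    ext i
    fin_cases i <;> simp [axialVector_apply, Ring.lie_def, Matrix.mul_apply, Fin.sum_univ_three,
      conjMap_diagonalUnit_apply, coe_h3Equiv_symm]
  · refine mem_span _ (-(δ 1 * algebraMap k K (γ 0 / γ 1) * (δ 0)⁻¹)) ![1, 0, 0, 0, 0, 0]
      ![0, 0, 0, 0, 0, 1] (by simp) ?_
    ext i
    fin_cases i <;> simp [axialVector_apply, Ring.lie_def, Matrix.mul_apply, Fin.sum_univ_three,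
      conjMap_diagonalUnit_apply, coe_h3Equiv_symm]

end ConjMapSpan

section Recognition

variable {k : Type u} {K A : Type*} [Field k] [NeZero (2 : k)] [Field K] [Algebra k K]
  [NonUnitalNonAssocRing A] [Module k A]

theorem exists_algIso_H3k_of_range (hA : Module.finrank k A = 6)
    (f : A →ₗ[k] Matrix (Fin 3) (Fin 3) K) (hf : Function.Injective f)
    (hmul : ∀ a b, f (a * b) = (2⁻¹ : k) • (f a * f b + f b * f a)) (hsymm : ∀ a, (f a).IsSymm)
    (htr : ∀ a, trace (f a) ∈ (algebraMap k K).range) (h1 : 1 ∈ Set.range f)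
    (hspan : Submodule.span K (axialVectors (Set.range f)) = ⊤) :
    ∃ γ : Fin 3 → kˣ, AlgIso k A (H3k γ) := by
  have hJ : IsSpecialJordan (LinearMap.range f) := by
    rintro _ ⟨a, rfl⟩ _ ⟨b, rfl⟩
    exact ⟨(2 : k) • (a * b), by rw [map_smul, hmul, smul_inv_smul₀ (NeZero.ne _)]⟩
  obtain ⟨P, γ, hP, hmem⟩ := exists_diagonal_mul_mul_transpose_mem hJ
    (Set.forall_mem_range.mpr hsymm) (Set.forall_mem_range.mpr htr) h1 hspan
  have hrange (X : H3k γ) : conjMap P X.1 ∈ LinearMap.range f := by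
    rw [conjMap_eq_mul_mul_transpose hP]
    exact hmem _ (isSymm_mul_diagonal_inv_of_mem_H3k X.2)
  let e : A ≃ₗ[k] LinearMap.range f := .ofInjective f hf
  let φ : H3k γ →ₗ[k] A := e.symm.toLinearMap ∘ₗ
    ((conjMap P).toLinearMap ∘ₗ (H3k γ).subtype).codRestrict (LinearMap.range f) hrange
  have hφ (X : H3k γ) : f (φ X) = conjMap P X.1 :=
    LinearEquiv.ofInjective_symm_apply (h := hf) f _
  have hφ_inj : Function.Injective φ := fun _ _ h =>
    Subtype.ext (conjMap_injective P (by rw [← hφ, ← hφ, h]))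
  have hφ_mul (X Y : H3k γ) : φ (X * Y) = φ X * φ Y := hf <| by
    rw [hφ, hmul, hφ, hφ, coe_mul, map_smul, map_add, map_mul, map_mul]
  have : Module.Finite k A := Module.finite_of_finrank_pos (by rw [hA]; norm_num)
  exact ⟨γ, AlgIso.symm ⟨{ φ with
    map_zero' := map_zero φ
    map_mul' := hφ_mul }, hφ_inj,
    (LinearMap.injective_iff_surjective_of_finrank_eq_finrank (by rw [finrank_H3k, hA])).mp hφ_inj⟩⟩

end Recognition

/-! ### Freudenthal algebras of dimension six -/

section Reduced

variable {K : Type u} {C : Type*} [Field K] [NonAssocRing C] [Module K C] [IsScalarTower K C C]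
  [SMulCommClass K C C] (N : QuadraticForm K C) [IsComposition N] (γ : Fin 3 → Kˣ)

theorem conj_one : conj N 1 = 1 := by
  rw [conj_apply, QuadraticMap.polar_self, map_one_eq, nsmul_one, Nat.cast_two, two_smul,
    add_sub_cancel_right]

/-- The element of `H₃(C, Γ)` with given scalars on the diagonal and given entries above it. -/
def h3OfEntries : (Fin 3 → K) × (Fin 3 → C) →ₗ[K] H3 N γ where
  toFun p := ⟨!![p.1 0 • 1, p.2 0, p.2 1;
    ((γ 0 / γ 1 : Kˣ) : K) • conj N (p.2 0), p.1 1 • 1, p.2 2;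
    ((γ 0 / γ 2 : Kˣ) : K) • conj N (p.2 1), ((γ 1 / γ 2 : Kˣ) : K) • conj N (p.2 2), p.1 2 • 1], by
    change starGamma N γ _ = _
    ext i j
    fin_cases i <;> fin_cases j <;> simp [starGamma, conj_one, conj_conj, smul_smul,
      div_eq_inv_mul, mul_assoc]⟩
  map_add' p q := by
    ext i j
    fin_cases i <;> fin_cases j <;> simp [add_smul]
  map_smul' c p := by
    ext i j
    fin_cases i <;> fin_cases j <;> simp [mul_smul, smul_comm c]

theorem h3OfEntries_injective : Function.Injective (h3OfEntries N γ) := by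
  have := IsComposition.nontrivial (N := N)
  intro p q h
  have entry (i j) : (h3OfEntries N γ p).1 i j = (h3OfEntries N γ q).1 i j := by rw [h]
  have smul_inj := smul_left_injective K (one_ne_zero (α := C))
  refine Prod.ext (funext fun i => ?_) (funext fun i => ?_)
  · fin_cases i
    · exact smul_inj (entry 0 0)
    · exact smul_inj (entry 1 1)
    · exact smul_inj (entry 2 2)
  · fin_cases i
    · exact entry 0 1
    · exact entry 0 2
    · exact entry 1 2

variable {N γ}

theorem finrank_eq_one_of_finrank_H3 (h : Module.finrank K (H3 N γ) = 6) :
    Module.finrank K C = 1 := by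
  have := IsComposition.nontrivial (N := N)
  have : Module.Finite K (H3 N γ) := Module.finite_of_finrank_pos (by rw [h]; norm_num)
  have : Module.Finite K ((Fin 3 → K) × (Fin 3 → C)) :=
    Module.Finite.of_injective _ (h3OfEntries_injective N γ)
  have : Module.Finite K C := Module.Finite.of_surjective
    (LinearMap.proj 0 ∘ₗ LinearMap.snd K (Fin 3 → K) (Fin 3 → C)) fun c => ⟨(0, fun _ => c), rfl⟩
  have hle := LinearMap.finrank_le_finrank_of_injective (h3OfEntries_injective N γ)
  simp only [h, Module.finrank_prod, Module.finrank_pi_fintype, Module.finrank_self,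
    Finset.sum_const, Finset.card_univ, Fintype.card_fin, smul_eq_mul] at hle
  have := Module.finrank_pos (R := K) (M := C)
  omega

theorem algIso_H3k_H3_of_finrank_eq_one [NeZero (2 : K)] (h : Module.finrank K C = 1) :
    AlgIso K (H3k γ) (H3 N γ) := by
  have := IsComposition.nontrivial (N := N)
  let e : K ≃ₗ[K] C := .ofBijective (LinearMap.toSpanSingleton K C 1)
    ⟨smul_left_injective K one_ne_zero, (finrank_eq_one_iff_of_nonzero' 1 one_ne_zero).mp h⟩
  have he (c : K) : e c = c • 1 := rfl
  refine algIso_H3_of_linearEquiv e.mapMatrix (fun X Y => ?_) (fun X => ?_)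
  · ext i j
    simp [he, Matrix.mul_apply, Finset.sum_smul, smul_smul, mul_comm]
  · have hstar : starGamma N γ (e.mapMatrix X) = e.mapMatrix (starGamma QuadraticMap.sq γ X) := by
      ext i j
      simp [starGamma, he, conj_one, conj_sq, smul_smul]
    change starGamma QuadraticMap.sq γ X = X ↔ starGamma N γ (e.mapMatrix X) = e.mapMatrix X
    rw [hstar, e.mapMatrix.injective.eq_iff]

end Reduced

section H3kUnit

variable {k : Type u} [Field k] (γ : Fin 3 → kˣ)

theorem one_mem_H3k : (1 : Matrix (Fin 3) (Fin 3) k) ∈ H3k γ := by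
  rw [mem_H3k_iff]
  intro i j
  obtain rfl | h := eq_or_ne i j
  · rfl
  · rw [one_apply_ne h, one_apply_ne h.symm, mul_zero, mul_zero]

variable [NeZero (2 : k)] (X : H3k γ)

theorem one_mul_H3k : ⟨1, one_mem_H3k γ⟩ * X = X := by
  apply Subtype.ext
  rw [coe_mul, Matrix.one_mul, Matrix.mul_one, ← two_smul k, inv_smul_smul₀ (NeZero.ne _)]

theorem mul_one_H3k : X * ⟨1, one_mem_H3k γ⟩ = X := by
  apply Subtype.ext
  rw [coe_mul, Matrix.one_mul, Matrix.mul_one, ← two_smul k, inv_smul_smul₀ (NeZero.ne _)]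

end H3kUnit

section BaseChange

variable {k K A : Type*} [Field k] [Field K] [Algebra k K] [NonUnitalNonAssocRing A] [Module k A]
  [IsScalarTower k A A] [SMulCommClass k A A]

theorem baseChange_mulLeft (a : A) :
    (LinearMap.mulLeft k a).baseChange K = LinearMap.mulLeft K ((1 : K) ⊗ₜ[k] a) := by
  ext b
  simp

omit [IsScalarTower k A A] [SMulCommClass k A A] in
theorem span_range_map_one_tmul {M : Type*} [AddCommGroup M] [Module K M] {f : K ⊗[k] A →ₗ[K] M}
    (hf : Function.Surjective f) : Submodule.span K (Set.range fun a : A => f (1 ⊗ₜ a)) = ⊤ := by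
  rw [← LinearMap.range_eq_top.mpr hf, LinearMap.range_eq_map, ← Submodule.baseChange_top,
    Submodule.baseChange_eq_span, Submodule.map_span, Submodule.map_top]
  simp only [LinearMap.coe_range, ← Set.range_comp]
  rfl

theorem exists_mul_eq_of_one_tmul_mul_eq {u : K ⊗[k] A}
    (hu : ∀ a : A, u * 1 ⊗ₜ a = 1 ⊗ₜ a) : ∃ e : A, ∀ a, e * a = a := by
  obtain ⟨π, hπ⟩ := (Algebra.linearMap k K).exists_leftInverse_of_injective
    (LinearMap.ker_eq_bot.mpr (algebraMap k K).injective)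
  have hπ1 : π 1 = 1 := by simpa using LinearMap.congr_fun hπ 1
  let ρ : K ⊗[k] A →ₗ[k] A := TensorProduct.lid k A ∘ₗ LinearMap.rTensor A π
  have hρ (c : K) (a : A) : ρ (c ⊗ₜ a) = π c • a := by simp [ρ]
  have hρ_mul (z : K ⊗[k] A) (a : A) : ρ (z * 1 ⊗ₜ a) = ρ z * a := by
    induction z with
    | zero => simp
    | tmul c b => rw [Algebra.TensorProduct.tmul_mul_tmul, mul_one, hρ, hρ, smul_mul_assoc]
    | add x y hx hy => rw [add_mul, map_add, map_add, hx, hy, add_mul]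
  exact ⟨ρ u, fun a => by rw [← hρ_mul, hu, hρ, hπ1, one_smul]⟩

theorem exists_one_tmul_eq_of_mul_eq {u : K ⊗[k] A} (hu : ∀ z, u * z = z) (hu' : ∀ z, z * u = z) :
    ∃ e : A, (1 : K) ⊗ₜ[k] e = u := by
  obtain ⟨e, he⟩ := exists_mul_eq_of_one_tmul_mul_eq fun a => hu (1 ⊗ₜ a)
  have hid : LinearMap.mulLeft K ((1 : K) ⊗ₜ[k] e) = LinearMap.id := by
    ext a
    simp [he]
  exact ⟨e, (hu' _).symm.trans (LinearMap.congr_fun hid u)⟩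

theorem algIso_self_tensorProduct : AlgIso k (k ⊗[k] A) A := by
  refine ⟨{ TensorProduct.lid k A with
    map_smul' := (TensorProduct.lid k A).map_smul
    map_zero' := (TensorProduct.lid k A).map_zero
    map_mul' := fun x y => ?_ }, (TensorProduct.lid k A).bijective⟩
  change TensorProduct.lid k A (x * y) = TensorProduct.lid k A x * TensorProduct.lid k A y
  induction x with
  | zero => simp
  | add x y hx hy => rw [add_mul, map_add, map_add, hx, hy, add_mul]
  | tmul c a =>
    induction y with
    | zero => simp
    | add x y hx hy => rw [mul_add, map_add, map_add, hx, hy, mul_add]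
    | tmul d b => simp [smul_mul_smul_comm]

omit [IsScalarTower k A A] [SMulCommClass k A A] in
theorem finrank_eq_of_algIso {B : Type*} [NonUnitalNonAssocRing B] [Module k B]
    (h : AlgIso k A B) : Module.finrank k A = Module.finrank k B := by
  obtain ⟨f, hf⟩ := h
  exact (LinearEquiv.ofBijective (f : A →ₗ[k] B) hf).finrank_eq

end BaseChange

section Descent

variable {k K : Type u} {A : Type v} [Field k] [Field K] [Algebra k K] [NonUnitalNonAssocRing A]
  [Module k A] [IsScalarTower k A A] [SMulCommClass k A A] [NeZero (2 : K)] {γ : Fin 3 → Kˣ}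
  {g : K ⊗[k] A →ₙₐ[K] H3k γ} (hg : Function.Bijective g)

include hg

theorem two_mul_trace_map_one_tmul [Module.Finite k A] (a : A) :
    2 * trace (g (1 ⊗ₜ a)).1 = algebraMap k K (LinearMap.trace k A (LinearMap.mulLeft k a)) := by
  rw [← trace_mulLeft_H3k, trace_mulLeft_map_of_bijective g hg, ← baseChange_mulLeft,
    LinearMap.trace_baseChange]

theorem exists_map_one_tmul_eq_one : ∃ a : A, (g (1 ⊗ₜ a)).1 = 1 := by
  obtain ⟨u, hu⟩ := hg.2 ⟨1, one_mem_H3k γ⟩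
  obtain ⟨a, rfl⟩ := exists_one_tmul_eq_of_mul_eq (u := u)
    (fun z => hg.1 (by rw [map_mul, hu, one_mul_H3k]))
    (fun z => hg.1 (by rw [map_mul, hu, mul_one_H3k]))
  exact ⟨a, congrArg Subtype.val hu⟩

theorem exists_algIso_H3k_of_baseChange [NeZero (2 : k)] (hA : Module.finrank k A = 6) :
    ∃ δ : Fin 3 → kˣ, AlgIso k A (H3k δ) := by
  have : Module.Finite k A := Module.finite_of_finrank_pos (by rw [hA]; norm_num)
  have : NeZero (2 : AlgebraicClosure K) := neZero_two_of_algebra K _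
  obtain ⟨δ, hδ⟩ := exists_transpose_mul_self_eq_diagonal (K := AlgebraicClosure K) γ
  let ψ : H3k γ →ₗ[K] Matrix (Fin 3) (Fin 3) (AlgebraicClosure K) :=
    (conjMap (diagonalUnit δ)).toLinearMap ∘ₗ (H3k γ).subtype
  let f : A →ₗ[k] Matrix (Fin 3) (Fin 3) (AlgebraicClosure K) :=
    ψ.restrictScalars k ∘ₗ (g : K ⊗[k] A →ₗ[K] H3k γ).restrictScalars k ∘ₗ
      TensorProduct.mk k K A 1
  have hf (a) : f a = conjMap (diagonalUnit δ) (g (1 ⊗ₜ a)).1 := rfl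
  refine exists_algIso_H3k_of_range hA f ?_ (fun a b => ?_) (fun a => ?_) (fun a => ?_) ?_ ?_
  · exact (conjMap_injective _).comp (Subtype.val_injective.comp
      (hg.1.comp (Module.FaithfullyFlat.tensorProduct_mk_injective A)))
  · have hab : (1 : K) ⊗ₜ[k] (a * b) = 1 ⊗ₜ a * 1 ⊗ₜ b := by
      rw [Algebra.TensorProduct.tmul_mul_tmul, mul_one]
    rw [hf, hf, hf, hab, map_mul, coe_mul, map_smul, map_add, map_mul, map_mul,
      ← algebraMap_smul K (2⁻¹ : k), map_inv₀, map_ofNat]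
  · rw [hf, conjMap_eq_mul_mul_transpose hδ]
    rw [Matrix.IsSymm, transpose_mul, transpose_mul, transpose_transpose, ← transpose_map,
      (isSymm_mul_diagonal_inv_of_mem_H3k (g (1 ⊗ₜ a)).2).eq, Matrix.mul_assoc]
  · refine ⟨2⁻¹ * LinearMap.trace k A (LinearMap.mulLeft k a), ?_⟩
    rw [hf, trace_conjMap, IsScalarTower.algebraMap_apply k K (AlgebraicClosure K), map_mul,
      ← two_mul_trace_map_one_tmul hg, map_inv₀, map_ofNat, inv_mul_cancel_left₀ (NeZero.ne _)]
  · obtain ⟨a, ha⟩ := exists_map_one_tmul_eq_one hg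
    exact ⟨a, by rw [hf, ha, map_one]⟩
  · refine span_axialVectors_eq_top_of_subset_span ?_ (span_axialVectors_conjMap_H3k γ δ)
    rintro _ ⟨X, rfl⟩
    have hX : X ∈ Submodule.span K (Set.range fun a : A => g (1 ⊗ₜ a)) :=
      span_range_map_one_tmul (f := (g : K ⊗[k] A →ₗ[K] H3k γ)) hg.2 ▸ Submodule.mem_top
    refine Submodule.span_subset_span K _ _ ?_
    have := Submodule.apply_mem_span_image_of_mem_span ψ hX
    rwa [← Set.range_comp] at this

end Descent

theorem isFreudenthal_and_finrank_iff {k : Type u} [Field k] [NeZero (2 : k)] (A : Type v)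
    [NonUnitalNonAssocRing A] [Module k A] [IsScalarTower k A A] [SMulCommClass k A A] :
    (IsFreudenthal k A ∧ Module.finrank k A = 6) ↔ ∃ γ : Fin 3 → kˣ, AlgIso k A (H3k γ) := by
  constructor
  · rintro ⟨⟨K, _, _, C, _, _, _, _, N, _, γ, h⟩, hA⟩
    have := neZero_two_of_algebra k K
    have hH3 : Module.finrank K (H3 N γ) = 6 := by
      rw [← finrank_eq_of_algIso h, Module.finrank_baseChange, hA]
    obtain ⟨g, hg⟩ :=
      h.trans (algIso_H3k_H3_of_finrank_eq_one (finrank_eq_one_of_finrank_H3 hH3)).symm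
    exact exists_algIso_H3k_of_baseChange hg hA
  · rintro ⟨γ, h⟩
    exact ⟨⟨k, _, _, k, _, _, inferInstance, inferInstance, QuadraticMap.sq, inferInstance, γ,
      algIso_self_tensorProduct.trans h⟩, by rw [finrank_eq_of_algIso h, finrank_H3k]⟩

end Freud

theorem theorem6p1_general {k : Type u} [Field k] [NeZero (2 : k)] :
    (∃ (Φ : H3Classes k ≃ QuatClasses k) (Ψ : X2Orbits k ≃ QuatClasses k),
      (∀ (γ : Fin 3 → kˣ) (Q : QuatAlg k),
        Φ (Quotient.mk (h3Setoid k) γ) = Quotient.mk (quatSetoid k) Q ↔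
          QuadraticMap.Equivalent Q.norm
            (diagForm 1 ((γ 1 : k) / γ 2) ((γ 2 : k) / γ 0) ((γ 0 : k) / γ 1))) ∧
      (∀ a b c : kˣ, ∃ hx : diagElt (a : k) (b : k) (c : k) ∈ X2 k, ∀ Q : QuatAlg k,
        Ψ (Quotient.mk (x2Setoid k) ⟨diagElt (a : k) (b : k) (c : k), hx⟩) =
            Quotient.mk (quatSetoid k) Q ↔
          QuadraticMap.Equivalent Q.norm (diagForm 1 ((b : k) * c) (c * a) (a * b)))) ∧
    (∀ (A : Type v) [NonUnitalNonAssocRing A] [Module k A] [IsScalarTower k A A]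
        [SMulCommClass k A A],
      (IsFreudenthal k A ∧ Module.finrank k A = 6) ↔ ∃ γ : Fin 3 → kˣ, AlgIso k A (H3k γ)) := by
  obtain ⟨Φ, hΦ⟩ := exists_equiv_H3Classes (k := k)
  obtain ⟨Ψ, hΨ⟩ := exists_equiv_X2Orbits (k := k)
  exact ⟨⟨Φ, Ψ, hΦ, hΨ⟩, fun A _ _ _ _ => isFreudenthal_and_finrank_iff A⟩

theorem theorem6p1 {k : Type u} [Field k] [NeZero (2 : k)] [NeZero (3 : k)] :
    (∃ (Φ : H3Classes k ≃ QuatClasses k) (Ψ : X2Orbits k ≃ QuatClasses k),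
      (∀ (γ : Fin 3 → kˣ) (Q : QuatAlg k),
        Φ (Quotient.mk (h3Setoid k) γ) = Quotient.mk (quatSetoid k) Q ↔
          QuadraticMap.Equivalent Q.norm
            (diagForm 1 ((γ 1 : k) / γ 2) ((γ 2 : k) / γ 0) ((γ 0 : k) / γ 1))) ∧
      (∀ a b c : kˣ, ∃ hx : diagElt (a : k) (b : k) (c : k) ∈ X2 k, ∀ Q : QuatAlg k,
        Ψ (Quotient.mk (x2Setoid k) ⟨diagElt (a : k) (b : k) (c : k), hx⟩) =
            Quotient.mk (quatSetoid k) Q ↔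
          QuadraticMap.Equivalent Q.norm (diagForm 1 ((b : k) * c) (c * a) (a * b)))) ∧
    (∀ (A : Type v) [NonUnitalNonAssocRing A] [Module k A] [IsScalarTower k A A]
        [SMulCommClass k A A],
      (IsFreudenthal k A ∧ Module.finrank k A = 6) ↔ ∃ γ : Fin 3 → kˣ, AlgIso k A (H3k γ)) := by
  exact theorem6p1_general
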